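/- **Setting.** Fix a first-order signature (variables, function symbols, predicate symbols), a set of indices, and a theory $\mathcal T$ (a set of sentences, e.g. a finite set of universal axioms; $\mathcal T=\emptyset$ is pure logic). *Quantifier-free formulae* $P$ are built from positive and negated atoms by $\wedge,\vee$; *prenex formulae* are $A ::= P \mid \exists x.A\mid\forall x.A$, up to renaming of bound variables; $\bar A$ is the De Morgan dual. *Expansion trees* $t:A$ are generated by: * $S:P$, for $S$ a nonempty finite set of indices; * $\alpha[a].t:\forall x.A$, for a variable $a$ and $t:A[x:=a]$; * $(w_1+\dots+w_n):\exists x.A$, a nonempty unordered formal sum of witnesses $w_k=\varepsilon[M_k].t_k:\langle\exists x.A\rangle$, with $M_k$ a first-order term and $t_k:A[x:=M_k]$. A *cut* is $t\bowtie s:A\bowtie\bar A$ with $t:A$ and $s:\bar A$. A *typed forest* is a finite multiset of expansion trees, witnesses ("naked" witnesses) and cuts, called its roots. Its nodes are the instances of subterms of its roots; it *binds* $a$ if it has a node $\alpha[a].t$. Its *type* is the multiset of the types of its non-cut roots. An *annotated sequent* is a typed forest without naked witnesses in which distinct $\alpha$-nodes have distinct variables (eigenvariables), and no bound variable is free in the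 type of a non-cut root. **Herbrand nets.** The *dependency graph* of a typed forest $F$ has as vertices the nodes of $F$ and the indices occurring in $F$. Its directed edges go from each node to its parent in the forest; from $\varepsilon[M].t$ to $\alpha[a].s$ whenever $a$ is free in $M$; from a cut of type $A\bowtie\bar A$ to $\alpha[a].s$ whenever $a$ is free in $A$; and from an index $i$ to each leaf $S$ with $i\in S$. A *switching* chooses, for each $\alpha$-node, each sum node and each leaf, one incoming edge; its *switching graph* is the undirected graph obtained by deleting the other incoming edges of these nodes and forgetting directions. $F$ is *ACC-correct* if every switching graph is connected (in particular nonempty) and acyclic. $F$ is *propositionally correct* if for each index $i$ occurring in $F$, $\mathcal T\vDash\bigvee\{P \mid S:P \text{ a leaf of } F,\ i\in S\}$. A *Herbrand net* is an annotated sequent that is propositionally correct and ACC-correct. **The calculus $\mathbf{LK}_H$** has these rules on typed forests (considered as multisets): * tautology rule with index $i$: if $n\ge 1$ and $\mathcal T\vDash P_1\vee\dots\vee P_n$, infer $\{i\}:P_1,\dots,\{i\}:P_n$; * $\forall$: from $F,\ t:A[x:=a]$ infer $F,\ \alpha[a].t:\forall x.A$; * $\exists$: from $F,\ t:A[x:=M]$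 infer $F,\ (\varepsilon[M].t):\exists x.A$; * contraction: from $F,\ t:\exists x.A,\ s:\exists x.A$ infer $F,\ t+s:\exists x.A$; * contraction: from $F,\ S:P,\ S':P$ infer $F,\ S\cup S':P$; * cut: from $F,\ t:A$ and $G,\ s:\bar A$ infer $F,\ G,\ t\bowtie s:A\bowtie\bar A$. A proof is *strict* if its tautology rules carry pairwise distinct indices, its $\forall$-rules have pairwise distinct eigenvariables, and, for each $\forall$-rule, its eigenvariable $a$ is free neither in the type of any sequent, nor in the witnessing term $M$ of any instance of the $\exists$-rule, that lies outside the subproof above that $\forall$-rule. **Theorem (Sequentialization).** An annotated sequent $F$ is a Herbrand net if and only if it is the endsequent of a strict $\mathbf{LK}_H$ proof. -/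

import Mathlib

namespace Herbrand

universe u v w x

/-! ### Prenex formulae -/

section Formulae

variable (L : FirstOrder.Language.{u, v})

/-- Quantifier-free formulae in negation normal form, with variables in `β`. The Boolean of an
atomic formula is its polarity (`true` for `p(M₁,…,Mₙ)`, `false` for `p̄(M₁,…,Mₙ)`). -/
inductive QFF (β : Type w) : Type (max u v w)
  | lit (pos : Bool) {k : ℕ} (p : L.Relations k) (ts : Fin k → L.Term β) : QFF β
  | and (P Q : QFF β) : QFF β
  | or (P Q : QFF β) : QFF β

/-- Prenex formulae with free variables in `V` and `n` dangling bound variables, modulo renaming of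
bound variables: a quantifier binds the last of the `n + 1` dangling variables of its body.
The prenex formulae proper are those in `Prenex L V 0`. -/
inductive Prenex (V : Type w) : ℕ → Type (max u v w)
  | qf {n : ℕ} (P : QFF L (V ⊕ Fin n)) : Prenex V n
  | all {n : ℕ} (A : Prenex V (n + 1)) : Prenex V n
  | ex {n : ℕ} (A : Prenex V (n + 1)) : Prenex V n

end Formulae

variable {L : FirstOrder.Language.{u, v}} {V : Type w} {I : Type x}

namespace QFF

variable {β : Type*} {γ : Type*}

/-- De Morgan dual. -/
def dual : QFF L β → QFF L β
  | lit pos p ts => lit (!pos) p ts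
  | and P Q => or P.dual Q.dual
  | or P Q => and P.dual Q.dual

/-- Simultaneous substitution of terms for variables. -/
def subst (σ : β → L.Term γ) : QFF L β → QFF L γ
  | lit pos p ts => lit pos p (fun i => (ts i).subst σ)
  | and P Q => and (P.subst σ) (Q.subst σ)
  | or P Q => or (P.subst σ) (Q.subst σ)

open Classical in
/-- The free variables, dangling bound variables not counted. -/
noncomputable def free {n : ℕ} : QFF L (V ⊕ Fin n) → Set V
  | lit _ _ ts => ⋃ i, ((ts i).varFinsetLeft : Set V)
  | and P Q => P.free ∪ Q.free
  | or P Q => P.free ∪ Q.free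

/-- Tarskian truth in a structure `M` under a valuation. -/
def Realize {M : Type*} [L.Structure M] (val : β → M) : QFF L β → Prop
  | lit true p ts => FirstOrder.Language.Structure.RelMap p (fun i => (ts i).realize val)
  | lit false p ts => ¬ FirstOrder.Language.Structure.RelMap p (fun i => (ts i).realize val)
  | and P Q => P.Realize val ∧ Q.Realize val
  | or P Q => P.Realize val ∨ Q.Realize val

end QFF

namespace Prenex

/-- De Morgan dual. -/
def dual : {n : ℕ} → Prenex L V n → Prenex L V n
  | _, qf P => qf P.dual
  | _, all A => ex A.dual
  | _, ex A => all A.dual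

/-- Replace the dangling variable `0` by `M`, and number the other ones down by one. -/
def instVar (M : L.Term V) (n : ℕ) : V ⊕ Fin (n + 1) → L.Term (V ⊕ Fin n) :=
  Sum.elim (fun a => .var (.inl a))
    (fun k => Fin.cases (motive := fun _ => L.Term (V ⊕ Fin n))
      (M.relabel Sum.inl) (fun j => .var (.inr j)) k)

/-- Capture-avoiding substitution of `M` for the outermost dangling variable: if `A : Prenex L V 1`
is the body of the formula `∀x.A` or `∃x.A`, then `A.inst M` is `A[x := M]`. -/
def inst (M : L.Term V) : {n : ℕ} → Prenex L V (n + 1) → Prenex L V n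
  | n, qf P => qf (P.subst (instVar M n))
  | _, all A => all (A.inst M)
  | _, ex A => ex (A.inst M)

/-- The free variables. -/
noncomputable def free : {n : ℕ} → Prenex L V n → Set V
  | _, qf P => P.free
  | _, all A => A.free
  | _, ex A => A.free

end Prenex

/-- The free variables of a first-order term. -/
noncomputable def termFree (M : L.Term V) : Set V :=
  open Classical in (M.varFinset : Set V)

/-- `T ⊨ ⋁ S`: in every (nonempty) model of `T`, under every valuation of the free variables, some
member of `S` is true. -/
def Valid (T : L.Theory) (S : Set (QFF L (V ⊕ Fin 0))) : Prop :=
  ∀ (M : FirstOrder.Language.Theory.ModelType.{u, v, max u v w} T) (val : V → M),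
    ∃ P ∈ S, P.Realize (Sum.elim val (fun k : Fin 0 => k.elim0))

/-! ### Typed terms and typed forests -/

variable (L V I) in
/-- Typed expansion trees `t : A` over the index set `I`; an inhabitant of `Tree L V I A` is a
typing derivation of an expansion tree of type `A`.
* `leaf P S` is `S : P`, with `S` a nonempty finite set of indices;
* `alpha A a t` is `α[a].t : ∀x.A`, for `t : A[x:=a]`;
* `sum A n M t` is `(ε[M₀].t₀ + ⋯ + ε[Mₙ].tₙ) : ∃x.A`, for `tₖ : A[x:=Mₖ]`. The order in which the
  summands are enumerated is immaterial: see the contraction rule of the sequent calculus. -/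
inductive Tree : Prenex L V 0 → Type (max u v w x)
  | leaf (P : QFF L (V ⊕ Fin 0)) (S : Finset I) (hS : S.Nonempty) : Tree (.qf P)
  | alpha (A : Prenex L V 1) (a : V) (t : Tree (A.inst (.var a))) : Tree (.all A)
  | sum (A : Prenex L V 1) (n : ℕ) (M : Fin (n + 1) → L.Term V)
      (t : ∀ k, Tree (A.inst (M k))) : Tree (.ex A)

variable (L V I) in
/-- The possible roots of a typed forest: the typed terms of the three kinds.
* `tree A t` is an expansion tree `t : A`;
* `witness A M t` is a naked witness `ε[M].t : ⟨∃x.A⟩`, for `t : A[x:=M]`;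
* `cut A t s` is a cut `t ⋈ s : A ⋈ Ā`, for `t : A` and `s : Ā`. -/
inductive Root : Type (max u v w x)
  | tree (A : Prenex L V 0) (t : Tree L V I A) : Root
  | witness (A : Prenex L V 1) (M : L.Term V) (t : Tree L V I (A.inst M)) : Root
  | cut (A : Prenex L V 0) (t : Tree L V I A) (s : Tree L V I A.dual) : Root

variable (L V I) in
/-- Typed forests, listed by their roots. Equality of typed forests is `List.Perm`. -/
abbrev Forest := List (Root L V I)

variable (L V I) in
/-- The labels of the nodes of a typed forest. -/
inductive Label : Type (max u v w x)
  | leaf (P : QFF L (V ⊕ Fin 0)) (S : Finset I) : Label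
  | alpha (a : V) : Label
  | plus : Label
  | eps (M : L.Term V) : Label
  | cut (A : Prenex L V 0) : Label

/-- The labels of switched nodes: `α`-nodes, expansion nodes and propositional nodes. -/
def Label.IsSwitched : Label L V I → Prop
  | .leaf _ _ => True
  | .alpha _ => True
  | .plus => True
  | .eps _ => False
  | .cut _ => False

namespace Tree

/-- The nodes (instances of subterms) of an expansion tree. The outermost node of a term is `none`
(or `()`), and in a sum the node `some ⟨k, none⟩` is the `ε`-node of the `k`-th summand. -/
def Node : {A : Prenex L V 0} → Tree L V I A → Type
  | _, leaf _ _ _ => Unit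
  | _, alpha _ _ t => Option t.Node
  | _, sum _ n _ t => Option (Σ k : Fin (n + 1), Option (t k).Node)

/-- The label of a node. -/
def label : {A : Prenex L V 0} → (t : Tree L V I A) → t.Node → Label L V I
  | _, leaf P S _, _ => .leaf P S
  | _, alpha _ a t, y =>
    match (show Option t.Node from y) with
    | none => .alpha a
    | some y => t.label y
  | _, sum _ n M t, y =>
    match (show Option (Σ k : Fin (n + 1), Option (t k).Node) from y) with
    | none => .plus
    | some ⟨k, none⟩ => .eps (M k)
    | some ⟨k, some y⟩ => (t k).label y

/-- The parent of a node (`none` for the root). -/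
def parent : {A : Prenex L V 0} → (t : Tree L V I A) → t.Node → Option t.Node
  | _, leaf _ _ _, _ => none
  | _, alpha _ _ t, y =>
    match (show Option t.Node from y) with
    | none => none
    | some y => some (t.parent y)
  | _, sum _ n _ t, y =>
    match (show Option (Σ k : Fin (n + 1), Option (t k).Node) from y) with
    | none => none
    | some ⟨_, none⟩ => some (none : Option (Σ k : Fin (n + 1), Option (t k).Node))
    | some ⟨k, some y⟩ =>
      some (some ⟨k, (t k).parent y⟩ : Option (Σ k : Fin (n + 1), Option (t k).Node))

end Tree

namespace Root

/-- The nodes of a typed term. -/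
def Node : Root L V I → Type
  | tree _ t => t.Node
  | witness _ _ t => Option t.Node
  | cut _ t s => Option (t.Node ⊕ s.Node)

/-- The label of a node. -/
def label : (r : Root L V I) → r.Node → Label L V I
  | tree _ t, y => t.label y
  | witness _ M _, none => .eps M
  | witness _ _ t, some y => t.label y
  | cut A _ _, none => .cut A
  | cut _ t _, some (.inl y) => t.label y
  | cut _ _ s, some (.inr y) => s.label y

/-- The parent of a node (`none` for the root). -/
def parent : (r : Root L V I) → r.Node → Option r.Node
  | tree _ t, y => t.parent y
  | witness _ _ _, none => none
  | witness _ _ t, some y => some (t.parent y)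
  | cut _ _ _, none => none
  | cut _ t _, some (.inl y) => some ((t.parent y).map .inl)
  | cut _ _ s, some (.inr y) => some ((s.parent y).map .inr)

/-- The free variables of the type of a typed term. -/
noncomputable def free : Root L V I → Set V
  | tree A _ => A.free
  | witness A _ _ => (Prenex.ex A).free
  | cut A _ _ => A.free

/-- Being a cut. -/
def IsCut : Root L V I → Prop
  | cut _ _ _ => True
  | _ => False

/-- Being a naked witness. -/
def IsWitness : Root L V I → Prop
  | witness _ _ _ => True
  | _ => False

end Root

namespace Forest

/-- The nodes of a typed forest. -/
def Node : Forest L V I → Type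
  | [] => Empty
  | r :: F => r.Node ⊕ Node F

/-- The label of a node. -/
def label : (F : Forest L V I) → Node F → Label L V I
  | [], y => y.elim
  | r :: _, .inl y => r.label y
  | _ :: F, .inr y => label F y

/-- The parent of a node (`none` for a root). -/
def parent : (F : Forest L V I) → Node F → Option (Node F)
  | [], y => y.elim
  | r :: _, .inl y => (r.parent y).map .inl
  | _ :: F, .inr y => (parent F y).map .inr

/-- The variables that are free in the type of the forest, i.e. in the type of a non-cut root. -/
def typeFree (F : Forest L V I) : Set V :=
  {a | ∃ r ∈ F, ¬ r.IsCut ∧ a ∈ r.free}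

/-- The `α`-bound variables. -/
def bound (F : Forest L V I) : Set V :=
  {a | ∃ y : Node F, label F y = .alpha a}

/-- Strictness: distinct `α`-nodes have distinct eigenvariables, and no `α`-bound variable is free
in the type of a non-cut root. -/
def IsStrict (F : Forest L V I) : Prop :=
  (∀ (a : V) (y z : Node F), label F y = .alpha a → label F z = .alpha a → y = z) ∧
    Disjoint (bound F) (typeFree F)

/-- Annotated sequents: strict typed forests without naked witnesses. -/
def IsAnnotatedSequent (F : Forest L V I) : Prop :=
  IsStrict F ∧ ∀ r ∈ F, ¬ r.IsWitness

/-! ### Correctness -/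

/-- The tautology indices appearing in a forest. -/
def indices (F : Forest L V I) : Set I :=
  {i | ∃ (y : Node F) (P : QFF L (V ⊕ Fin 0)) (S : Finset I), label F y = .leaf P S ∧ i ∈ S}

/-- The disjuncts of the formula `Fᵢ`. -/
def disjuncts (F : Forest L V I) (i : I) : Set (QFF L (V ⊕ Fin 0)) :=
  {P | ∃ (y : Node F) (S : Finset I), label F y = .leaf P S ∧ i ∈ S}

/-- The condition on Herbrand structures over `T`: `T ⊨ Fᵢ` for each tautology index `i`. -/
def IsHerbrandStructure (T : L.Theory) (F : Forest L V I) : Prop :=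
  ∀ i ∈ indices F, Valid T (disjuncts F i)

/-- The vertices of the dependency graph: the nodes and the tautology indices. -/
abbrev Vertex (F : Forest L V I) : Type x :=
  Node F ⊕ {i : I // i ∈ indices F}

/-- A node as a vertex of the dependency graph. -/
abbrev nodeVertex (F : Forest L V I) (y : Node F) : Vertex F := .inl y

/-- The directed edges of the dependency graph: from child to parent in the forest, and the jumps
from `ε[M]` to `α[a]` for `a` free in `M`, from a cut `A ⋈ Ā` to `α[a]` for `a` free in `A`, and
from an index `i` to each leaf `S` with `i ∈ S`. -/
inductive DepEdge (F : Forest L V I) : Vertex F → Vertex F → Prop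
  | child (y z : Node F) (h : parent F y = some z) :
      DepEdge F (nodeVertex F y) (nodeVertex F z)
  | eps (y z : Node F) (M : L.Term V) (a : V) (hy : label F y = .eps M)
      (hz : label F z = .alpha a) (h : a ∈ termFree M) :
      DepEdge F (nodeVertex F y) (nodeVertex F z)
  | cut (y z : Node F) (A : Prenex L V 0) (a : V) (hy : label F y = .cut A)
      (hz : label F z = .alpha a) (h : a ∈ A.free) :
      DepEdge F (nodeVertex F y) (nodeVertex F z)
  | index (i : {i : I // i ∈ indices F}) (z : Node F) (P : QFF L (V ⊕ Fin 0)) (S : Finset I)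
      (hz : label F z = .leaf P S) (h : i.1 ∈ S) :
      DepEdge F (.inr i) (nodeVertex F z)

/-- A switching chooses, for each switched node, an incoming edge (given by its source). -/
structure Switching (F : Forest L V I) where
  choice : (y : Node F) → (label F y).IsSwitched → Vertex F
  edge : ∀ (y : Node F) (hy : (label F y).IsSwitched), DepEdge F (choice y hy) (nodeVertex F y)

/-- The switching graph: for each switched node delete all incoming edges but the chosen one, then
forget directions. (If two vertices are joined by edges in both directions in some switching, then
no notion of graph makes all switching graphs trees: the number of edges, counted with
multiplicity, is the same in all switchings. So nothing is lost by using simple graphs.) -/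
def switchingGraph (F : Forest L V I) (σ : Switching F) : SimpleGraph (Vertex F) :=
  SimpleGraph.fromRel fun p q =>
    DepEdge F p q ∧
      ∀ (y : Node F) (hy : (label F y).IsSwitched), q = nodeVertex F y → p = σ.choice y hy

/-- ACC-correctness: every switching graph is connected and acyclic. -/
def IsACC (F : Forest L V I) : Prop :=
  ∀ σ : Switching F, (switchingGraph F σ).Connected ∧ (switchingGraph F σ).IsAcyclic

/-- Herbrand nets over `T`: annotated sequents that are Herbrand structures and ACC-correct. -/
def IsHerbrandNet (T : L.Theory) (F : Forest L V I) : Prop :=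
  IsAnnotatedSequent F ∧ IsHerbrandStructure T F ∧ IsACC F

end Forest

/-! ### The sequent calculus -/

/-- The typed forest `{i} : P₁, …, {i} : Pₙ`. -/
def tautForest (i : I) (Ps : List (QFF L (V ⊕ Fin 0))) : Forest L V I :=
  Ps.map fun P => .tree (.qf P) (.leaf P {i} (Finset.singleton_nonempty i))

open Classical in
/-- Proofs in the annotated sequent calculus, over the theory `T`. Typed forests are considered up
to the order of their roots (`perm`). In `contrEx`, the formal sum in the conclusion is the sum of
those in the premise, its summands being listed in any order. -/
inductive Proof (T : L.Theory) : Forest L V I → Type (max u v w x)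
  | taut (i : I) (Ps : List (QFF L (V ⊕ Fin 0))) (hne : Ps ≠ [])
      (h : Valid T {P | P ∈ Ps}) :
      Proof T (tautForest i Ps)
  | allR (F : Forest L V I) (A : Prenex L V 1) (a : V) (t : Tree L V I (A.inst (.var a)))
      (π : Proof T (.tree _ t :: F)) :
      Proof T (.tree _ (.alpha A a t) :: F)
  | exR (F : Forest L V I) (A : Prenex L V 1) (M : L.Term V) (t : Tree L V I (A.inst M))
      (π : Proof T (.tree _ t :: F)) :
      Proof T (.tree _ (.sum A 0 (fun _ => M) (fun _ => t)) :: F)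
  | contrEx (F : Forest L V I) (A : Prenex L V 1) (m n k : ℕ)
      (e : Fin (m + 1) ⊕ Fin (n + 1) ≃ Fin (k + 1))
      (M : Fin (k + 1) → L.Term V) (t : ∀ j, Tree L V I (A.inst (M j)))
      (π : Proof T (.tree _ (.sum A m (fun j => M (e (.inl j))) (fun j => t (e (.inl j)))) ::
        .tree _ (.sum A n (fun j => M (e (.inr j))) (fun j => t (e (.inr j)))) :: F)) :
      Proof T (.tree _ (.sum A k M t) :: F)
  | contrP (F : Forest L V I) (P : QFF L (V ⊕ Fin 0)) (S₁ S₂ : Finset I)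
      (h₁ : S₁.Nonempty) (h₂ : S₂.Nonempty)
      (π : Proof T (.tree _ (.leaf P S₁ h₁) :: .tree _ (.leaf P S₂ h₂) :: F)) :
      Proof T (.tree _ (.leaf P (S₁ ∪ S₂) (h₁.mono Finset.subset_union_left)) :: F)
  | cut (F G : Forest L V I) (A : Prenex L V 0) (t : Tree L V I A) (s : Tree L V I A.dual)
      (π₁ : Proof T (.tree _ t :: F)) (π₂ : Proof T (.tree _ s :: G)) :
      Proof T (.cut A t s :: (F ++ G))
  | perm (F G : Forest L V I) (h : F.Perm G) (π : Proof T F) : Proof T G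

namespace Proof

variable {T : L.Theory}

/-- The labels of the instances of the tautology rule. -/
def indices : {F : Forest L V I} → Proof T F → List I
  | _, taut i _ _ _ => [i]
  | _, allR _ _ _ _ π => π.indices
  | _, exR _ _ _ _ π => π.indices
  | _, contrEx _ _ _ _ _ _ _ _ π => π.indices
  | _, contrP _ _ _ _ _ _ π => π.indices
  | _, cut _ _ _ _ _ π₁ π₂ => π₁.indices ++ π₂.indices
  | _, perm _ _ _ π => π.indices

/-- The eigenvariables of the instances of the `∀`-rule. -/
def eigenvars : {F : Forest L V I} → Proof T F → List V
  | _, taut _ _ _ _ => []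
  | _, allR _ _ a _ π => a :: π.eigenvars
  | _, exR _ _ _ _ π => π.eigenvars
  | _, contrEx _ _ _ _ _ _ _ _ π => π.eigenvars
  | _, contrP _ _ _ _ _ _ π => π.eigenvars
  | _, cut _ _ _ _ _ π₁ π₂ => π₁.eigenvars ++ π₂.eigenvars
  | _, perm _ _ _ π => π.eigenvars

/-- The sequents of the proof that lie outside the subproofs above the instances of the `∀`-rule
with eigenvariable `a`. -/
def sequentsOutside (a : V) {F : Forest L V I} (π : Proof T F) : Set (Forest L V I) :=
  {F} ∪ match π with
    | taut _ _ _ _ => ∅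
    | allR _ _ b _ π => {G | b ≠ a ∧ G ∈ π.sequentsOutside a}
    | exR _ _ _ _ π => π.sequentsOutside a
    | contrEx _ _ _ _ _ _ _ _ π => π.sequentsOutside a
    | contrP _ _ _ _ _ _ π => π.sequentsOutside a
    | cut _ _ _ _ _ π₁ π₂ => π₁.sequentsOutside a ∪ π₂.sequentsOutside a
    | perm _ _ _ π => π.sequentsOutside a

/-- The witnessing terms `M` of the instances of the `∃`-rule that lie outside the subproofs above
the instances of the `∀`-rule with eigenvariable `a`. -/
def witnessesOutside (a : V) : {F : Forest L V I} → Proof T F → Set (L.Term V)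
  | _, taut _ _ _ _ => ∅
  | _, allR _ _ b _ π => {N | b ≠ a ∧ N ∈ π.witnessesOutside a}
  | _, exR _ _ M _ π => {M} ∪ π.witnessesOutside a
  | _, contrEx _ _ _ _ _ _ _ _ π => π.witnessesOutside a
  | _, contrP _ _ _ _ _ _ π => π.witnessesOutside a
  | _, cut _ _ _ _ _ π₁ π₂ => π₁.witnessesOutside a ∪ π₂.witnessesOutside a
  | _, perm _ _ _ π => π.witnessesOutside a

/-- Strict proofs: the tautology rules carry distinct indices, the `∀`-rules have distinct
eigenvariables, and an eigenvariable `a` is free neither in the type of a sequent, nor in the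
witnessing term of an `∃`-rule, outside the subproof above the `∀`-rule introducing `α[a]`. -/
def IsStrict {F : Forest L V I} (π : Proof T F) : Prop :=
  π.indices.Nodup ∧ π.eigenvars.Nodup ∧
    ∀ a ∈ π.eigenvars,
      (∀ G ∈ π.sequentsOutside a, a ∉ Forest.typeFree G) ∧
        ∀ M ∈ π.witnessesOutside a, a ∉ termFree M

end Proof

end Herbrand

/-!
The proof replaces ACC-correctness by an inductive condition that can be followed through the rules
of the calculus.

In the dependency graph, an index has no source, a cut has exactly two, and every other vertex
either is switched or has a unique source: the graph consists of base vertices, joins and links. A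
*sub-net* (`IsSubnet`) is a set of vertices obtained from single base vertices by adding a link all
of whose sources are present, or a join of two disjoint sub-nets, one source in each. The key fact
`Forest.isACC_iff_isNet` says that a forest is ACC-correct if and only if all of its vertices
together form a sub-net (`Forest.IsNet`).

* If they do, then every switching graph is connected, and since a sub-net has one base vertex more
  than it has joins, it has too few edges for a cycle (`IsSubnet.isTree`).
* Conversely (`isSubnet_univ_of_isTree`), suppose that every switching graph is a tree, and merge
  sub-nets as long as possible, beginning with the single base vertices. A switching that avoids a
  sub-net `B` wherever it can still connects `B` with the rest, so that either a link can be added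
  to `B`, or `B` contains a source of a join outside (`IsSubnet.exists_edge`). Counting edges of a
  tree gives one base vertex more than there are joins, hence fewer remaining joins than remaining
  sub-nets. By the pigeonhole principle some join has its two sources in distinct sub-nets and
  merges them.

Each rule of the calculus preserves `Forest.IsNet`: the `∀`-rule and the contractions only change
switched roots, which are links without targets; the `∃`-rule adds two links, provided that there
is no jump from the new node to an `α`-node; and a cut joins two sub-nets, provided that there are
no jumps between these. Strictness of a proof excludes the jumps, because a variable that is not an
eigenvariable of a proof is avoided by the proof if and only if it does not occur in the conclusion
(`Proof.avoids_iff`). This gives `Proof.correct_of_isStrict`.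

For the converse (`Forest.IsCorrect.provable`), the `∀`-rule and the contractions are invertible and
are applied backwards first, each of them decreasing a weight. If none of them applies, then the
roots are leaves with a single index, sums with a single summand, and cuts. The last step by which
the sub-net of all vertices arises, the switched roots being left aside (`IsSubnet.last_cases`),
then gives the last rule of a proof (`Forest.provable_of_isFinal`): a base vertex corresponds to a
tautology, a link is the `ε`-node of a root and is the source of no jump, and a join is a cut. In
the case of a cut, the two sub-nets are the premises: no tree and no index is shared by them, and
no jump leads from one to the other.
-/

namespace Herbrand

/-! ### Sub-nets of a digraph with switched vertices -/

section SwitchingDigraph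

variable {W : Type*}

/-- `v` has a source, and is switched or has no other source. -/
def IsLink (E : W → W → Prop) (sw : W → Prop) (v : W) : Prop :=
  (∃ u, E u v) ∧ (sw v ∨ ∃ u, ∀ w, E w v → w = u)

/-- `v` is unswitched and has no source. -/
def IsBase (E : W → W → Prop) (sw : W → Prop) (v : W) : Prop :=
  ¬ sw v ∧ ∀ u, ¬ E u v

/-- `v` is unswitched and has exactly two sources. -/
def IsJoin (E : W → W → Prop) (sw : W → Prop) (v : W) : Prop :=
  ¬ sw v ∧ ∃ u w, u ≠ w ∧ ∀ x, E x v ↔ x = u ∨ x = w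

/-- Sub-nets: a base vertex is a sub-net; a link can be added to a sub-net that contains all its
sources; two disjoint sub-nets are joined by a vertex with one source in each of them. -/
inductive IsSubnet (E : W → W → Prop) (sw : W → Prop) : Set W → Prop
  | base (v : W) (h : IsBase E sw v) : IsSubnet E sw {v}
  | link (B : Set W) (v : W) (hv : v ∉ B) (hl : IsLink E sw v) (hB : ∀ u, E u v → u ∈ B)
      (h : IsSubnet E sw B) : IsSubnet E sw (insert v B)
  | join (B C : Set W) (v u w : W) (hBC : Disjoint B C) (hvB : v ∉ B) (hvC : v ∉ C)
      (hu : u ∈ B) (hw : w ∈ C) (hE : ∀ x, E x v ↔ x = u ∨ x = w) (hs : ¬ sw v)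
      (hB : IsSubnet E sw B) (hC : IsSubnet E sw C) : IsSubnet E sw (insert v (B ∪ C))

variable {E : W → W → Prop} {sw : W → Prop}

theorem IsJoin.not_isLink {v : W} (h : IsJoin E sw v) : ¬ IsLink E sw v := by
  rintro ⟨-, hs | ⟨u', hu'⟩⟩
  · exact h.1 hs
  · obtain ⟨-, u, w, hne, hE⟩ := h
    exact hne ((hu' u ((hE u).2 (.inl rfl))).trans (hu' w ((hE w).2 (.inr rfl))).symm)

theorem IsJoin.not_isBase {v : W} (h : IsJoin E sw v) : ¬ IsBase E sw v := by
  obtain ⟨-, u, w, -, hE⟩ := h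
  exact fun hb => hb.2 u ((hE u).2 (.inl rfl))

namespace IsSubnet

theorem isJoin_of_join {B C : Set W} {v u w : W} (hBC : Disjoint B C) (hu : u ∈ B) (hw : w ∈ C)
    (hE : ∀ x, E x v ↔ x = u ∨ x = w) (hs : ¬ sw v) : IsJoin E sw v :=
  ⟨hs, u, w, fun h => Set.disjoint_left.1 hBC hu (h ▸ hw), hE⟩

theorem source_mem {B : Set W} (h : IsSubnet E sw B) {u v : W} (hv : v ∈ B) (huv : E u v) :
    u ∈ B := by
  induction h with
  | base x hx => obtain rfl : v = x := hv; exact absurd huv (hx.2 u)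
  | link B x hx hl hB h ih =>
    rcases hv with rfl | hv
    · exact .inr (hB _ huv)
    · exact .inr (ih hv)
  | join B C x p q hBC hxB hxC hp hq hE hs hB hC ihB ihC =>
    rcases hv with rfl | hv | hv
    · rcases (hE u).1 huv with rfl | rfl
      · exact .inr (.inl hp)
      · exact .inr (.inr hq)
    · exact .inr (.inl (ihB hv))
    · exact .inr (.inr (ihC hv))

theorem nonempty {B : Set W} (h : IsSubnet E sw B) : B.Nonempty := by
  cases h <;> simp

/-- Links without targets outside `R` can be removed. -/
theorem diff {B : Set W} (h : IsSubnet E sw B) (R : Set W) (hR : ∀ r ∈ R, IsLink E sw r)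
    (hout : ∀ r ∈ R, ∀ v ∈ B, E r v → v ∈ R) : IsSubnet E sw (B \ R) := by
  induction h with
  | base x hx =>
    have : x ∉ R := fun h => by obtain ⟨u, hu⟩ := (hR x h).1; exact hx.2 u hu
    rw [sdiff_eq_left.2 (Set.disjoint_singleton_left.2 this)]
    exact .base x hx
  | link B x hx hl hB h ih =>
    have ih := ih fun r hr v hv => hout r hr v (.inr hv)
    by_cases hxR : x ∈ R
    · rwa [Set.insert_sdiff_of_mem _ hxR]
    · rw [Set.insert_sdiff_of_notMem _ hxR]
      exact .link _ x (fun h => hx h.1) hl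
        (fun u hu => ⟨hB u hu, fun huR => hxR (hout u huR x (.inl rfl) hu)⟩) ih
  | join B C x p q hBC hxB hxC hp hq hE hs hB hC ihB ihC =>
    have ihB := ihB fun r hr v hv => hout r hr v (.inr (.inl hv))
    have ihC := ihC fun r hr v hv => hout r hr v (.inr (.inr hv))
    have hxR : x ∉ R := fun h => (isJoin_of_join hBC hp hq hE hs).not_isLink (hR x h)
    rw [Set.insert_sdiff_of_notMem _ hxR, Set.union_sdiff_distrib]
    refine .join _ _ x p q (hBC.mono Set.sdiff_subset Set.sdiff_subset) (fun h => hxB h.1)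
      (fun h => hxC h.1) ⟨hp, fun h => ?_⟩ ⟨hq, fun h => ?_⟩ hE hs ihB ihC
    · exact hxR (hout p h x (.inl rfl) ((hE p).2 (.inl rfl)))
    · exact hxR (hout q h x (.inl rfl) ((hE q).2 (.inr rfl)))

/-- Links with all their sources in a sub-net can be added. -/
theorem union {B : Set W} (h : IsSubnet E sw B) (R : Set W) (hfin : R.Finite)
    (hR : ∀ r ∈ R, IsLink E sw r) (hin : ∀ r ∈ R, ∀ u, E u r → u ∈ B) :
    IsSubnet E sw (B ∪ R) := by
  induction R, hfin using Set.Finite.induction_on with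
  | empty => simpa using h
  | @insert r R hr _ ih =>
    have ih := ih (fun r hr => hR r (.inr hr)) (fun r hr => hin r (.inr hr))
    rw [Set.union_insert]
    by_cases hrB : r ∈ B ∪ R
    · rwa [Set.insert_eq_of_mem hrB]
    · exact .link _ r hrB (hR r (.inl rfl)) (fun u hu => .inl (hin r (.inl rfl) u hu)) ih

/-- Sub-nets are transported along maps that induce a bijection on sources. -/
theorem image {W' : Type*} {E' : W' → W' → Prop} {sw' : W' → Prop} {D : Set W} (f : W → W')
    (hinj : Set.InjOn f D) (hsw : ∀ v ∈ D, sw' (f v) ↔ sw v)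
    (hE : ∀ v ∈ D, ∀ u', E' u' (f v) ↔ ∃ u ∈ D, E u v ∧ f u = u')
    {B : Set W} (h : IsSubnet E sw B) (hBD : B ⊆ D) : IsSubnet E' sw' (f '' B) := by
  have key : ∀ v ∈ D, ∀ u ∈ D, E u v → E' (f u) (f v) := fun v hv u hu h =>
    (hE v hv _).2 ⟨u, hu, h, rfl⟩
  induction h with
  | base x hx =>
    have hxD : x ∈ D := hBD rfl
    rw [Set.image_singleton]
    refine .base _ ⟨fun h => hx.1 ((hsw x hxD).1 h), fun u' hu' => ?_⟩
    obtain ⟨u, -, hu, -⟩ := (hE x hxD u').1 hu'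
    exact hx.2 u hu
  | link B x hx hl hB h ih =>
    have hxD : x ∈ D := hBD (.inl rfl)
    have hBD' : B ⊆ D := fun b hb => hBD (.inr hb)
    rw [Set.image_insert_eq]
    refine .link _ _ ?_ ⟨?_, ?_⟩ ?_ (ih hBD')
    · rintro ⟨y, hy, hyx⟩
      exact hx (hinj (hBD' hy) hxD hyx ▸ hy)
    · obtain ⟨u, hu⟩ := hl.1
      exact ⟨f u, key x hxD u (hBD' (hB u hu)) hu⟩
    · refine hl.2.imp (hsw x hxD).2 ?_
      rintro ⟨u, hu⟩
      refine ⟨f u, fun w' hw' => ?_⟩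
      obtain ⟨w, -, hw, rfl⟩ := (hE x hxD w').1 hw'
      rw [hu w hw]
    · intro u' hu'
      obtain ⟨u, -, hu, rfl⟩ := (hE x hxD u').1 hu'
      exact ⟨u, hB u hu, rfl⟩
  | join B C x p q hBC hxB hxC hp hq hEx hs hB hC ihB ihC =>
    have hxD : x ∈ D := hBD (.inl rfl)
    have hBD' : B ⊆ D := fun b hb => hBD (.inr (.inl hb))
    have hCD' : C ⊆ D := fun b hb => hBD (.inr (.inr hb))
    rw [Set.image_insert_eq, Set.image_union]
    refine .join _ _ _ (f p) (f q) ?_ ?_ ?_ ⟨p, hp, rfl⟩ ⟨q, hq, rfl⟩ ?_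
      (fun h => hs ((hsw x hxD).1 h)) (ihB hBD') (ihC hCD')
    · rw [Set.disjoint_left]
      rintro _ ⟨y, hy, rfl⟩ ⟨z, hz, hzy⟩
      exact Set.disjoint_left.1 hBC hy (hinj (hCD' hz) (hBD' hy) hzy ▸ hz)
    · rintro ⟨y, hy, hyx⟩
      exact hxB (hinj (hBD' hy) hxD hyx ▸ hy)
    · rintro ⟨y, hy, hyx⟩
      exact hxC (hinj (hCD' hy) hxD hyx ▸ hy)
    · intro u'
      constructor
      · intro hu'
        obtain ⟨u, -, hu, rfl⟩ := (hE x hxD u').1 hu'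
        exact ((hEx u).1 hu).imp (congrArg f) (congrArg f)
      · rintro (rfl | rfl)
        · exact key x hxD p (hBD' hp) ((hEx p).2 (.inl rfl))
        · exact key x hxD q (hCD' hq) ((hEx q).2 (.inr rfl))

theorem image_iff {W' : Type*} {E' : W' → W' → Prop} {sw' : W' → Prop} {D : Set W} (f : W → W')
    (hinj : Set.InjOn f D) (hsw : ∀ v ∈ D, sw' (f v) ↔ sw v)
    (hE : ∀ v ∈ D, ∀ u', E' u' (f v) ↔ ∃ u ∈ D, E u v ∧ f u = u')
    (hD : ∀ v ∈ D, ∀ u, E u v → u ∈ D) :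
    IsSubnet E' sw' (f '' D) ↔ IsSubnet E sw D := by
  refine ⟨fun h => ?_, fun h => h.image f hinj hsw hE subset_rfl⟩
  obtain ⟨_, v₀, -, -⟩ := h.nonempty
  have : Nonempty W := ⟨v₀⟩
  have hinv : ∀ v ∈ D, Function.invFunOn f D (f v) = v := fun v hv =>
    hinj.leftInvOn_invFunOn hv
  have := h.image (E' := E) (sw' := sw) (D := f '' D) (Function.invFunOn f D) ?_ ?_ ?_ subset_rfl
  · rwa [hinj.invFunOn_image subset_rfl] at this
  · rintro _ ⟨v, hv, rfl⟩ _ ⟨w, hw, rfl⟩ h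
    rw [hinv v hv, hinv w hw] at h
    rw [h]
  · rintro _ ⟨v, hv, rfl⟩
    rw [hinv v hv, hsw v hv]
  · rintro _ ⟨v, hv, rfl⟩ u
    rw [hinv v hv]
    constructor
    · intro hu
      have huD := hD v hv u hu
      exact ⟨f u, ⟨u, huD, rfl⟩, (hE v hv _).2 ⟨u, huD, hu, rfl⟩, hinv u huD⟩
    · rintro ⟨_, ⟨w, hw, rfl⟩, hwv, rfl⟩
      obtain ⟨w', hw', hE', hf⟩ := (hE v hv _).1 hwv
      rw [hinv w hw, ← hinj hw' hw hf]
      exact hE'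

open Classical in
/-- A sub-net has one more base vertex than it has joins. -/
theorem ncard_base [Finite W] {B : Set W} (h : IsSubnet E sw B) :
    (B ∩ {v | IsBase E sw v}).ncard = (B ∩ {v | IsJoin E sw v}).ncard + 1 := by
  induction h with
  | base x hx =>
    have : ¬ IsJoin E sw x := fun h => h.not_isBase hx
    have h1 : {x} ∩ {v | IsBase E sw v} = {x} :=
      Set.inter_eq_left.2 fun y hy => by obtain rfl : y = x := hy; exact hx
    have h2 : {x} ∩ {v | IsJoin E sw v} = ∅ :=
      Set.singleton_inter_eq_empty.2 this
    rw [h1, h2]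
    simp
  | link B x hx hl hB h ih =>
    have h1 : x ∉ {v | IsBase E sw v} := fun h => by
      obtain ⟨u, hu⟩ := hl.1; exact h.2 u hu
    have h2 : x ∉ {v | IsJoin E sw v} := fun h => h.not_isLink hl
    rw [Set.insert_inter_of_notMem h1, Set.insert_inter_of_notMem h2, ih]
  | join B C x p q hBC hxB hxC hp hq hE hs hB hC ihB ihC =>
    have hj := isJoin_of_join hBC hp hq hE hs
    have h1 : x ∉ {v | IsBase E sw v} := hj.not_isBase
    have h2 : x ∈ {v | IsJoin E sw v} := hj
    rw [Set.insert_inter_of_notMem h1, Set.insert_inter_of_mem h2, Set.union_inter_distrib_right,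
      Set.union_inter_distrib_right,
      Set.ncard_union_eq (hBC.mono Set.inter_subset_left Set.inter_subset_left), ihB, ihC,
      Set.ncard_insert_of_notMem (by rintro (h | h); exacts [hxB h.1, hxC h.1]),
      Set.ncard_union_eq (hBC.mono Set.inter_subset_left Set.inter_subset_left)]
    omega

end IsSubnet

/-- The edge from `p` to `q` is kept by the switching `σ`. -/
def Kept (E : W → W → Prop) (sw : W → Prop) (σ : W → W) (p q : W) : Prop :=
  E p q ∧ (sw q → p = σ q)

/-- Any two vertices of a sub-net are connected in every switching graph. -/
theorem IsSubnet.reachable {B : Set W} (h : IsSubnet E sw B) {σ : W → W}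
    (hσ : ∀ v, sw v → E (σ v) v) {u v : W} (hu : u ∈ B) (hv : v ∈ B) :
    (SimpleGraph.fromRel (Kept E sw σ)).Reachable u v := by
  have edge : ∀ {p q}, Kept E sw σ p q → (SimpleGraph.fromRel (Kept E sw σ)).Reachable p q := by
    intro p q h
    by_cases hpq : p = q
    · rw [hpq]
    · exact SimpleGraph.Adj.reachable ((SimpleGraph.fromRel_adj _ _ _).2 ⟨hpq, .inl h⟩)
  induction h generalizing u v with
  | base x hx =>
    obtain rfl : u = x := hu
    obtain rfl : v = u := hv
    rfl
  | link B x hx hl hB h ih =>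
    have key : ∃ y ∈ B, (SimpleGraph.fromRel (Kept E sw σ)).Reachable y x := by
      by_cases hs : sw x
      · exact ⟨σ x, hB _ (hσ x hs), edge ⟨hσ x hs, fun _ => rfl⟩⟩
      · obtain ⟨y, hy⟩ := hl.1
        exact ⟨y, hB _ hy, edge ⟨hy, fun h => absurd h hs⟩⟩
    obtain ⟨y, hy, hyx⟩ := key
    rcases hu with rfl | hu <;> rcases hv with rfl | hv
    · rfl
    · exact hyx.symm.trans (ih hy hv)
    · exact (ih hu hy).trans hyx
    · exact ih hu hv
  | join B C x p q hBC hxB hxC hp hq hE hs hB hC ihB ihC =>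
    have hpx := edge ⟨(hE p).2 (.inl rfl), fun h => absurd h hs⟩
    have hqx := edge ⟨(hE q).2 (.inr rfl), fun h => absurd h hs⟩
    have key : ∀ y ∈ insert x (B ∪ C), (SimpleGraph.fromRel (Kept E sw σ)).Reachable y x := by
      rintro y (rfl | hy | hy)
      · rfl
      · exact (ihB hy hp).trans hpx
      · exact (ihC hy hq).trans hqx
    exact (key u hu).trans (key v hv).symm

/-- The hypotheses on the sources: switched vertices have a source, the other ones have at most
two. -/
def SourcesOK (E : W → W → Prop) (sw : W → Prop) : Prop :=
  ∀ v, IsBase E sw v ∨ IsLink E sw v ∨ IsJoin E sw v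

/-- Each link is the target of one kept edge, a base vertex of none, and a join of two. -/
theorem card_kept [Finite W] (hS : SourcesOK E sw) {σ : W → W} (hσ : ∀ v, sw v → E (σ v) v) :
    {e : W × W | Kept E sw σ e.1 e.2}.ncard + {v | IsBase E sw v}.ncard =
      Nat.card W + {v | IsJoin E sw v}.ncard := by
  classical
  have := Fintype.ofFinite W
  have h1 : ∀ q : W, (Finset.univ.filter fun p => Kept E sw σ p q).card
      + (if IsBase E sw q then 1 else 0) = 1 + (if IsJoin E sw q then 1 else 0) := by
    intro q
    rcases hS q with h | h | h
    · have : ¬ IsJoin E sw q := fun h' => h'.not_isBase h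
      rw [if_pos h, if_neg this, Finset.filter_false_of_mem fun p _ hp => h.2 p hp.1]
      rfl
    · have h2 : ¬ IsJoin E sw q := fun h' => h'.not_isLink h
      have h3 : ¬ IsBase E sw q := fun h' => by obtain ⟨u, hu⟩ := h.1; exact h'.2 u hu
      rw [if_neg h2, if_neg h3, add_zero, add_zero, Finset.card_eq_one]
      by_cases hs : sw q
      · refine ⟨σ q, Finset.ext fun p => ?_⟩
        simp only [Finset.mem_filter, Finset.mem_univ, true_and, Finset.mem_singleton]
        exact ⟨fun h => h.2 hs, fun h => h ▸ ⟨hσ q hs, fun _ => rfl⟩⟩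
      · obtain ⟨⟨u', hu'⟩, h4 | ⟨u, hu⟩⟩ := h
        · exact absurd h4 hs
        refine ⟨u, Finset.ext fun p => ?_⟩
        simp only [Finset.mem_filter, Finset.mem_univ, true_and, Finset.mem_singleton]
        refine ⟨fun h => hu p h.1, fun h => ⟨?_, fun h => absurd h hs⟩⟩
        rwa [h, ← hu u' hu']
    · rw [if_pos h, if_neg h.not_isBase]
      obtain ⟨hs, u, w, hne, hE⟩ := h
      have : (Finset.univ.filter fun p => Kept E sw σ p q) = {u, w} := by
        ext p
        simp only [Finset.mem_filter, Finset.mem_univ, true_and, Finset.mem_insert,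
          Finset.mem_singleton]
        rw [← hE p]
        exact ⟨fun h => h.1, fun h => ⟨h, fun h => absurd h hs⟩⟩
      rw [this, Finset.card_pair hne]
  have h2 := Finset.sum_congr rfl fun q (_ : q ∈ Finset.univ) => h1 q
  rw [Finset.sum_add_distrib, Finset.sum_add_distrib] at h2
  simp only [Finset.sum_boole, Finset.sum_const, smul_eq_mul, mul_one, Nat.cast_id] at h2
  have h3 : {e : W × W | Kept E sw σ e.1 e.2}.ncard
      = ∑ q, (Finset.univ.filter fun p => Kept E sw σ p q).card := by
    rw [Set.ncard_eq_toFinset_card', Finset.card_eq_sum_card_fiberwise (f := Prod.snd)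
      (t := Finset.univ) (fun _ _ => Finset.mem_coe.2 (Finset.mem_univ _))]
    refine Finset.sum_congr rfl fun q _ => ?_
    refine Finset.card_bij' (fun e _ => e.1) (fun p _ => (p, q)) ?_ ?_ ?_ ?_
    · rintro ⟨p, q'⟩ h
      simp only [Finset.mem_filter, Set.mem_toFinset, Set.mem_ofPred_eq] at h
      obtain ⟨h, rfl⟩ := h
      simpa using h
    · intro p h
      simpa using h
    · rintro ⟨p, q'⟩ h
      simp only [Finset.mem_filter, Set.mem_toFinset, Set.mem_ofPred_eq] at h
      rw [← h.2]
    · intro p _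
      rfl
  rw [h3, Set.ncard_eq_toFinset_card' {v | IsBase E sw v},
    Set.ncard_eq_toFinset_card' {v | IsJoin E sw v}, Nat.card_eq_fintype_card]
  simpa [Finset.card_univ] using h2

/-- A digraph with a sub-net exhausting it is correct: its switching graphs are connected and have
too few edges for a cycle. -/
theorem IsSubnet.isTree [Finite W] (hS : SourcesOK E sw) (h : IsSubnet E sw Set.univ) {σ : W → W}
    (hσ : ∀ v, sw v → E (σ v) v) : (SimpleGraph.fromRel (Kept E sw σ)).IsTree := by
  classical
  obtain ⟨v₀, -⟩ := h.nonempty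
  have : Nonempty W := ⟨v₀⟩
  have hconn : (SimpleGraph.fromRel (Kept E sw σ)).Connected :=
    ⟨fun u v => h.reachable hσ (Set.mem_univ u) (Set.mem_univ v)⟩
  rw [SimpleGraph.isTree_iff_connected_and_card]
  refine ⟨hconn, le_antisymm ?_ hconn.card_vert_le_card_edgeSet_add_one⟩
  have h1 := card_kept hS hσ
  have h2 := h.ncard_base
  rw [Set.univ_inter, Set.univ_inter] at h2
  have h3 : Nat.card (SimpleGraph.fromRel (Kept E sw σ)).edgeSet
      ≤ {e : W × W | Kept E sw σ e.1 e.2}.ncard := by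
    rw [Nat.card_coe_set_eq]
    refine (Set.ncard_le_ncard ?_ (Set.toFinite _)).trans
      (Set.ncard_image_le (f := fun e : W × W => s(e.1, e.2)) (Set.toFinite _))
    rintro ⟨p, q⟩ hpq
    obtain ⟨-, hpq | hpq⟩ := (SimpleGraph.fromRel_adj _ _ _).1 hpq
    · exact ⟨(p, q), hpq, rfl⟩
    · exact ⟨(q, p), hpq, Sym2.eq_swap⟩
  omega

/-- In a correct digraph, there is one more base vertex than there are joins. The switching has to
be free of antiparallel edges, which a simple graph would identify. -/
theorem ncard_base_of_isTree [Finite W] (hS : SourcesOK E sw) {σ : W → W}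
    (hσ : ∀ v, sw v → E (σ v) v) (hanti : ∀ u v, Kept E sw σ u v → ¬ Kept E sw σ v u)
    (hT : (SimpleGraph.fromRel (Kept E sw σ)).IsTree) :
    {v | IsBase E sw v}.ncard = {v | IsJoin E sw v}.ncard + 1 := by
  have h1 := card_kept hS hσ
  have h2 := (SimpleGraph.isTree_iff_connected_and_card.1 hT).2
  have h3 : Nat.card (SimpleGraph.fromRel (Kept E sw σ)).edgeSet
      = {e : W × W | Kept E sw σ e.1 e.2}.ncard := by
    rw [Nat.card_coe_set_eq]
    have : (SimpleGraph.fromRel (Kept E sw σ)).edgeSet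
        = (fun e : W × W => s(e.1, e.2)) '' {e : W × W | Kept E sw σ e.1 e.2} := by
      ext e
      constructor
      · induction e with | _ p q
        intro hpq
        obtain ⟨-, hpq | hpq⟩ := (SimpleGraph.fromRel_adj _ _ _).1 hpq
        · exact ⟨(p, q), hpq, rfl⟩
        · exact ⟨(q, p), hpq, Sym2.eq_swap⟩
      · rintro ⟨⟨p, q⟩, hpq, rfl⟩
        refine (SimpleGraph.fromRel_adj _ _ _).2 ⟨?_, .inl hpq⟩
        intro hpq'
        dsimp only at hpq hpq'
        subst hpq'
        exact hanti _ _ hpq hpq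
    rw [this, Set.InjOn.ncard_image]
    rintro ⟨p, q⟩ h ⟨p', q'⟩ h' heq
    rcases Sym2.eq_iff.1 heq with ⟨rfl, rfl⟩ | ⟨rfl, rfl⟩
    · rfl
    · exact absurd h' (hanti _ _ h)
  omega

/-- Each member of a family of disjoint sub-nets contributes one base vertex in excess of its
joins. -/
theorem ncard_base_sUnion [Finite W] (𝓑 : Set (Set W)) (h𝓑 : ∀ B ∈ 𝓑, IsSubnet E sw B)
    (hd : 𝓑.PairwiseDisjoint id) :
    (⋃₀ 𝓑 ∩ {v | IsBase E sw v}).ncard = (⋃₀ 𝓑 ∩ {v | IsJoin E sw v}).ncard + 𝓑.ncard := by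
  induction 𝓑, 𝓑.toFinite using Set.Finite.induction_on with
  | empty => simp
  | @insert B 𝓑 hB _ ih =>
    have hdis : Disjoint B (⋃₀ 𝓑) := Set.disjoint_sUnion_right.2 fun C hC =>
      hd (.inl rfl) (.inr hC) fun h => hB (h ▸ hC)
    rw [Set.sUnion_insert, Set.union_inter_distrib_right, Set.union_inter_distrib_right,
      Set.ncard_union_eq (hdis.mono Set.inter_subset_left Set.inter_subset_left),
      Set.ncard_union_eq (hdis.mono Set.inter_subset_left Set.inter_subset_left),
      (h𝓑 B (.inl rfl)).ncard_base, Set.ncard_insert_of_notMem hB,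
      ih (fun C hC => h𝓑 C (.inr hC)) (hd.subset (Set.subset_insert _ _))]
    omega

/-- If a digraph is connected under the switchings that avoid the sub-net `B`, then `B` is the
whole digraph, or a premise of a link or join outside. -/
theorem IsSubnet.exists_edge (hS : SourcesOK E sw) {B : Set W} (hB : IsSubnet E sw B)
    (hconn : ∀ σ : W → W, (∀ v, sw v → E (σ v) v) →
      (SimpleGraph.fromRel (Kept E sw σ)).Connected) (hne : B ≠ Set.univ) :
    ∃ p ∈ B, ∃ q ∉ B, E p q ∧ (IsJoin E sw q ∨ IsLink E sw q ∧ ∀ u, E u q → u ∈ B) := by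
  classical
  have hsrc : ∀ v, sw v → ∃ u, E u v := by
    intro v hv
    rcases hS v with h | h | h
    exacts [absurd hv h.1, h.1, absurd hv h.1]
  -- the switching chooses sources outside `B` wherever there are any
  have hch : ∀ v, ∃ u, sw v → E u v ∧ (u ∈ B → ∀ w, E w v → w ∈ B) := by
    intro v
    by_cases hv : sw v
    · by_cases h : ∃ u, E u v ∧ u ∉ B
      · obtain ⟨u, hu, huB⟩ := h
        exact ⟨u, fun _ => ⟨hu, fun h => absurd h huB⟩⟩
      · push Not at h
        obtain ⟨u, hu⟩ := hsrc v hv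
        exact ⟨u, fun _ => ⟨hu, fun _ => h⟩⟩
    · exact ⟨v, fun h => absurd h hv⟩
  choose σ hσ using hch
  have hconn := hconn σ fun v hv => (hσ v hv).1
  obtain ⟨b, hb⟩ := hB.nonempty
  obtain ⟨c, hc⟩ := (Set.ne_univ_iff_exists_notMem B).1 hne
  obtain ⟨walk⟩ := hconn.preconnected b c
  obtain ⟨d, -, hd1, hd2⟩ := walk.exists_boundary_dart B hb hc
  obtain ⟨-, hk | hk⟩ := (SimpleGraph.fromRel_adj _ _ _).1 d.adj
  · refine ⟨d.fst, hd1, d.snd, hd2, hk.1, ?_⟩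
    by_cases hs : sw d.snd
    · have h := (hσ d.snd hs).2 (hk.2 hs ▸ hd1)
      exact .inr ⟨⟨⟨_, hk.1⟩, .inl hs⟩, h⟩
    · rcases hS d.snd with h | h | h
      · exact absurd hk.1 (h.2 _)
      · obtain ⟨h1, h2 | ⟨u, hu⟩⟩ := h
        · exact absurd h2 hs
        · refine .inr ⟨⟨h1, .inr ⟨u, hu⟩⟩, fun w hw => ?_⟩
          rw [hu w hw, ← hu _ hk.1]
          exact hd1
      · exact .inl h
  · exact absurd (hB.source_mem hd1 hk.1) hd2

/-- The combinatorial core: the sub-nets of a correct digraph can be merged until a single one is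
left. -/
theorem isSubnet_univ_of_isTree [Finite W] (hS : SourcesOK E sw)
    (hT : ∀ σ : W → W, (∀ v, sw v → E (σ v) v) → (SimpleGraph.fromRel (Kept E sw σ)).IsTree)
    (hanti : ∃ σ : W → W, (∀ v, sw v → E (σ v) v) ∧
      ∀ u v, Kept E sw σ u v → ¬ Kept E sw σ v u) :
    IsSubnet E sw Set.univ := by
  obtain ⟨σ₀, hσ₀, hanti⟩ := hanti
  have hcount := ncard_base_of_isTree hS hσ₀ hanti (hT σ₀ hσ₀)
  -- induction on the number of vertices outside a family of disjoint sub-nets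
  suffices H : ∀ (n : ℕ) (𝓑 : Set (Set W)), (⋃₀ 𝓑)ᶜ.ncard = n → (∀ B ∈ 𝓑, IsSubnet E sw B) →
      𝓑.PairwiseDisjoint id → {v | IsBase E sw v} ⊆ ⋃₀ 𝓑 → IsSubnet E sw Set.univ by
    refine H _ (singleton '' {v | IsBase E sw v}) rfl ?_ ?_ ?_
    · rintro _ ⟨v, hv, rfl⟩
      exact .base v hv
    · rintro _ ⟨v, -, rfl⟩ _ ⟨w, -, rfl⟩ h
      exact Set.disjoint_singleton.2 fun h' => h (by rw [h'])
    · exact fun v hv => ⟨{v}, ⟨v, hv, rfl⟩, rfl⟩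
  intro n
  induction n using Nat.strong_induction_on with
  | _ n ih =>
  intro 𝓑 hn h𝓑 hd hbase
  by_cases hfire : ∃ q ∉ ⋃₀ 𝓑, ∃ 𝓒 ⊆ 𝓑, IsSubnet E sw (insert q (⋃₀ 𝓒))
  · obtain ⟨q, hq, 𝓒, h𝓒, hsub⟩ := hfire
    have hU : ⋃₀ (insert (insert q (⋃₀ 𝓒)) (𝓑 \ 𝓒)) = insert q (⋃₀ 𝓑) := by
      rw [Set.sUnion_insert, Set.insert_union, ← Set.sUnion_union, Set.union_sdiff_cancel h𝓒]
    refine ih _ ?_ (insert (insert q (⋃₀ 𝓒)) (𝓑 \ 𝓒)) rfl ?_ ?_ ?_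
    · rw [hU, ← hn]
      refine Set.ncard_lt_ncard ⟨Set.compl_subset_compl.2 (Set.subset_insert _ _), fun h => ?_⟩
        (Set.toFinite _)
      exact h hq (.inl rfl)
    · rintro B (rfl | hB)
      · exact hsub
      · exact h𝓑 B hB.1
    · refine (hd.subset Set.sdiff_subset).insert fun B hB _ => ?_
      refine Set.disjoint_left.2 ?_
      rintro x (rfl | ⟨C, hC, hx⟩) hxB
      · exact hq ⟨B, hB.1, hxB⟩
      · exact Set.disjoint_left.1 (hd (h𝓒 hC) hB.1 fun h => hB.2 (h ▸ hC)) hx hxB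
    · rw [hU]
      exact hbase.trans (Set.subset_insert _ _)
  · by_cases huniv : Set.univ ∈ 𝓑
    · exact h𝓑 _ huniv
    exfalso
    -- every sub-net contains a source of a join outside, and no join outside has its sources in
    -- two sub-nets; so there are at least as many joins outside as there are sub-nets
    have hedge : ∀ B ∈ 𝓑, ∃ q, (q ∉ ⋃₀ 𝓑 ∧ IsJoin E sw q) ∧ ∃ p ∈ B, E p q := by
      intro B hB
      obtain ⟨p, hp, q, hq, hpq, h⟩ := (h𝓑 B hB).exists_edge hS (fun σ hσ => (hT σ hσ).1)
        fun h => huniv (h ▸ hB)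
      have hqU : q ∉ ⋃₀ 𝓑 := by
        rintro ⟨C, hC, hqC⟩
        have hpC := (h𝓑 C hC).source_mem hqC hpq
        have hne : B ≠ C := fun h => hq (h ▸ hqC)
        exact Set.disjoint_left.1 (hd hB hC hne) hp hpC
      rcases h with h | ⟨hl, hall⟩
      · exact ⟨q, ⟨hqU, h⟩, p, hp, hpq⟩
      · refine absurd ⟨q, hqU, {B}, Set.singleton_subset_iff.2 hB, ?_⟩ hfire
        rw [Set.sUnion_singleton]
        exact .link B q hq hl hall (h𝓑 B hB)
    have : Nonempty W := (hT σ₀ hσ₀).1.nonempty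
    choose! f hf hfE using hedge
    have hinj : Set.InjOn f 𝓑 := by
      intro B hB C hC hBC
      by_contra hne
      obtain ⟨p, hp, hpE⟩ := hfE B hB
      obtain ⟨p', hp', hpE'⟩ := hfE C hC
      rw [← hBC] at hpE'
      obtain ⟨hqU, hs, u, w, huw, hE⟩ := hf B hB
      have hdis : Disjoint B C := hd hB hC hne
      have hpp' : p ≠ p' := fun h => Set.disjoint_left.1 hdis hp (h ▸ hp')
      refine hfire ⟨f B, hqU, {B, C}, Set.pair_subset hB hC, ?_⟩
      rw [Set.sUnion_pair]
      refine .join B C _ p p' hdis (fun h => hqU ⟨B, hB, h⟩) (fun h => hqU ⟨C, hC, h⟩) hp hp'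
        (fun x => ?_) hs (h𝓑 B hB) (h𝓑 C hC)
      rw [hE] at hpE hpE' ⊢
      grind
    have h1 : 𝓑.ncard ≤ ({v | IsJoin E sw v} \ ⋃₀ 𝓑).ncard :=
      Set.ncard_le_ncard_of_injOn f (fun B hB => ⟨(hf B hB).2, (hf B hB).1⟩) hinj (Set.toFinite _)
    have h2 := ncard_base_sUnion 𝓑 h𝓑 hd
    rw [Set.inter_eq_right.2 hbase, hcount, Set.inter_comm] at h2
    have h3 := Set.ncard_inter_add_ncard_sdiff_eq_ncard {v | IsJoin E sw v} (⋃₀ 𝓑)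
    omega

/-- How a sub-net arises, up to a set `R` of links that have unique sources and no targets: it is a
base vertex, it ends with a link, or it ends with a join. In the last case the members of `R` are
distributed over the two sub-nets that are joined, unless one of them has the join as its source. -/
theorem IsSubnet.last_cases {X : Set W} (h : IsSubnet E sw X) (R : Set W) (hfin : R.Finite)
    (hRX : R ⊆ X) (hR : ∀ r ∈ R, ∃ u, ∀ w, E w r ↔ w = u) (hout : ∀ r ∈ R, ∀ v ∈ X, ¬ E r v) :
    (∃ v, IsBase E sw v ∧ X \ R = {v}) ∨
    (∃ v ∈ X, v ∉ R ∧ IsLink E sw v ∧ ∀ w ∈ X, E v w → w ∈ R) ∨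
    (∃ v ∈ X, v ∉ R ∧ IsJoin E sw v ∧ (∀ w ∈ X, E v w → w ∈ R) ∧ ((∀ r ∈ R, ¬ E v r) →
      ∃ B C, IsSubnet E sw B ∧ IsSubnet E sw C ∧ Disjoint B C ∧ v ∉ B ∧ v ∉ C ∧
        X = insert v (B ∪ C) ∧ ∃ u ∈ B, ∃ w ∈ C, ∀ x, E x v ↔ x = u ∨ x = w)) := by
  have hlink : ∀ r ∈ R, IsLink E sw r := fun r hr => by
    obtain ⟨u, hu⟩ := hR r hr
    exact ⟨⟨u, (hu u).2 rfl⟩, .inr ⟨u, fun w => (hu w).1⟩⟩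
  have hd := h.diff R hlink fun r hr v hv hE => absurd hE (hout r hr v hv)
  generalize hY : X \ R = Y at hd
  have hmem : ∀ {w}, w ∈ Y ↔ w ∈ X ∧ w ∉ R := by rintro w; rw [← hY]; rfl
  cases hd with
  | base v hv => exact .inl ⟨v, hv, rfl⟩
  | link B v hv hl hB hsub =>
    refine .inr (.inl ⟨v, (hmem.1 (.inl rfl)).1, (hmem.1 (.inl rfl)).2, hl, fun w hw hvw => ?_⟩)
    by_contra hwR
    rcases hmem.2 ⟨hw, hwR⟩ with rfl | hwB
    · exact hv (hB _ hvw)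
    · exact hv (hsub.source_mem hwB hvw)
  | join B C v p q hBC hvB hvC hp hq hE hs hB hC =>
    have hvX := hmem.1 (Set.mem_insert v _)
    refine .inr (.inr ⟨v, hvX.1, hvX.2, isJoin_of_join hBC hp hq hE hs, fun w hw hvw => ?_,
      fun hvR => ?_⟩)
    · by_contra hwR
      rcases hmem.2 ⟨hw, hwR⟩ with rfl | hwB | hwC
      · rcases (hE _).1 hvw with rfl | rfl
        exacts [hvB hp, hvC hq]
      · exact hvB (hB.source_mem hwB hvw)
      · exact hvC (hC.source_mem hwC hvw)
    have hBX : ∀ {x}, x ∈ B → x ∈ X ∧ x ∉ R := fun hx => hmem.1 (.inr (.inl hx))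
    have hCX : ∀ {x}, x ∈ C → x ∈ X ∧ x ∉ R := fun hx => hmem.1 (.inr (.inr hx))
    refine ⟨B ∪ {r ∈ R | ∀ u, E u r → u ∈ B}, C ∪ {r ∈ R | ∀ u, E u r → u ∈ C},
      hB.union _ (hfin.subset fun r hr => hr.1) (fun r hr => hlink r hr.1) (fun r hr => hr.2),
      hC.union _ (hfin.subset fun r hr => hr.1) (fun r hr => hlink r hr.1) (fun r hr => hr.2),
      ?_, ?_, ?_, ?_, p, .inl hp, q, .inl hq, hE⟩
    · rw [Set.disjoint_left]
      rintro x (hxB | hxB) (hxC | hxC)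
      · exact Set.disjoint_left.1 hBC hxB hxC
      · exact (hBX hxB).2 hxC.1
      · exact (hCX hxC).2 hxB.1
      · obtain ⟨u, hu⟩ := (hlink x hxB.1).1
        exact Set.disjoint_left.1 hBC (hxB.2 u hu) (hxC.2 u hu)
    · rintro (h | h)
      exacts [hvB h, hvX.2 h.1]
    · rintro (h | h)
      exacts [hvC h, hvX.2 h.1]
    · ext x
      constructor
      · intro hx
        by_cases hxR : x ∈ R
        · obtain ⟨u, hu⟩ := hR x hxR
          have huE := (hu u).2 rfl
          have huR : u ∉ R := fun h => hout u h x hx huE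
          rcases hmem.2 ⟨h.source_mem hx huE, huR⟩ with rfl | huB | huC
          · exact absurd huE (hvR x hxR)
          · exact .inr (.inl (.inr ⟨hxR, fun w hw => by rwa [(hu w).1 hw]⟩))
          · exact .inr (.inr (.inr ⟨hxR, fun w hw => by rwa [(hu w).1 hw]⟩))
        · rcases hmem.2 ⟨hx, hxR⟩ with rfl | hxB | hxC
          · exact .inl rfl
          · exact .inr (.inl (.inl hxB))
          · exact .inr (.inr (.inl hxC))
      · rintro (rfl | (hx | hx) | (hx | hx))
        exacts [hvX.1, (hBX hx).1, hRX hx.1, (hCX hx).1, hRX hx.1]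

end SwitchingDigraph

universe u v w x

variable {L : FirstOrder.Language.{u, v}} {V : Type w} {I : Type x}

/-! ### Labelled forests -/

/-- The eigenvariables to whose `α`-node a node with the given label has a jump. -/
def Label.jumps : Label L V I → Set V
  | .eps M => termFree M
  | .cut A => A.free
  | _ => ∅

/-- The arities of the labels: the condition on the set `C` of the children of a node. -/
def Label.Fits {N : Type*} (lab : N → Label L V I) : Label L V I → Set N → Prop
  | .leaf _ S, C => S.Nonempty ∧ C = ∅
  | .alpha _, C => C.Nonempty
  | .plus, C => C.Nonempty ∧ ∀ y ∈ C, ∃ M, lab y = .eps M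
  | .eps _, C => ∃ y, C = {y}
  | .cut _, C => ∃ y z, y ≠ z ∧ C = {y, z}

theorem Label.Fits.image {N N' : Type*} {lab : N → Label L V I} {lab' : N' → Label L V I}
    {l : Label L V I} {C : Set N} {C' : Set N'} (h : l.Fits lab C) (f : N → N')
    (hf : f.Injective) (hlab : ∀ y, lab' (f y) = lab y) (hC : C' = f '' C) : l.Fits lab' C' := by
  subst hC
  cases l with
  | leaf P S => exact ⟨h.1, by rw [h.2, Set.image_empty]⟩
  | alpha a => exact Set.Nonempty.image f h
  | plus =>
    refine ⟨h.1.image f, ?_⟩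
    rintro _ ⟨y, hy, rfl⟩
    rw [hlab]
    exact h.2 y hy
  | eps M =>
    obtain ⟨y, rfl⟩ := h
    exact ⟨f y, Set.image_singleton⟩
  | cut A =>
    obtain ⟨y, z, hyz, rfl⟩ := h
    exact ⟨f y, f z, hf.ne hyz, Set.image_pair f y z⟩

/-- Finite forests, given by the parent function, whose labels have the right arities. Acyclicity is
expressed by `depth`. -/
structure IsLabelled {N : Type*} (lab : N → Label L V I) (par : N → Option N) : Prop where
  finite : Finite N
  depth : ∃ d : N → ℕ, ∀ y z, par y = some z → d z < d y
  fits : ∀ z, (lab z).Fits lab {y | par y = some z}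

section Constructions

variable {N : Type*} {lab : N → Label L V I} {par : N → Option N}

theorem IsLabelled.sum {N' : Type*} {lab' : N' → Label L V I} {par' : N' → Option N'}
    (h : IsLabelled lab par) (h' : IsLabelled lab' par') :
    IsLabelled (Sum.elim lab lab')
      (Sum.elim (fun y => (par y).map .inl) (fun y => (par' y).map .inr)) := by
  obtain ⟨hfin, ⟨d, hd⟩, hfits⟩ := h
  obtain ⟨hfin', ⟨d', hd'⟩, hfits'⟩ := h'
  refine ⟨inferInstance, ⟨Sum.elim d d', ?_⟩, ?_⟩
  · rintro (y | y) (z | z) h <;> simp at h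
    · exact hd y z h
    · exact hd' y z h
  · rintro (z | z)
    · refine (hfits z).image Sum.inl Sum.inl_injective (fun _ => rfl) ?_
      ext (y | y) <;> simp
    · refine (hfits' z).image Sum.inr Sum.inr_injective (fun _ => rfl) ?_
      ext (y | y) <;> simp

theorem IsLabelled.sigma {K : Type*} [Finite K] {N : K → Type*} {lab : ∀ k, N k → Label L V I}
    {par : ∀ k, N k → Option (N k)} (h : ∀ k, IsLabelled (lab k) (par k)) :
    IsLabelled (fun y : Σ k, N k => lab y.1 y.2)
      (fun y : Σ k, N k => (par y.1 y.2).map (Sigma.mk y.1)) := by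
  have hfin := fun k => (h k).finite
  choose d hd using fun k => (h k).depth
  refine ⟨inferInstance, ⟨fun y => d y.1 y.2, ?_⟩, ?_⟩
  · rintro ⟨k, y⟩ z h
    obtain ⟨w, hw, rfl⟩ := Option.map_eq_some_iff.1 h
    exact hd k y w hw
  · rintro ⟨k, z⟩
    refine ((h k).fits z).image (Sigma.mk k) sigma_mk_injective (fun _ => rfl) ?_
    ext ⟨l, y⟩
    constructor
    · intro h
      obtain ⟨w, hw, he⟩ := Option.map_eq_some_iff.1 h
      cases he
      exact ⟨y, hw, rfl⟩
    · rintro ⟨y, hy, he⟩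
      cases he
      exact Option.map_eq_some_iff.2 ⟨z, hy, rfl⟩

/-- Adding a root below all the roots of a labelled forest. -/
theorem IsLabelled.addRoot (h : IsLabelled lab par) {lab' : Option N → Label L V I}
    {par' : Option N → Option (Option N)} (hlab : ∀ y, lab' (some y) = lab y)
    (hpar : ∀ y, par' (some y) = some (par y)) (hroot : par' none = none)
    (hfit : (lab' none).Fits lab' (some '' {y | par y = none})) : IsLabelled lab' par' := by
  obtain ⟨hfin, ⟨d, hd⟩, hfits⟩ := h
  refine ⟨inferInstance, ⟨fun y => y.elim 0 fun y => d y + 1, ?_⟩, ?_⟩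
  · rintro (_ | y) (_ | z) h
    · rw [hroot] at h; cases h
    · rw [hroot] at h; cases h
    · exact Nat.succ_pos _
    · rw [hpar] at h
      exact Nat.succ_lt_succ (hd y z (Option.some_injective _ h))
  · rintro (_ | z)
    · have : {y | par' y = some none} = some '' {y | par y = none} := by
        ext (_ | y) <;> simp [hroot, hpar]
      rwa [this]
    · rw [hlab]
      refine (hfits z).image some (Option.some_injective _) hlab ?_
      ext (_ | y) <;> simp [hroot, hpar]

end Constructions

namespace Tree

/-- The outermost node. -/
def root : {A : Prenex L V 0} → (t : Tree L V I A) → t.Node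
  | _, leaf _ _ _ => ()
  | _, alpha _ _ t => (none : Option t.Node)
  | _, sum _ n _ t => (none : Option (Σ k : Fin (n + 1), Option (t k).Node))

theorem parent_eq_none_iff {A : Prenex L V 0} (t : Tree L V I A) (y : t.Node) :
    t.parent y = none ↔ y = t.root := by
  cases t with
  | leaf P S hS => exact ⟨fun _ => rfl, fun _ => rfl⟩
  | alpha A a t =>
    change Option t.Node at y
    rcases y with _ | y
    · exact ⟨fun _ => rfl, fun _ => rfl⟩
    · exact ⟨fun h => (by cases h), fun h => (by cases h)⟩
  | sum A n M t =>
    change Option (Σ k : Fin (n + 1), Option (t k).Node) at y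
    rcases y with _ | ⟨k, _ | y⟩
    · exact ⟨fun _ => rfl, fun _ => rfl⟩
    · exact ⟨fun h => (by cases h), fun h => (by cases h)⟩
    · exact ⟨fun h => (by cases h), fun h => (by cases h)⟩

theorem isLabelled {A : Prenex L V 0} (t : Tree L V I A) : IsLabelled t.label t.parent := by
  induction t with
  | leaf P S hS =>
    refine ⟨inferInstanceAs (Finite Unit), ⟨fun _ => 0, fun y z h => (by cases h)⟩, fun z => ?_⟩
    exact ⟨hS, by ext y; exact ⟨fun h => (by cases h), fun h => h.elim⟩⟩
  | alpha A a t ih =>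
    refine ih.addRoot (lab' := (alpha A a t).label) (par' := (alpha A a t).parent) (fun _ => rfl)
      (fun _ => rfl) rfl ?_
    exact ⟨_, t.root, (t.parent_eq_none_iff _).2 rfl, rfl⟩
  | sum A n M t ih =>
    have h : ∀ k, IsLabelled
        (fun y : Option (t k).Node => y.elim (.eps (M k)) fun y => (t k).label y)
        (fun y : Option (t k).Node => y.elim none fun y => some ((t k).parent y)) := by
      intro k
      refine (ih k).addRoot (fun _ => rfl) (fun _ => rfl) rfl ⟨some (t k).root, ?_⟩
      rw [← Set.image_singleton]
      congr 1
      ext y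
      exact (t k).parent_eq_none_iff y
    refine (IsLabelled.sigma h).addRoot (lab' := (sum A n M t).label)
      (par' := (sum A n M t).parent) ?_ ?_ rfl ⟨⟨_, ⟨0, none⟩, rfl, rfl⟩, ?_⟩
    · rintro ⟨k, _ | y⟩ <;> rfl
    · rintro ⟨k, _ | y⟩ <;> rfl
    · rintro _ ⟨⟨k, _ | y⟩, hy, rfl⟩
      · exact ⟨M k, rfl⟩
      · cases hy

theorem label_ne_cut {A : Prenex L V 0} (t : Tree L V I A) (y : t.Node) (B : Prenex L V 0) :
    t.label y ≠ .cut B := by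
  induction t with
  | leaf P S hS => exact fun h => by cases h
  | alpha A a t ih =>
    change Option t.Node at y
    rcases y with _ | y
    · exact fun h => by cases h
    · exact ih y
  | sum A n M t ih =>
    change Option (Σ k : Fin (n + 1), Option (t k).Node) at y
    rcases y with _ | ⟨k, _ | y⟩
    · exact fun h => by cases h
    · exact fun h => by cases h
    · exact ih k y

theorem label_root_ne_eps {A : Prenex L V 0} (t : Tree L V I A) (M : L.Term V) :
    t.label t.root ≠ .eps M := by
  cases t <;> exact fun h => by cases h

end Tree

theorem Root.isLabelled (r : Root L V I) : IsLabelled r.label r.parent := by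
  cases r with
  | tree A t => exact t.isLabelled
  | witness A M t =>
    refine t.isLabelled.addRoot (lab' := (Root.witness A M t).label)
      (par' := (Root.witness A M t).parent) (fun _ => rfl) (fun _ => rfl) rfl ⟨some t.root, ?_⟩
    rw [← Set.image_singleton]
    congr 1
    ext y
    exact t.parent_eq_none_iff y
  | cut A t s =>
    refine (t.isLabelled.sum s.isLabelled).addRoot (lab' := (Root.cut A t s).label)
      (par' := (Root.cut A t s).parent) ?_ ?_ rfl
      ⟨some (.inl t.root), some (.inr s.root), by simp, ?_⟩
    · rintro (y | y) <;> rfl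
    · rintro (y | y) <;> rfl
    · rw [← Set.image_pair]
      congr 1
      ext (y | y) <;> simp [Tree.parent_eq_none_iff]

theorem Forest.isLabelled (F : Forest L V I) :
    IsLabelled (Forest.label F) (Forest.parent F) := by
  induction F with
  | nil => exact ⟨inferInstanceAs (Finite Empty), ⟨fun _ => 0, fun y => y.elim⟩, fun y => y.elim⟩
  | cons r F ih =>
    have h := r.isLabelled.sum ih
    refine cast ?_ h
    congr 1
    · funext y; rcases y with y | y <;> rfl
    · funext y; rcases y with y | y <;> rfl

/-! ### The dependency graph -/

section DependencyGraph

variable {N : Type*}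

/-- The edges of the dependency graph of a labelled forest. All of `I` is added to the nodes, so
that the vertices depend on the nodes only. -/
inductive Edge (lab : N → Label L V I) (par : N → Option N) : N ⊕ I → N ⊕ I → Prop
  | child {y z : N} (h : par y = some z) : Edge lab par (.inl y) (.inl z)
  | jump {y z : N} {a : V} (hy : a ∈ (lab y).jumps) (hz : lab z = .alpha a) :
      Edge lab par (.inl y) (.inl z)
  | index {i : I} {z : N} {P : QFF L (V ⊕ Fin 0)} {S : Finset I} (hz : lab z = .leaf P S)
      (h : i ∈ S) : Edge lab par (.inr i) (.inl z)

/-- The switched vertices. -/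
def NodeSwitched (lab : N → Label L V I) : N ⊕ I → Prop :=
  Sum.elim (fun y => (lab y).IsSwitched) fun _ => False

variable {lab : N → Label L V I} {par : N → Option N}

theorem isBase_inr (i : I) : IsBase (Edge lab par) (NodeSwitched lab) (.inr i) :=
  ⟨fun h => h, fun u h => by cases h⟩

theorem isLink_of_isSwitched (h : IsLabelled lab par) {z : N} (hz : (lab z).IsSwitched) :
    IsLink (Edge lab par) (NodeSwitched lab) (.inl z) := by
  refine ⟨?_, .inl hz⟩
  have hf := h.fits z
  generalize hl : lab z = l at hz hf
  cases l with
  | leaf P S =>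
    obtain ⟨i, hi⟩ := hf.1
    exact ⟨.inr i, .index hl hi⟩
  | alpha a =>
    obtain ⟨y, hy⟩ := hf
    exact ⟨.inl y, .child hy⟩
  | plus =>
    obtain ⟨y, hy⟩ := hf.1
    exact ⟨.inl y, .child hy⟩
  | eps M => exact hz.elim
  | cut A => exact hz.elim

theorem edge_of_not_isSwitched {z : N} (hz : ¬ (lab z).IsSwitched) (u : N ⊕ I) :
    Edge lab par u (.inl z) ↔ ∃ y, par y = some z ∧ u = .inl y := by
  constructor
  · rintro (h | ⟨-, h⟩ | ⟨h, -⟩)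
    · exact ⟨_, h, rfl⟩
    · rw [h] at hz; exact absurd trivial hz
    · rw [h] at hz; exact absurd trivial hz
  · rintro ⟨y, hy, rfl⟩
    exact .child hy

theorem exists_edge_iff_of_eps (h : IsLabelled lab par) {z : N} {M : L.Term V}
    (hz : lab z = .eps M) : ∃ y, par y = some z ∧ ∀ u, Edge lab par u (.inl z) ↔ u = .inl y := by
  have hf := h.fits z
  rw [hz] at hf
  obtain ⟨y, hy⟩ := hf
  have hy' : ∀ w, par w = some z ↔ w = y := fun w => Set.ext_iff.1 hy w
  refine ⟨y, (hy' y).2 rfl, fun u => ?_⟩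
  rw [edge_of_not_isSwitched (by rw [hz]; exact id)]
  simp [hy']

theorem exists_edge_iff_of_cut (h : IsLabelled lab par) {z : N} {A : Prenex L V 0}
    (hz : lab z = .cut A) : ∃ y w, y ≠ w ∧
      ∀ u, Edge lab par u (.inl z) ↔ u = .inl y ∨ u = .inl w := by
  have hf := h.fits z
  rw [hz] at hf
  obtain ⟨y, w, hyw, hy⟩ := hf
  have hy' : ∀ u, par u = some z ↔ u = y ∨ u = w := fun u => Set.ext_iff.1 hy u
  refine ⟨y, w, hyw, fun u => ?_⟩
  rw [edge_of_not_isSwitched (by rw [hz]; exact id)]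
  simp only [hy', or_and_right, exists_or, exists_eq_left]

theorem isLink_of_eps (h : IsLabelled lab par) {z : N} {M : L.Term V}
    (hz : lab z = .eps M) : IsLink (Edge lab par) (NodeSwitched lab) (.inl z) := by
  obtain ⟨y, -, hy⟩ := exists_edge_iff_of_eps h hz
  exact ⟨⟨_, (hy _).2 rfl⟩, .inr ⟨_, fun w => (hy w).1⟩⟩

theorem isJoin_of_cut (h : IsLabelled lab par) {z : N} {A : Prenex L V 0}
    (hz : lab z = .cut A) : IsJoin (Edge lab par) (NodeSwitched lab) (.inl z) := by
  obtain ⟨y, w, hyw, hy⟩ := exists_edge_iff_of_cut h hz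
  refine ⟨?_, .inl y, .inl w, by simpa using hyw, hy⟩
  change ¬ (lab z).IsSwitched
  rw [hz]
  exact id

theorem sourcesOK_edge (h : IsLabelled lab par) :
    SourcesOK (Edge lab par) (NodeSwitched lab) := by
  rintro (z | i)
  · by_cases hz : (lab z).IsSwitched
    · exact .inr (.inl (isLink_of_isSwitched h hz))
    · generalize hl : lab z = l at hz
      cases l with
      | leaf | alpha | plus => exact absurd trivial hz
      | eps M => exact .inr (.inl (isLink_of_eps h hl))
      | cut A => exact .inr (.inr (isJoin_of_cut h hl))
  · exact .inl (isBase_inr i)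

end DependencyGraph

namespace Forest

/-- The nodes and indices of a forest. -/
def support (F : Forest L V I) : Set (Node F ⊕ I) :=
  Sum.inl '' Set.univ ∪ Sum.inr '' indices F

/-- The nodes and indices of the forest form a sub-net. -/
def IsNet (F : Forest L V I) : Prop :=
  IsSubnet (Edge (label F) (parent F)) (NodeSwitched (label F)) F.support

/-- The inclusion of the vertices of the dependency graph. -/
def vertexVal (F : Forest L V I) : Vertex F → Node F ⊕ I := Sum.map id Subtype.val

theorem vertexVal_injective (F : Forest L V I) : Function.Injective F.vertexVal :=
  Sum.map_injective.2 ⟨Function.injective_id, Subtype.val_injective⟩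

theorem depEdge_iff (F : Forest L V I) (p q : Vertex F) :
    DepEdge F p q ↔ Edge (label F) (parent F) (F.vertexVal p) (F.vertexVal q) := by
  constructor
  · rintro (⟨y, z, h⟩ | ⟨y, z, M, a, hy, hz, h⟩ | ⟨y, z, A, a, hy, hz, h⟩ | ⟨i, z, P, S, hz, h⟩)
    · exact .child h
    · exact .jump (y := y) (by rw [hy]; exact h) hz
    · exact .jump (y := y) (by rw [hy]; exact h) hz
    · exact .index hz h
  · rcases p with y | i <;> rcases q with z | j
    · rintro (h | ⟨h, hz⟩)
      · exact .child y z h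
      · change _ ∈ (label F y).jumps at h
        generalize hl : label F y = l at h
        cases l with
        | leaf | alpha | plus => exact False.elim h
        | eps M => exact .eps y z M _ hl hz h
        | cut A => exact .cut y z A _ hl hz h
    · rintro ⟨⟩
    · rintro ⟨⟩
      exact .index i z _ _ ‹_› ‹_›
    · rintro ⟨⟩

theorem exists_vertexVal_of_edge {F : Forest L V I} {u v : Node F ⊕ I}
    (h : Edge (label F) (parent F) u v) : ∃ p, F.vertexVal p = u := by
  rcases u with y | i
  · exact ⟨.inl y, rfl⟩
  · cases h with
    | @index _ z P S hz h => exact ⟨.inr ⟨i, z, P, S, hz, h⟩, rfl⟩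

/-- The switched vertices of the dependency graph. -/
def VertexSwitched (F : Forest L V I) (p : Vertex F) : Prop :=
  NodeSwitched (label F) (F.vertexVal p)

theorem sourcesOK_depEdge (F : Forest L V I) : SourcesOK (DepEdge F) F.VertexSwitched := by
  intro p
  rcases sourcesOK_edge F.isLabelled (F.vertexVal p) with ⟨hs, h⟩ | ⟨⟨u, hu⟩, h⟩ | ⟨hs, u, w, huw, h⟩
  · exact .inl ⟨hs, fun u hu => h _ ((F.depEdge_iff _ _).1 hu)⟩
  · obtain ⟨u, rfl⟩ := exists_vertexVal_of_edge hu
    refine .inr (.inl ⟨⟨u, (F.depEdge_iff _ _).2 hu⟩, h.imp_right ?_⟩)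
    rintro ⟨u', hu'⟩
    refine ⟨u, fun w hw => F.vertexVal_injective ?_⟩
    rw [hu' _ ((F.depEdge_iff _ _).1 hw), hu' _ hu]
  · obtain ⟨u, rfl⟩ := exists_vertexVal_of_edge ((h u).2 (.inl rfl))
    obtain ⟨w, rfl⟩ := exists_vertexVal_of_edge ((h w).2 (.inr rfl))
    refine .inr (.inr ⟨hs, u, w, fun h => huw (h ▸ rfl), fun x => ?_⟩)
    rw [depEdge_iff, h, F.vertexVal_injective.eq_iff, F.vertexVal_injective.eq_iff]

theorem support_eq (F : Forest L V I) : F.support = F.vertexVal '' Set.univ := by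
  ext (y | i)
  · exact ⟨fun _ => ⟨.inl y, trivial, rfl⟩, fun _ => .inl ⟨y, trivial, rfl⟩⟩
  · constructor
    · rintro (⟨_, _, h⟩ | ⟨j, hj, h⟩)
      · cases h
      · cases h
        exact ⟨.inr ⟨i, hj⟩, trivial, rfl⟩
    · rintro ⟨_ | j, -, h⟩
      · cases h
      · cases h
        exact .inr ⟨j.1, j.2, rfl⟩

theorem isNet_iff (F : Forest L V I) :
    F.IsNet ↔ IsSubnet (DepEdge F) F.VertexSwitched Set.univ := by
  rw [IsNet, support_eq]
  refine IsSubnet.image_iff _ F.vertexVal_injective.injOn (fun _ _ => Iff.rfl) ?_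
    fun _ _ _ _ => trivial
  intro v _ u'
  constructor
  · intro h
    obtain ⟨p, rfl⟩ := exists_vertexVal_of_edge h
    exact ⟨p, trivial, (F.depEdge_iff _ _).2 h, rfl⟩
  · rintro ⟨p, -, hp, rfl⟩
    exact (F.depEdge_iff _ _).1 hp

/-- The switching that chooses a child whenever there is one has no pair of antiparallel edges. -/
theorem exists_switching_anti (F : Forest L V I) : ∃ σ : Vertex F → Vertex F,
    (∀ v, F.VertexSwitched v → DepEdge F (σ v) v) ∧
      ∀ u v, Kept (DepEdge F) F.VertexSwitched σ u v →
        ¬ Kept (DepEdge F) F.VertexSwitched σ v u := by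
  have h : ∀ v, ∃ u, (F.VertexSwitched v → DepEdge F u v) ∧
      ∀ y z, u = .inl y → v = .inl z → F.VertexSwitched v → parent F y = some z := by
    rintro (z | i)
    · by_cases hz : (label F z).IsSwitched
      · have hf := F.isLabelled.fits z
        generalize hl : label F z = l at hf hz
        cases l with
        | leaf P S =>
          obtain ⟨i, hi⟩ := hf.1
          exact ⟨.inr ⟨i, z, P, S, hl, hi⟩, fun _ => .index _ z P S hl hi, fun y z h => by cases h⟩
        | alpha a =>
          obtain ⟨y, hy⟩ := hf
          refine ⟨.inl y, fun _ => .child y z hy, fun y' z' h h' _ => ?_⟩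
          cases h; cases h'; exact hy
        | plus =>
          obtain ⟨y, hy⟩ := hf.1
          refine ⟨.inl y, fun _ => .child y z hy, fun y' z' h h' _ => ?_⟩
          cases h; cases h'; exact hy
        | eps | cut => exact hz.elim
      · exact ⟨.inl z, fun h => absurd h hz, fun y z' _ h' hs => by cases h'; exact absurd hs hz⟩
    · exact ⟨.inr i, fun h => h.elim, fun y z h => by cases h⟩
  choose σ hσ hσ' using h
  obtain ⟨d, hd⟩ := F.isLabelled.depth
  have key : ∀ y z, Kept (DepEdge F) F.VertexSwitched σ (.inl y) (.inl z) → d z < d y := by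
    rintro y z ⟨hE, hk⟩
    by_cases hs : F.VertexSwitched (.inl z)
    · exact hd y z (hσ' (.inl z) y z (hk hs).symm rfl hs)
    · rw [depEdge_iff] at hE
      obtain ⟨y', hy', h⟩ := (edge_of_not_isSwitched hs _).1 hE
      cases h
      exact hd y z hy'
  refine ⟨σ, hσ, ?_⟩
  rintro (y | i) (z | j) h h'
  · exact lt_asymm (key y z h) (key z y h')
  · cases h.1
  · cases h'.1
  · cases h.1

/-- The switching graphs are the graphs of kept edges. -/
theorem isACC_iff_isTree (F : Forest L V I) : IsACC F ↔
    ∀ σ : Vertex F → Vertex F, (∀ v, F.VertexSwitched v → DepEdge F (σ v) v) →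
      (SimpleGraph.fromRel (Kept (DepEdge F) F.VertexSwitched σ)).IsTree := by
  have key : ∀ (τ : Switching F) (σ : Vertex F → Vertex F),
      (∀ y hy, σ (.inl y) = τ.choice y hy) →
      switchingGraph F τ = SimpleGraph.fromRel (Kept (DepEdge F) F.VertexSwitched σ) := by
    intro τ σ h
    unfold switchingGraph
    congr 1
    funext p q
    refine propext (and_congr_right fun _ => ⟨fun hk hq => ?_, ?_⟩)
    · rcases q with y | i
      · rw [h y hq]
        exact hk y hq rfl
      · exact hq.elim
    · rintro hk y hy rfl
      rw [← h y hy]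
      exact hk hy
  constructor
  · intro h σ hσ
    have := h ⟨fun y _ => σ (.inl y), fun y hy => hσ _ hy⟩
    rw [key _ σ fun _ _ => rfl] at this
    exact ⟨this.1, this.2⟩
  · intro h τ
    classical
    let σ : Vertex F → Vertex F := Sum.elim
      (fun y => if hy : (label F y).IsSwitched then τ.choice y hy else .inl y) .inr
    have hσ : ∀ y hy, σ (.inl y) = τ.choice y hy := fun y hy => dif_pos hy
    have := h σ ?_
    · rw [key τ σ hσ]
      exact ⟨this.1, this.2⟩
    · rintro (y | i) hs
      · rw [hσ y hs]
        exact τ.edge y hs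
      · exact hs.elim

/-- A typed forest is ACC-correct if and only if its dependency graph can be built up as a
sub-net. -/
theorem isACC_iff_isNet (F : Forest L V I) : IsACC F ↔ F.IsNet := by
  have : Finite (Node F) := F.isLabelled.finite
  have : Finite (indices F) := by
    refine Set.Finite.subset (s := ⋃ y : Node F, {i | ∃ P S, label F y = .leaf P S ∧ i ∈ S})
      (Set.finite_iUnion fun y => ?_) ?_
    · generalize label F y = l
      by_cases h : ∃ P S, l = .leaf P S
      · obtain ⟨P, S, rfl⟩ := h
        refine S.finite_toSet.subset ?_
        rintro i ⟨_, _, h, hi⟩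
        cases h
        exact hi
      · refine Set.finite_empty.subset ?_
        rintro i ⟨P, S, hl, -⟩
        exact h ⟨P, S, hl⟩
    · rintro i ⟨y, P, S, h⟩
      exact Set.mem_iUnion.2 ⟨y, P, S, h⟩
  have : Finite {i : I // i ∈ indices F} := this
  rw [isACC_iff_isTree, isNet_iff]
  exact ⟨fun h => isSubnet_univ_of_isTree F.sourcesOK_depEdge h F.exists_switching_anti,
    fun h σ hσ => h.isTree F.sourcesOK_depEdge hσ⟩

end Forest

/-! ### Maps of labelled forests -/

theorem inl_mem_image_union {α β : Type*} {D : Set α} {D' : Set β} {y : α} :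
    (Sum.inl y : α ⊕ β) ∈ Sum.inl '' D ∪ Sum.inr '' D' ↔ y ∈ D := by simp

theorem inr_mem_image_union {α β : Type*} {D : Set α} {D' : Set β} {y : β} :
    (Sum.inr y : α ⊕ β) ∈ Sum.inl '' D ∪ Sum.inr '' D' ↔ y ∈ D' := by simp

/-- `f` is injective on the set `D` of nodes, preserves the labels of its members, and maps the
children of each `z ∈ D`, which are required to be in `D`, onto the children of `f z`. Jumps are not
taken into account. -/
structure LocalIso {N N' : Type*} (lab : N → Label L V I) (par : N → Option N)
    (lab' : N' → Label L V I) (par' : N' → Option N') (f : N → N') (D : Set N) : Prop where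
  inj : Set.InjOn f D
  label : ∀ y ∈ D, lab' (f y) = lab y
  child : ∀ z ∈ D, ∀ y, par y = some z → y ∈ D ∧ par' (f y) = some (f z)
  exists_child : ∀ z ∈ D, ∀ y', par' y' = some (f z) → ∃ y ∈ D, par y = some z ∧ f y = y'

namespace LocalIso

section General

variable {N N' N'' : Type*} {lab : N → Label L V I} {par : N → Option N}
  {lab' : N' → Label L V I} {par' : N' → Option N'}
  {lab'' : N'' → Label L V I} {par'' : N'' → Option N''}
  {f : N → N'} {D : Set N}

theorem comp {g : N' → N''} {D' : Set N'} (hg : LocalIso lab' par' lab'' par'' g D')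
    (hf : LocalIso lab par lab' par' f D) (hD : ∀ y ∈ D, f y ∈ D') :
    LocalIso lab par lab'' par'' (g ∘ f) D where
  inj y hy z hz h := hf.inj hy hz (hg.inj (hD y hy) (hD z hz) h)
  label y hy := (hg.label _ (hD y hy)).trans (hf.label y hy)
  child z hz y h := by
    obtain ⟨hy, h'⟩ := hf.child z hz y h
    exact ⟨hy, (hg.child _ (hD z hz) _ h').2⟩
  exists_child z hz y'' h := by
    obtain ⟨y', hy', h', rfl⟩ := hg.exists_child _ (hD z hz) y'' h
    obtain ⟨y, hy, h'', rfl⟩ := hf.exists_child z hz y' h'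
    exact ⟨y, hy, h'', rfl⟩

theorem edge (h : LocalIso lab par lab' par' f D)
    (hj' : ∀ z ∈ D, ∀ a, lab z = .alpha a → ∀ y', a ∈ (lab' y').jumps → y' ∈ f '' D)
    {J : Set I} (hJ : ∀ y ∈ D, ∀ P S, lab y = .leaf P S → ∀ i ∈ S, i ∈ J) (v : N ⊕ I)
    (hv : v ∈ Sum.inl '' D ∪ Sum.inr '' J) (u' : N' ⊕ I) :
    Edge lab' par' u' (Sum.map f id v) ↔
      ∃ u ∈ Sum.inl '' D ∪ Sum.inr '' J, Edge lab par u v ∧ Sum.map f id u = u' := by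
  rcases v with z | i
  · have hz : z ∈ D := by simpa using hv
    constructor
    · rintro (h' | ⟨hy, h'⟩ | ⟨h', hi⟩)
      · obtain ⟨y, hy, h'', rfl⟩ := h.exists_child z hz _ h'
        exact ⟨.inl y, .inl ⟨y, hy, rfl⟩, .child h'', rfl⟩
      · rw [h.label z hz] at h'
        obtain ⟨y, hyD, rfl⟩ := hj' z hz _ h' _ hy
        rw [h.label y hyD] at hy
        exact ⟨.inl y, .inl ⟨y, hyD, rfl⟩, .jump hy h', rfl⟩
      · rw [h.label z hz] at h'
        exact ⟨.inr _, .inr ⟨_, hJ z hz _ _ h' _ hi, rfl⟩, .index h' hi, rfl⟩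
    · rintro ⟨u, hu, (h' | ⟨hy, h'⟩ | ⟨h', hi⟩), rfl⟩
      · exact .child (h.child z hz _ h').2
      · refine .jump ?_ ((h.label z hz).trans h')
        rwa [h.label _ (by simpa using hu)]
      · exact .index ((h.label z hz).trans h') hi
  · constructor
    · rintro ⟨⟩
    · rintro ⟨u, -, ⟨⟩, -⟩

theorem image_vertices (J : Set I) :
    Sum.map f id '' (Sum.inl '' D ∪ Sum.inr '' J) = Sum.inl '' (f '' D) ∪ Sum.inr '' J := by
  rw [Set.image_union, Set.image_image, Set.image_image, Set.image_image]
  rfl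

/-- Sub-nets are transported along local isomorphisms that are compatible with jumps. -/
theorem isSubnet_iff (h : LocalIso lab par lab' par' f D)
    (hj : ∀ z ∈ D, ∀ a, lab z = .alpha a → ∀ y, a ∈ (lab y).jumps → y ∈ D)
    (hj' : ∀ z ∈ D, ∀ a, lab z = .alpha a → ∀ y', a ∈ (lab' y').jumps → y' ∈ f '' D)
    {J : Set I} (hJ : ∀ y ∈ D, ∀ P S, lab y = .leaf P S → ∀ i ∈ S, i ∈ J) :
    IsSubnet (Edge lab' par') (NodeSwitched lab') (Sum.inl '' (f '' D) ∪ Sum.inr '' J) ↔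
      IsSubnet (Edge lab par) (NodeSwitched lab) (Sum.inl '' D ∪ Sum.inr '' J) := by
  rw [← image_vertices]
  refine IsSubnet.image_iff _ ?_ ?_ (h.edge hj' hJ) ?_
  · rintro (y | i) hy (z | j) hz hyz
    · rw [h.inj (by simpa using hy) (by simpa using hz) (Sum.inl_injective hyz)]
    · cases hyz
    · cases hyz
    · cases hyz; rfl
  · rintro (y | i) hy
    · have hy : y ∈ D := by simpa using hy
      change (lab' (f y)).IsSwitched ↔ (lab y).IsSwitched
      rw [h.label y hy]
    · exact Iff.rfl
  · rintro (z | i) hz u hu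
    · have hz : z ∈ D := by simpa using hz
      rcases hu with h' | ⟨hy, h'⟩ | ⟨h', hi⟩
      · exact .inl ⟨_, (h.child z hz _ h').1, rfl⟩
      · exact .inl ⟨_, hj z hz _ h' _ hy, rfl⟩
      · exact .inr ⟨_, hJ z hz _ _ h' _ hi, rfl⟩
    · cases hu

/-- Adding a root below a forest. -/
theorem some {lab' : Option N → Label L V I} {par' : Option N → Option (Option N)}
    (hlab : ∀ y, lab' (.some y) = lab y) (hpar : ∀ y, par' (.some y) = .some (par y))
    (hroot : par' none = none) : LocalIso lab par lab' par' Option.some Set.univ where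
  inj := (Option.some_injective _).injOn
  label y _ := hlab y
  child z _ y h := ⟨trivial, by rw [hpar, h]⟩
  exists_child z _ y' h := by
    rcases y' with _ | y
    · rw [hroot] at h; cases h
    · rw [hpar] at h
      exact ⟨y, trivial, Option.some_injective _ h, rfl⟩

end General

variable {N' : Type*} {lab' : N' → Label L V I} {par' : N' → Option N'}

theorem inl (r : Root L V I) (F : Forest L V I) :
    LocalIso r.label r.parent (Forest.label (r :: F)) (Forest.parent (r :: F)) Sum.inl
      Set.univ where
  inj := Sum.inl_injective.injOn
  label _ _ := rfl
  child z _ y h := ⟨trivial, congrArg (Option.map Sum.inl) h⟩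
  exists_child := by
    rintro z - (y | y) h
    · obtain ⟨z', h', he⟩ := Option.map_eq_some_iff.1 h
      cases he
      exact ⟨y, trivial, h', rfl⟩
    · obtain ⟨z', h', he⟩ := Option.map_eq_some_iff.1 h
      cases he

theorem inr (r : Root L V I) (F : Forest L V I) :
    LocalIso (Forest.label F) (Forest.parent F) (Forest.label (r :: F)) (Forest.parent (r :: F))
      Sum.inr Set.univ where
  inj := Sum.inr_injective.injOn
  label _ _ := rfl
  child z _ y h := ⟨trivial, congrArg (Option.map Sum.inr) h⟩
  exists_child := by
    rintro z - (y | y) h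
    · obtain ⟨z', h', he⟩ := Option.map_eq_some_iff.1 h
      cases he
    · obtain ⟨z', h', he⟩ := Option.map_eq_some_iff.1 h
      cases he
      exact ⟨y, trivial, h', rfl⟩

theorem nil (f : Forest.Node ([] : Forest L V I) → N') (D : Set (Forest.Node ([] : Forest L V I))) :
    LocalIso (Forest.label []) (Forest.parent []) lab' par' f D :=
  ⟨fun y => y.elim, fun y => y.elim, fun y => y.elim, fun y => y.elim⟩

/-- Local isomorphisms with disjoint images are put together. -/
theorem cons {r : Root L V I} {F : Forest L V I} {f : r.Node → N'} {g : Forest.Node F → N'}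
    {D : Set r.Node} {D' : Set (Forest.Node F)}
    (hf : LocalIso r.label r.parent lab' par' f D)
    (hg : LocalIso (Forest.label F) (Forest.parent F) lab' par' g D')
    (hdis : ∀ y ∈ D, ∀ z ∈ D', f y ≠ g z) :
    LocalIso (Forest.label (r :: F)) (Forest.parent (r :: F)) lab' par'
      (Sum.elim f g) (Sum.inl '' D ∪ Sum.inr '' D') where
  inj := by
    rintro (y | y) hy (z | z) hz h
    · rw [hf.inj (inl_mem_image_union.1 hy) (inl_mem_image_union.1 hz) h]
    · exact absurd h (hdis _ (inl_mem_image_union.1 hy) _ (inr_mem_image_union.1 hz))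
    · exact absurd h.symm (hdis _ (inl_mem_image_union.1 hz) _ (inr_mem_image_union.1 hy))
    · rw [hg.inj (inr_mem_image_union.1 hy) (inr_mem_image_union.1 hz) h]
  label := by
    rintro (y | y) hy
    · exact hf.label y (inl_mem_image_union.1 hy)
    · exact hg.label y (inr_mem_image_union.1 hy)
  child := by
    rintro (z | z) hz (y | y) h
    all_goals obtain ⟨z', h', he⟩ := Option.map_eq_some_iff.1 h
    all_goals cases he
    · obtain ⟨h1, h2⟩ := hf.child z (inl_mem_image_union.1 hz) y h'
      exact ⟨.inl ⟨y, h1, rfl⟩, h2⟩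
    · obtain ⟨h1, h2⟩ := hg.child z (inr_mem_image_union.1 hz) y h'
      exact ⟨.inr ⟨y, h1, rfl⟩, h2⟩
  exists_child := by
    rintro (z | z) hz y' h
    · obtain ⟨y, hy, h', rfl⟩ := hf.exists_child z (inl_mem_image_union.1 hz) y' h
      exact ⟨.inl y, .inl ⟨y, hy, rfl⟩, congrArg (Option.map Sum.inl) h', rfl⟩
    · obtain ⟨y, hy, h', rfl⟩ := hg.exists_child z (inr_mem_image_union.1 hz) y' h
      exact ⟨.inr y, .inr ⟨y, hy, rfl⟩, congrArg (Option.map Sum.inr) h', rfl⟩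

theorem cons_univ {r : Root L V I} {F : Forest L V I} {f : r.Node → N'} {g : Forest.Node F → N'}
    (hf : LocalIso r.label r.parent lab' par' f Set.univ)
    (hg : LocalIso (Forest.label F) (Forest.parent F) lab' par' g Set.univ)
    (hdis : ∀ y z, f y ≠ g z) :
    LocalIso (Forest.label (r :: F)) (Forest.parent (r :: F)) lab' par' (Sum.elim f g)
      Set.univ := by
  have h : (Sum.inl '' Set.univ ∪ Sum.inr '' Set.univ : Set (r.Node ⊕ Forest.Node F)) =
      Set.univ := by
    rw [Set.image_univ, Set.image_univ, Set.range_inl_union_range_inr]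
  exact cast (congrArg (LocalIso _ _ _ _ _) h) (hf.cons hg fun y _ z _ => hdis y z)

theorem alpha (A : Prenex L V 1) (a : V) (t : Tree L V I (A.inst (.var a))) :
    LocalIso (Root.tree _ t).label (Root.tree _ t).parent (Root.tree _ (.alpha A a t)).label
      (Root.tree _ (.alpha A a t)).parent Option.some Set.univ :=
  .some (fun _ => rfl) (fun _ => rfl) rfl

theorem summand (A : Prenex L V 1) (n : ℕ) (M : Fin (n + 1) → L.Term V)
    (t : ∀ k, Tree L V I (A.inst (M k))) (k : Fin (n + 1)) :
    LocalIso (Root.tree _ (t k)).label (Root.tree _ (t k)).parent (Root.tree _ (.sum A n M t)).label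
      (Root.tree _ (.sum A n M t)).parent
      (fun y => Option.some (⟨k, .some y⟩ : Σ k : Fin (n + 1), Option (t k).Node)) Set.univ where
  inj y _ z _ h := by
    have := sigma_mk_injective (Option.some_injective _ h)
    exact Option.some_injective _ this
  label _ _ := rfl
  child z _ y h := by
    refine ⟨trivial, ?_⟩
    change Option.some (Option.some (⟨k, (t k).parent y⟩ : Σ k : Fin (n + 1), Option (t k).Node)) = _
    rw [show (t k).parent y = Option.some z from h]
    rfl
  exists_child z _ y' h := by
    change Option (Σ k : Fin (n + 1), Option (t k).Node) at y'
    rcases y' with _ | ⟨l, _ | y⟩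
    · cases h
    · cases h
    · have h := Option.some_injective _ (Option.some_injective _ h)
      obtain rfl : l = k := congrArg Sigma.fst h
      exact ⟨y, trivial, sigma_mk_injective (β := fun j => Option (t j).Node) h, rfl⟩

theorem cutLeft (A : Prenex L V 0) (t : Tree L V I A) (s : Tree L V I A.dual) :
    LocalIso (Root.tree _ t).label (Root.tree _ t).parent (Root.cut A t s).label
      (Root.cut A t s).parent (fun y => Option.some (.inl y)) Set.univ where
  inj y _ z _ h := Sum.inl_injective (Option.some_injective _ h)
  label _ _ := rfl
  child z _ y h := by
    refine ⟨trivial, ?_⟩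
    change Option.some ((t.parent y).map Sum.inl) = _
    rw [show t.parent y = Option.some z from h]
    rfl
  exists_child := by
    rintro z - (_ | y | y) h
    · cases h
    · obtain ⟨z', h', he⟩ := Option.map_eq_some_iff.1 (Option.some_injective _ h)
      cases he
      exact ⟨y, trivial, h', rfl⟩
    · obtain ⟨z', h', he⟩ := Option.map_eq_some_iff.1 (Option.some_injective _ h)
      cases he

theorem cutRight (A : Prenex L V 0) (t : Tree L V I A) (s : Tree L V I A.dual) :
    LocalIso (Root.tree _ s).label (Root.tree _ s).parent (Root.cut A t s).label
      (Root.cut A t s).parent (fun y => Option.some (.inr y)) Set.univ where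
  inj y _ z _ h := Sum.inr_injective (Option.some_injective _ h)
  label _ _ := rfl
  child z _ y h := by
    refine ⟨trivial, ?_⟩
    change Option.some ((s.parent y).map Sum.inr) = _
    rw [show s.parent y = Option.some z from h]
    rfl
  exists_child := by
    rintro z - (_ | y | y) h
    · cases h
    · obtain ⟨z', h', he⟩ := Option.map_eq_some_iff.1 (Option.some_injective _ h)
      cases he
    · obtain ⟨z', h', he⟩ := Option.map_eq_some_iff.1 (Option.some_injective _ h)
      cases he
      exact ⟨y, trivial, h', rfl⟩

/-- A sum with some of its summands, the roots being left out, is embedded in the whole sum. -/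
theorem subsum (A : Prenex L V 1) (m k : ℕ) (e : Fin (m + 1) → Fin (k + 1))
    (he : Function.Injective e) (M : Fin (k + 1) → L.Term V)
    (t : ∀ j, Tree L V I (A.inst (M j))) :
    LocalIso (Root.tree _ (.sum A m (fun j => M (e j)) (fun j => t (e j)))).label
      (Root.tree _ (.sum A m (fun j => M (e j)) (fun j => t (e j)))).parent
      (Root.tree _ (.sum A k M t)).label (Root.tree _ (.sum A k M t)).parent
      (Option.map fun y : Σ j : Fin (m + 1), Option (t (e j)).Node =>
        (⟨e y.1, y.2⟩ : Σ j : Fin (k + 1), Option (t j).Node))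
      (Set.range (Option.some : (Σ j : Fin (m + 1), Option (t (e j)).Node) → _)) where
  inj := by
    rintro _ ⟨⟨i, y⟩, rfl⟩ _ ⟨⟨j, z⟩, rfl⟩ h
    have h := Option.some_injective _ h
    obtain rfl : i = j := he (congrArg Sigma.fst h)
    obtain rfl : y = z := sigma_mk_injective (β := fun j => Option (t j).Node) h
    rfl
  label := by
    rintro _ ⟨⟨i, _ | y⟩, rfl⟩ <;> rfl
  child := by
    rintro _ ⟨⟨i, z⟩, rfl⟩ (_ | ⟨j, _ | y⟩) h
    · cases h
    · cases h
    · have h := Option.some_injective _ (Option.some_injective _ h)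
      obtain rfl : j = i := congrArg Sigma.fst h
      obtain rfl := sigma_mk_injective h
      exact ⟨⟨_, rfl⟩, rfl⟩
  exists_child := by
    rintro _ ⟨⟨i, z⟩, rfl⟩ (_ | ⟨j, _ | y⟩) h
    · cases h
    · cases h
    · have h := Option.some_injective _ (Option.some_injective _ h)
      obtain rfl : j = e i := congrArg Sigma.fst h
      obtain rfl := sigma_mk_injective (β := fun j => Option (t j).Node) h
      exact ⟨Option.some ⟨i, Option.some y⟩, ⟨_, rfl⟩, rfl, rfl⟩

end LocalIso

namespace Forest

/-- The nodes of the first part of a forest. -/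
def appendLeft : (F G : Forest L V I) → Node F → Node (F ++ G)
  | [], _, y => y.elim
  | _ :: _, _, .inl y => .inl y
  | _ :: F, G, .inr y => .inr (appendLeft F G y)

/-- The nodes of the second part of a forest. -/
def appendRight : (F G : Forest L V I) → Node G → Node (F ++ G)
  | [], _, y => y
  | _ :: F, G, y => .inr (appendRight F G y)

theorem localIso_appendLeft (F G : Forest L V I) :
    LocalIso (label F) (parent F) (label (F ++ G)) (parent (F ++ G)) (appendLeft F G)
      Set.univ := by
  induction F with
  | nil => exact LocalIso.nil _ _
  | cons r F ih =>
    have := (LocalIso.inl r (F ++ G)).cons_univ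
      ((LocalIso.inr r (F ++ G)).comp ih fun _ _ => trivial) fun y z h => by cases h
    refine cast (congrArg (fun f => LocalIso _ _ _ _ f _) ?_) this
    funext y
    rcases y with y | y <;> rfl

theorem localIso_appendRight (F G : Forest L V I) :
    LocalIso (label G) (parent G) (label (F ++ G)) (parent (F ++ G)) (appendRight F G)
      Set.univ := by
  induction F with
  | nil => exact ⟨fun _ _ _ _ h => h, fun _ _ => rfl, fun _ _ _ h => ⟨trivial, h⟩,
      fun _ _ y h => ⟨y, trivial, h, rfl⟩⟩
  | cons r F ih => exact (LocalIso.inr r (F ++ G)).comp ih fun _ _ => trivial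

theorem appendLeft_ne_appendRight (F G : Forest L V I) (y : Node F) (z : Node G) :
    appendLeft F G y ≠ appendRight F G z := by
  induction F with
  | nil => exact y.elim
  | cons r F ih =>
    rcases y with y | y
    · exact fun h => by cases h
    · exact fun h => ih y (Sum.inr_injective h)

theorem append_cases (F G : Forest L V I) (x : Node (F ++ G)) :
    (∃ y, appendLeft F G y = x) ∨ ∃ z, appendRight F G z = x := by
  induction F with
  | nil => exact .inr ⟨x, rfl⟩
  | cons r F ih =>
    rcases x with y | y
    · exact .inl ⟨.inl y, rfl⟩
    · rcases ih y with ⟨y, rfl⟩ | ⟨z, rfl⟩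
      · exact .inl ⟨.inr y, rfl⟩
      · exact .inr ⟨z, rfl⟩

/-- Permuting the roots permutes the nodes. -/
theorem exists_equiv_of_perm {F G : Forest L V I} (h : F.Perm G) :
    ∃ e : Node F ≃ Node G, (∀ y, label G (e y) = label F y) ∧
      ∀ y, parent G (e y) = (parent F y).map e := by
  induction h with
  | nil => exact ⟨.refl _, fun _ => rfl, fun y => y.elim⟩
  | @cons r F G _ ih =>
    obtain ⟨e, h1, h2⟩ := ih
    refine ⟨Equiv.sumCongr (.refl _) e, ?_, ?_⟩
    · rintro (y | y)
      · rfl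
      · exact h1 y
    · rintro (y | y)
      · change Option.map _ (r.parent y) = Option.map _ (Option.map _ (r.parent y))
        cases r.parent y <;> rfl
      · change Option.map _ (parent G (e y)) = Option.map _ (Option.map _ _)
        rw [h2]
        cases parent F y <;> rfl
  | swap r r' F =>
    refine ⟨(Equiv.sumAssoc _ _ _).symm.trans ((Equiv.sumCongr (Equiv.sumComm _ _) (.refl _)).trans
      (Equiv.sumAssoc _ _ _)), ?_, ?_⟩
    · rintro (y | y | y) <;> rfl
    · rintro (y | y | y)
      · change Option.map _ (Option.map _ (r'.parent y)) = Option.map _ (Option.map _ (r'.parent y))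
        cases r'.parent y <;> rfl
      · change Option.map _ (r.parent y) = Option.map _ (Option.map _ (Option.map _ (r.parent y)))
        cases r.parent y <;> rfl
      · change Option.map _ (Option.map _ (parent F y)) =
          Option.map _ (Option.map _ (Option.map _ (parent F y)))
        cases parent F y <;> rfl
  | trans _ _ ih ih' =>
    obtain ⟨e, h1, h2⟩ := ih
    obtain ⟨e', h1', h2'⟩ := ih'
    refine ⟨e.trans e', fun y => (h1' _).trans (h1 y), fun y => ?_⟩
    rw [Equiv.trans_apply, h2', h2, Option.map_map]
    rfl

theorem exists_localIso_of_perm {F G : Forest L V I} (h : F.Perm G) :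
    ∃ e : Node F ≃ Node G, LocalIso (label F) (parent F) (label G) (parent G) e Set.univ := by
  obtain ⟨e, h1, h2⟩ := exists_equiv_of_perm h
  refine ⟨e, e.injective.injOn, fun y _ => h1 y, fun z _ y h => ⟨trivial, ?_⟩, fun z _ y' h => ?_⟩
  · rw [h2, h]; rfl
  · obtain ⟨y, rfl⟩ := e.surjective y'
    rw [h2] at h
    obtain ⟨z', h', he⟩ := Option.map_eq_some_iff.1 h
    exact ⟨y, trivial, e.injective he ▸ h', rfl⟩

/-! ### Labels -/

/-- The labels of the nodes. -/
def labels (F : Forest L V I) : Set (Label L V I) := Set.range (label F)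

theorem labels_perm {F G : Forest L V I} (h : F.Perm G) : labels F = labels G := by
  obtain ⟨e, h1, -⟩ := exists_equiv_of_perm h
  rw [labels, labels, ← e.surjective.range_comp]
  congr 1
  funext y
  exact (h1 y).symm

end Forest

namespace Tree

/-- The labels of the nodes. -/
def labels {A : Prenex L V 0} (t : Tree L V I A) : Set (Label L V I) := Set.range t.label

theorem labels_leaf (P : QFF L (V ⊕ Fin 0)) (S : Finset I) (hS : S.Nonempty) :
    (leaf P S hS).labels = {.leaf P S} := by
  ext l
  exact ⟨fun ⟨_, h⟩ => h.symm, fun h => ⟨(), h.symm⟩⟩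

theorem labels_alpha (A : Prenex L V 1) (a : V) (t : Tree L V I (A.inst (.var a))) :
    (alpha A a t).labels = insert (.alpha a) t.labels := by
  ext l
  constructor
  · rintro ⟨_ | y, rfl⟩
    · exact .inl rfl
    · exact .inr ⟨y, rfl⟩
  · rintro (rfl | ⟨y, rfl⟩)
    · exact ⟨(none : Option t.Node), rfl⟩
    · exact ⟨some y, rfl⟩

theorem labels_sum (A : Prenex L V 1) (n : ℕ) (M : Fin (n + 1) → L.Term V)
    (t : ∀ k, Tree L V I (A.inst (M k))) :
    (sum A n M t).labels = insert .plus (⋃ k, insert (.eps (M k)) (t k).labels) := by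
  ext l
  constructor
  · rintro ⟨_ | ⟨k, _ | y⟩, rfl⟩
    · exact .inl rfl
    · exact .inr (Set.mem_iUnion.2 ⟨k, .inl rfl⟩)
    · exact .inr (Set.mem_iUnion.2 ⟨k, .inr ⟨y, rfl⟩⟩)
  · rintro (rfl | h)
    · exact ⟨(none : Option (Σ k : Fin (n + 1), Option (t k).Node)), rfl⟩
    · obtain ⟨k, rfl | ⟨y, rfl⟩⟩ := Set.mem_iUnion.1 h
      · exact ⟨some ⟨k, none⟩, rfl⟩
      · exact ⟨some ⟨k, some y⟩, rfl⟩

end Tree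

namespace Root

/-- The labels of the nodes. -/
def labels (r : Root L V I) : Set (Label L V I) := Set.range r.label

theorem labels_tree {A : Prenex L V 0} (t : Tree L V I A) : (tree A t).labels = t.labels := rfl

theorem labels_cut (A : Prenex L V 0) (t : Tree L V I A) (s : Tree L V I A.dual) :
    (cut A t s).labels = insert (.cut A) (t.labels ∪ s.labels) := by
  ext l
  constructor
  · rintro ⟨_ | y | y, rfl⟩
    · exact .inl rfl
    · exact .inr (.inl ⟨y, rfl⟩)
    · exact .inr (.inr ⟨y, rfl⟩)
  · rintro (rfl | ⟨y, rfl⟩ | ⟨y, rfl⟩)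
    · exact ⟨none, rfl⟩
    · exact ⟨some (.inl y), rfl⟩
    · exact ⟨some (.inr y), rfl⟩

end Root

namespace Forest

theorem labels_nil : labels ([] : Forest L V I) = ∅ := by
  ext l
  exact ⟨fun ⟨y, _⟩ => y.elim, fun h => h.elim⟩

theorem labels_cons (r : Root L V I) (F : Forest L V I) :
    labels (r :: F) = r.labels ∪ labels F := by
  ext l
  constructor
  · rintro ⟨y | y, rfl⟩
    · exact .inl ⟨y, rfl⟩
    · exact .inr ⟨y, rfl⟩
  · rintro (⟨y, rfl⟩ | ⟨y, rfl⟩)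
    · exact ⟨.inl y, rfl⟩
    · exact ⟨.inr y, rfl⟩

theorem labels_append (F G : Forest L V I) : labels (F ++ G) = labels F ∪ labels G := by
  induction F with
  | nil => rw [labels_nil, Set.empty_union, List.nil_append]
  | cons r F ih => rw [List.cons_append, labels_cons, labels_cons, ih, Set.union_assoc]

theorem mem_disjuncts {F : Forest L V I} {i : I} {P : QFF L (V ⊕ Fin 0)} :
    P ∈ disjuncts F i ↔ ∃ S, .leaf P S ∈ labels F ∧ i ∈ S :=
  ⟨fun ⟨y, S, h, hi⟩ => ⟨S, ⟨y, h⟩, hi⟩, fun ⟨S, ⟨y, h⟩, hi⟩ => ⟨y, S, h, hi⟩⟩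

theorem mem_indices {F : Forest L V I} {i : I} : i ∈ indices F ↔ ∃ P, P ∈ disjuncts F i :=
  ⟨fun ⟨y, P, S, h, hi⟩ => ⟨P, y, S, h, hi⟩, fun ⟨P, y, S, h, hi⟩ => ⟨y, P, S, h, hi⟩⟩

theorem indices_eq_of_disjuncts {F G : Forest L V I} (h : disjuncts F = disjuncts G) :
    indices F = indices G := by
  ext i
  rw [mem_indices, mem_indices, h]

theorem mem_bound {F : Forest L V I} {a : V} : a ∈ bound F ↔ .alpha a ∈ labels F := Iff.rfl

/-- The eigenvariables that would be targets of jumps from the forest. -/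
def jumps (F : Forest L V I) : Set V := {a | ∃ l ∈ labels F, a ∈ l.jumps}

theorem isHerbrandStructure_of_disjuncts {T : L.Theory} {F G : Forest L V I}
    (h : disjuncts F = disjuncts G) (hF : IsHerbrandStructure T F) : IsHerbrandStructure T G := by
  intro i hi
  rw [← h]
  exact hF i (by rwa [indices_eq_of_disjuncts h])

/-! ### Correctness and the rules -/

/-- A set of nodes, with all the indices. -/
def part (F : Forest L V I) (D : Set (Node F)) : Set (Node F ⊕ I) :=
  Sum.inl '' D ∪ Sum.inr '' indices F

/-- The nodes in `D` and the indices form a sub-net. -/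
def IsNetOn (F : Forest L V I) (D : Set (Node F)) : Prop :=
  IsSubnet (Edge (label F) (parent F)) (NodeSwitched (label F)) (F.part D)

theorem inl_mem_part {F : Forest L V I} {D : Set (Node F)} {y : Node F} :
    .inl y ∈ F.part D ↔ y ∈ D := inl_mem_image_union

theorem inr_mem_part {F : Forest L V I} {D : Set (Node F)} {i : I} :
    .inr i ∈ F.part D ↔ i ∈ indices F := inr_mem_image_union

/-- Links that are not sources of other nodes do not affect correctness. -/
theorem isNetOn_iff_of_subset {F : Forest L V I} {D D' : Set (Node F)} (hDD' : D ⊆ D')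
    (hlink : ∀ y ∈ D', y ∉ D → IsLink (Edge (label F) (parent F)) (NodeSwitched (label F)) (.inl y))
    (hclosed : ∀ z ∈ D, ∀ y ∈ D', Edge (label F) (parent F) (.inl y) (.inl z) → y ∈ D)
    (hsrc : ∀ z ∈ D', z ∉ D → ∀ y, Edge (label F) (parent F) (.inl y) (.inl z) → y ∈ D) :
    IsNetOn F D' ↔ IsNetOn F D := by
  have hR : ∀ r ∈ (Sum.inl '' (D' \ D) : Set (Node F ⊕ I)),
      IsLink (Edge (label F) (parent F)) (NodeSwitched (label F)) r := by
    rintro _ ⟨y, ⟨hy, hy'⟩, rfl⟩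
    exact hlink y hy hy'
  constructor
  · intro h
    have := h.diff (Sum.inl '' (D' \ D)) hR ?_
    · refine cast (congrArg (IsSubnet _ _) ?_) this
      ext (y | i)
      · simp only [Set.mem_sdiff, inl_mem_part, Set.mem_image, Sum.inl.injEq, exists_eq_right]
        exact ⟨fun h => by_contra fun h' => h.2 ⟨h.1, h'⟩, fun h => ⟨hDD' h, fun h' => h'.2 h⟩⟩
      · simp [inr_mem_part]
    · rintro _ ⟨y, ⟨hy, hy'⟩, rfl⟩ (z | i) hz hE
      · by_contra hzR
        have hzD : z ∈ D := by
          by_contra hzD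
          exact hzR ⟨z, ⟨inl_mem_part.1 hz, hzD⟩, rfl⟩
        exact hy' (hclosed z hzD y hy hE)
      · cases hE
  · intro h
    have : Finite (Node F) := F.isLabelled.finite
    have := h.union (Sum.inl '' (D' \ D)) (Set.toFinite _) hR ?_
    · refine cast (congrArg (IsSubnet _ _) ?_) this
      ext (y | i)
      · simp only [Set.mem_union, inl_mem_part, Set.mem_image, Sum.inl.injEq, exists_eq_right,
          Set.mem_sdiff]
        exact ⟨fun h => h.elim (fun h => hDD' h) fun h => h.1,
          fun h => or_iff_not_imp_left.2 fun h' => ⟨h, h'⟩⟩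
      · simp [inr_mem_part]
    · rintro _ ⟨z, ⟨hz, hz'⟩, rfl⟩ (y | i) hE
      · exact inl_mem_part.2 (hsrc z hz hz' y hE)
      · cases hE with
        | index hl hi => exact inr_mem_part.2 ⟨z, _, _, hl, hi⟩

/-- Switched roots do not affect correctness. -/
theorem isNet_iff_isNetOn {F : Forest L V I} (D : Set (Node F))
    (hroot : ∀ y ∉ D, parent F y = none ∧ (label F y).IsSwitched) : F.IsNet ↔ F.IsNetOn D := by
  have key : ∀ y z, Edge (label F) (parent F) (.inl y) (.inl z) → y ∈ D := by
    intro y z h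
    by_contra hy
    obtain ⟨h1, h2⟩ := hroot y hy
    rcases h with h | ⟨h, -⟩
    · rw [h1] at h; cases h
    · generalize label F y = l at h h2
      cases l with
      | leaf | alpha | plus => exact h
      | eps | cut => exact h2
  exact isNetOn_iff_of_subset (Set.subset_univ D)
    (fun y _ hy => isLink_of_isSwitched F.isLabelled (hroot y hy).2)
    (fun z _ y _ h => key y z h) (fun z _ _ y h => key y z h)

theorem isNetOn_image_iff {F G : Forest L V I} {f : Node F → Node G} {D : Set (Node F)}
    (h : LocalIso (label F) (parent F) (label G) (parent G) f D)
    (hj : ∀ y ∉ D, (label F y).jumps = ∅)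
    (hj' : ∀ a ∈ bound F, ∀ y ∉ f '' D, a ∉ (label G y).jumps)
    (hidx : indices G = indices F) : G.IsNetOn (f '' D) ↔ F.IsNetOn D := by
  unfold IsNetOn part
  rw [hidx]
  refine h.isSubnet_iff ?_ ?_ ?_
  · intro z _ a _ y hy
    by_contra hyD
    rw [hj y hyD] at hy
    exact hy
  · intro z _ a hz y' hy'
    by_contra hyD
    exact hj' a ⟨z, hz⟩ y' hyD hy'
  · exact fun y _ P S hl i hi => ⟨y, P, S, hl, hi⟩

theorem isNet_perm {F G : Forest L V I} (h : F.Perm G) : F.IsNet ↔ G.IsNet := by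
  obtain ⟨e, he⟩ := exists_localIso_of_perm h
  have hidx : indices G = indices F := by
    refine indices_eq_of_disjuncts (funext fun i => Set.ext fun P => ?_)
    rw [mem_disjuncts, mem_disjuncts, labels_perm h]
  have hr : e '' Set.univ = Set.univ := Set.image_univ_of_surjective e.surjective
  have := isNetOn_image_iff he (fun y hy => absurd trivial hy)
    (fun a _ y hy => absurd (hr ▸ trivial) hy) hidx
  rw [hr] at this
  exact this.symm

/-- A map between roots extends to forests by the identity on the other roots, and misses the same
nodes. -/
theorem exists_localIso_cons {r r' : Root L V I} {g : r.Node → r'.Node}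
    (hg : LocalIso r.label r.parent r'.label r'.parent g Set.univ) (F : Forest L V I) :
    ∃ f : Node (r :: F) → Node (r' :: F),
      LocalIso (label (r :: F)) (parent (r :: F)) (label (r' :: F)) (parent (r' :: F)) f Set.univ ∧
      ∀ y, y ∉ f '' Set.univ ↔ ∃ z, (∀ x, g x ≠ z) ∧ y = Sum.inl z := by
  have hf := ((LocalIso.inl r' F).comp hg fun _ _ => trivial).cons_univ (LocalIso.inr r' F)
    fun y z h => by cases h
  refine ⟨_, hf, fun y => ⟨fun hy => ?_, ?_⟩⟩
  · rcases y with y | y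
    · exact ⟨y, fun x hx => hy ⟨Sum.inl x, trivial, congrArg Sum.inl hx⟩, rfl⟩
    · exact absurd ⟨Sum.inr y, trivial, rfl⟩ hy
  · rintro ⟨z, hz, rfl⟩ ⟨x | x, -, hx⟩
    · exact hz x (Sum.inl_injective hx)
    · cases hx

theorem exists_localIso_alpha (F : Forest L V I) (A : Prenex L V 1) (a : V)
    (t : Tree L V I (A.inst (.var a))) :
    ∃ f : Node (.tree _ t :: F) → Node (.tree _ (.alpha A a t) :: F),
      LocalIso (label (.tree _ t :: F)) (parent (.tree _ t :: F))
        (label (.tree _ (.alpha A a t) :: F)) (parent (.tree _ (.alpha A a t) :: F)) f Set.univ ∧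
      ∀ y ∉ f '' Set.univ, parent (.tree _ (.alpha A a t) :: F) y = none ∧
        label (.tree _ (.alpha A a t) :: F) y = .alpha a := by
  obtain ⟨f, hf, h⟩ := exists_localIso_cons (LocalIso.alpha A a t) F
  refine ⟨f, hf, fun y hy => ?_⟩
  obtain ⟨_ | z, hz, rfl⟩ := (h y).1 hy
  · exact ⟨rfl, rfl⟩
  · exact absurd rfl (hz z)

theorem disjuncts_alpha (F : Forest L V I) (A : Prenex L V 1) (a : V)
    (t : Tree L V I (A.inst (.var a))) :
    disjuncts (.tree _ (.alpha A a t) :: F) = disjuncts (.tree _ t :: F) := by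
  refine funext fun i => Set.ext fun P => ?_
  simp [mem_disjuncts, labels_cons, Root.labels_tree, Tree.labels_alpha]

/-- The `∀`-rule adds a switched root, which does not affect correctness. -/
theorem isNet_alpha_iff (F : Forest L V I) (A : Prenex L V 1) (a : V)
    (t : Tree L V I (A.inst (.var a))) :
    IsNet (.tree _ (.alpha A a t) :: F) ↔ IsNet (.tree _ t :: F) := by
  obtain ⟨f, hf, h⟩ := exists_localIso_alpha F A a t
  rw [isNet_iff_isNetOn (f '' Set.univ), isNetOn_image_iff hf (fun y hy => absurd trivial hy)]
  · rfl
  · intro b _ y hy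
    rw [(h y hy).2]
    exact id
  · exact indices_eq_of_disjuncts (disjuncts_alpha F A a t)
  · intro y hy
    rw [(h y hy).2]
    exact ⟨(h y hy).1, trivial⟩

theorem exists_localIso_single (F : Forest L V I) (A : Prenex L V 1) (M : L.Term V)
    (t : Tree L V I (A.inst M)) :
    ∃ f : Node (.tree _ t :: F) →
        Node (.tree _ (.sum A 0 (fun _ => M) (fun _ => t)) :: F),
      LocalIso (label (.tree _ t :: F)) (parent (.tree _ t :: F))
        (label (.tree _ (.sum A 0 (fun _ => M) (fun _ => t)) :: F))
        (parent (.tree _ (.sum A 0 (fun _ => M) (fun _ => t)) :: F)) f Set.univ ∧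
      ∃ r e, label (.tree _ (.sum A 0 (fun _ => M) (fun _ => t)) :: F) r = .plus ∧
        parent (.tree _ (.sum A 0 (fun _ => M) (fun _ => t)) :: F) r = none ∧
        label (.tree _ (.sum A 0 (fun _ => M) (fun _ => t)) :: F) e = .eps M ∧
        parent (.tree _ (.sum A 0 (fun _ => M) (fun _ => t)) :: F) e = some r ∧
      ∀ y, y ∉ f '' Set.univ ↔ y = r ∨ y = e := by
  obtain ⟨f, hf, h⟩ := exists_localIso_cons (LocalIso.summand A 0 (fun _ => M) (fun _ => t) 0) F
  refine ⟨f, hf, .inl (none : Option (Σ _ : Fin 1, Option t.Node)),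
    .inl (some ⟨0, none⟩ : Option (Σ _ : Fin 1, Option t.Node)), rfl, rfl, rfl, rfl, fun y =>
    ⟨fun hy => ?_, ?_⟩⟩
  · obtain ⟨_ | ⟨k, _ | z⟩, hz, rfl⟩ := (h y).1 hy
    · exact .inl rfl
    · obtain rfl : k = 0 := Subsingleton.elim (α := Fin 1) _ _
      exact .inr rfl
    · obtain rfl : k = 0 := Subsingleton.elim (α := Fin 1) _ _
      exact absurd rfl (hz z)
  · rintro (rfl | rfl)
    · exact (h _).2 ⟨_, fun x hx => (by cases hx), rfl⟩
    · exact (h _).2 ⟨_, fun x hx => (by cases hx), rfl⟩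

theorem disjuncts_single (F : Forest L V I) (A : Prenex L V 1) (M : L.Term V)
    (t : Tree L V I (A.inst M)) :
    disjuncts (.tree _ (.sum A 0 (fun _ => M) (fun _ => t)) :: F) = disjuncts (.tree _ t :: F) := by
  refine funext fun i => Set.ext fun P => ?_
  simp [mem_disjuncts, labels_cons, Root.labels_tree, Tree.labels_sum, Set.iUnion_const]

/-- The `∃`-rule adds an `ε`-node below the root of a tree, and a switched root below that. The
`ε`-node does not affect correctness if it is not the source of a jump. -/
theorem isNet_single_iff (F : Forest L V I) (A : Prenex L V 1) (M : L.Term V)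
    (t : Tree L V I (A.inst M)) (hM : Disjoint (bound (.tree _ t :: F)) (termFree M)) :
    IsNet (.tree _ (.sum A 0 (fun _ => M) (fun _ => t)) :: F) ↔ IsNet (.tree _ t :: F) := by
  obtain ⟨f, hf, r, e, hr, hr', he, he', h⟩ := exists_localIso_single F A M t
  have hre : r ≠ e := fun h => by rw [← h, hr] at he; cases he
  have hfr : ∀ x, f x ≠ r := fun x hx => (h r).2 (.inl rfl) ⟨x, trivial, hx⟩
  have hsub : f '' Set.univ ⊆ {r}ᶜ := by
    rintro _ ⟨x, -, rfl⟩
    exact hfr x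
  have hmem : ∀ y ∈ ({r}ᶜ : Set _), y ∉ f '' Set.univ → y = e := fun y hy hy' =>
    ((h y).1 hy').resolve_left hy
  -- the new root `r` is removed first, then the link `e`
  rw [isNet_iff_isNetOn {r}ᶜ, isNetOn_iff_of_subset hsub, isNetOn_image_iff hf
    (fun y hy => absurd trivial hy)]
  · rfl
  · intro a ha y hy hay
    rcases (h y).1 hy with rfl | rfl
    · rw [hr] at hay; exact hay
    · rw [he] at hay; exact Set.disjoint_left.1 hM ha hay
  · exact indices_eq_of_disjuncts (disjuncts_single F A M t)
  · intro y hy hy'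
    obtain rfl := hmem y hy hy'
    exact isLink_of_eps (isLabelled _) he
  · rintro _ ⟨z, -, rfl⟩ y hy hE
    by_contra hy'
    obtain rfl := hmem y hy hy'
    rcases hE with hE | ⟨ha, hz⟩
    · rw [he'] at hE
      exact hfr z (Option.some_injective _ hE).symm
    · rw [he] at ha
      rw [hf.label z trivial] at hz
      exact Set.disjoint_left.1 hM ⟨z, hz⟩ ha
  · intro z hz hz' y hE
    obtain rfl := hmem z hz hz'
    by_contra hy
    rcases hE with hE | ⟨ha, hz⟩
    · rcases (h y).1 hy with rfl | rfl
      · rw [hr'] at hE; cases hE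
      · rw [he'] at hE
        exact hre (Option.some_injective _ hE)
    · rw [he] at hz; cases hz
  · intro y hy
    obtain rfl : y = r := by_contra hy
    rw [hr]
    exact ⟨hr', trivial⟩

/-- The roots that are merged by the contraction rules. -/
def IsContrRoot (F : Forest L V I) (y : Node F) : Prop :=
  parent F y = none ∧ (label F y = .plus ∨ ∃ P S, label F y = .leaf P S)

theorem IsContrRoot.isSwitched {F : Forest L V I} {y : Node F} (h : IsContrRoot F y) :
    (label F y).IsSwitched := by
  rcases h.2 with h | ⟨P, S, h⟩ <;> rw [h] <;> trivial

theorem IsContrRoot.jumps_eq {F : Forest L V I} {y : Node F} (h : IsContrRoot F y) :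
    (label F y).jumps = ∅ := by
  rcases h.2 with h | ⟨P, S, h⟩ <;> rw [h] <;> rfl

theorem IsContrRoot.label_ne {F : Forest L V I} {y : Node F} (h : IsContrRoot F y) (a : V) :
    label F y ≠ .alpha a := by
  rcases h.2 with h | ⟨P, S, h⟩ <;> rw [h] <;> exact fun h => by cases h

/-- The contraction rules change only switched roots that are neither sources nor targets of
jumps. -/
theorem isNet_contr_iff {F G : Forest L V I} {f : Node F → Node G} {D : Set (Node F)}
    (h : LocalIso (label F) (parent F) (label G) (parent G) f D)
    (hD : ∀ y ∉ D, IsContrRoot F y) (hD' : ∀ y ∉ f '' D, IsContrRoot G y)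
    (hdis : disjuncts G = disjuncts F) : IsNet G ↔ IsNet F := by
  rw [isNet_iff_isNetOn D fun y hy => ⟨(hD y hy).1, (hD y hy).isSwitched⟩,
    isNet_iff_isNetOn (f '' D) fun y hy => ⟨(hD' y hy).1, (hD' y hy).isSwitched⟩,
    isNetOn_image_iff h (fun y hy => (hD y hy).jumps_eq)
      (fun a _ y hy => by rw [(hD' y hy).jumps_eq]; exact id) (indices_eq_of_disjuncts hdis)]

/-- Two roots are merged into one, the nodes outside `D₁` and `D₂` being replaced by the nodes
outside the images of these sets. -/
theorem exists_localIso_merge {r₁ r₂ r : Root L V I} {g₁ : r₁.Node → r.Node}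
    {g₂ : r₂.Node → r.Node} {D₁ : Set r₁.Node} {D₂ : Set r₂.Node}
    (h₁ : LocalIso r₁.label r₁.parent r.label r.parent g₁ D₁)
    (h₂ : LocalIso r₂.label r₂.parent r.label r.parent g₂ D₂)
    (hdis : ∀ y ∈ D₁, ∀ z ∈ D₂, g₁ y ≠ g₂ z) (F : Forest L V I) :
    ∃ (f : Node (r₁ :: r₂ :: F) → Node (r :: F)) (D : Set (Node (r₁ :: r₂ :: F))),
      LocalIso (label (r₁ :: r₂ :: F)) (parent (r₁ :: r₂ :: F)) (label (r :: F)) (parent (r :: F))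
        f D ∧
      (∀ y ∉ D, (∃ z ∉ D₁, y = Sum.inl z) ∨ ∃ z ∉ D₂, y = Sum.inr (Sum.inl z)) ∧
      ∀ y ∉ f '' D, ∃ z, z ∉ g₁ '' D₁ ∧ z ∉ g₂ '' D₂ ∧ y = Sum.inl z := by
  have hi := LocalIso.inl r F
  have h := (hi.comp h₁ fun _ _ => trivial).cons
    ((hi.comp h₂ fun _ _ => trivial).cons (LocalIso.inr r F) fun y _ z _ h => by cases h) ?_
  · refine ⟨_, _, h, ?_, ?_⟩
    · rintro (y | y | y) hy
      · exact .inl ⟨y, fun h => hy (.inl ⟨y, h, rfl⟩), rfl⟩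
      · exact .inr ⟨y, fun h => hy (.inr ⟨_, .inl ⟨y, h, rfl⟩, rfl⟩), rfl⟩
      · exact absurd (.inr ⟨_, .inr ⟨y, trivial, rfl⟩, rfl⟩) hy
    · rintro (y | y) hy
      · refine ⟨y, ?_, ?_, rfl⟩
        · rintro ⟨z, hz, rfl⟩
          exact hy ⟨.inl z, .inl ⟨z, hz, rfl⟩, rfl⟩
        · rintro ⟨z, hz, rfl⟩
          exact hy ⟨.inr (.inl z), .inr ⟨_, .inl ⟨z, hz, rfl⟩, rfl⟩, rfl⟩
      · exact absurd ⟨.inr (.inr y), .inr ⟨_, .inr ⟨y, trivial, rfl⟩, rfl⟩, rfl⟩ hy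
  · rintro y hy _ (⟨z, hz, rfl⟩ | ⟨z, hz, rfl⟩) h
    · exact hdis y hy z hz (Sum.inl_injective h)
    · cases h

theorem exists_localIso_contrEx (F : Forest L V I) (A : Prenex L V 1) (m n k : ℕ)
    (e : Fin (m + 1) ⊕ Fin (n + 1) ≃ Fin (k + 1))
    (M : Fin (k + 1) → L.Term V) (t : ∀ j, Tree L V I (A.inst (M j))) :
    ∃ (f : Node (.tree _ (.sum A m (fun j => M (e (.inl j))) (fun j => t (e (.inl j)))) ::
        .tree _ (.sum A n (fun j => M (e (.inr j))) (fun j => t (e (.inr j)))) :: F) →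
        Node (.tree _ (.sum A k M t) :: F)) (D : _),
      LocalIso (label _) (parent _) (label _) (parent _) f D ∧
      (∀ y ∉ D, IsContrRoot _ y) ∧ ∀ y ∉ f '' D, IsContrRoot _ y := by
  have h₁ := LocalIso.subsum A m k (fun j => e (.inl j))
    (fun i j h => Sum.inl_injective (e.injective h)) M t
  have h₂ := LocalIso.subsum A n k (fun j => e (.inr j))
    (fun i j h => Sum.inr_injective (e.injective h)) M t
  obtain ⟨f, D, h, hD, hD'⟩ := exists_localIso_merge h₁ h₂ (by
    rintro _ ⟨⟨i, y⟩, rfl⟩ _ ⟨⟨j, z⟩, rfl⟩ h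
    have h : e (.inl i) = e (.inr j) := congrArg Sigma.fst (Option.some_injective _ h)
    cases e.injective h) F
  refine ⟨f, D, h, ?_, ?_⟩
  · rintro y hy
    rcases hD y hy with ⟨_ | z, hz, rfl⟩ | ⟨_ | z, hz, rfl⟩
    · exact ⟨rfl, .inl rfl⟩
    · exact absurd ⟨z, rfl⟩ hz
    · exact ⟨rfl, .inl rfl⟩
    · exact absurd ⟨z, rfl⟩ hz
  · rintro y hy
    obtain ⟨_ | ⟨j, z⟩, hz₁, hz₂, rfl⟩ := hD' y hy
    · exact ⟨rfl, .inl rfl⟩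
    · obtain ⟨j | j, rfl⟩ := e.surjective j
      · exact absurd ⟨some ⟨j, z⟩, ⟨_, rfl⟩, rfl⟩ hz₁
      · exact absurd ⟨some ⟨j, z⟩, ⟨_, rfl⟩, rfl⟩ hz₂

theorem labels_contrEx (F : Forest L V I) (A : Prenex L V 1) (m n k : ℕ)
    (e : Fin (m + 1) ⊕ Fin (n + 1) ≃ Fin (k + 1))
    (M : Fin (k + 1) → L.Term V) (t : ∀ j, Tree L V I (A.inst (M j))) :
    labels (.tree _ (.sum A k M t) :: F) =
      labels (.tree _ (.sum A m (fun j => M (e (.inl j))) (fun j => t (e (.inl j)))) ::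
        .tree _ (.sum A n (fun j => M (e (.inr j))) (fun j => t (e (.inr j)))) :: F) := by
  simp only [labels_cons, Root.labels_tree, Tree.labels_sum]
  rw [← e.surjective.iUnion_comp, Set.iUnion_sum, ← Set.union_assoc]
  congr 1
  rw [Set.insert_union, Set.union_insert, Set.insert_idem]

theorem exists_localIso_contrP [DecidableEq I] (F : Forest L V I) (P : QFF L (V ⊕ Fin 0))
    (S S₁ S₂ : Finset I) (h : S.Nonempty) (h₁ : S₁.Nonempty) (h₂ : S₂.Nonempty) :
    ∃ (f : Node (.tree _ (.leaf P S₁ h₁) :: .tree _ (.leaf P S₂ h₂) :: F) →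
        Node (.tree _ (.leaf P S h) :: F)) (D : _),
      LocalIso (label _) (parent _) (label _) (parent _) f D ∧
      (∀ y ∉ D, IsContrRoot _ y) ∧ ∀ y ∉ f '' D, IsContrRoot _ y := by
  have hf : ∀ S' h', LocalIso (Root.tree (I := I) _ (.leaf P S' h')).label
      (Root.tree (I := I) _ (.leaf P S' h')).parent (Root.tree _ (.leaf P S h)).label
      (Root.tree _ (.leaf P S h)).parent (fun _ => ()) ∅ := fun S' h' =>
    ⟨Set.injOn_empty _, fun _ h => h.elim, fun _ h => h.elim, fun _ h => h.elim⟩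
  obtain ⟨f, D, h, hD, hD'⟩ := exists_localIso_merge (hf S₁ h₁) (hf S₂ h₂) (fun _ h => h.elim) F
  refine ⟨f, D, h, ?_, ?_⟩
  · rintro y hy
    rcases hD y hy with ⟨z, hz, rfl⟩ | ⟨z, hz, rfl⟩
    · exact ⟨rfl, .inr ⟨P, _, rfl⟩⟩
    · exact ⟨rfl, .inr ⟨P, _, rfl⟩⟩
  · rintro y hy
    obtain ⟨z, -, -, rfl⟩ := hD' y hy
    exact ⟨rfl, .inr ⟨P, _, rfl⟩⟩

theorem disjuncts_contrP [DecidableEq I] (F : Forest L V I) (P : QFF L (V ⊕ Fin 0))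
    (S₁ S₂ : Finset I) (h : (S₁ ∪ S₂).Nonempty) (h₁ : S₁.Nonempty) (h₂ : S₂.Nonempty) :
    disjuncts (.tree _ (.leaf P (S₁ ∪ S₂) h) :: F) =
      disjuncts (.tree _ (.leaf P S₁ h₁) :: .tree _ (.leaf P S₂ h₂) :: F) := by
  refine funext fun i => Set.ext fun Q => ?_
  simp only [mem_disjuncts, labels_cons, Root.labels_tree, Tree.labels_leaf, Set.mem_union,
    Set.mem_singleton_iff, Label.leaf.injEq]
  constructor
  · rintro ⟨S, ⟨rfl, rfl⟩ | hS, hi⟩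
    · rcases Finset.mem_union.1 hi with hi | hi
      · exact ⟨S₁, .inl ⟨rfl, rfl⟩, hi⟩
      · exact ⟨S₂, .inr (.inl ⟨rfl, rfl⟩), hi⟩
    · exact ⟨S, .inr (.inr hS), hi⟩
  · rintro ⟨S, ⟨rfl, rfl⟩ | ⟨rfl, rfl⟩ | hS, hi⟩
    · exact ⟨_, .inl ⟨rfl, rfl⟩, Finset.mem_union_left _ hi⟩
    · exact ⟨_, .inl ⟨rfl, rfl⟩, Finset.mem_union_right _ hi⟩
    · exact ⟨S, .inr hS, hi⟩

/-- The cut node of a forest that starts with a cut. -/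
def cutNode (A : Prenex L V 0) (t : Tree L V I A) (s : Tree L V I A.dual) (F : Forest L V I) :
    Node (.cut A t s :: F) :=
  Sum.inl (none : Option (t.Node ⊕ s.Node))

/-- The root of the first tree of the cut. -/
def cutLeft (A : Prenex L V 0) (t : Tree L V I A) (s : Tree L V I A.dual) (F : Forest L V I) :
    Node (.cut A t s :: F) :=
  Sum.inl (some (.inl t.root) : Option (t.Node ⊕ s.Node))

/-- The root of the second tree of the cut. -/
def cutRight (A : Prenex L V 0) (t : Tree L V I A) (s : Tree L V I A.dual) (F : Forest L V I) :
    Node (.cut A t s :: F) :=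
  Sum.inl (some (.inr s.root) : Option (t.Node ⊕ s.Node))

/-- The sources of a cut node are the roots of its two trees. -/
theorem edge_cut_iff (F : Forest L V I) (A : Prenex L V 0) (t : Tree L V I A)
    (s : Tree L V I A.dual) (x : Node (.cut A t s :: F) ⊕ I) :
    Edge (label (.cut A t s :: F)) (parent (.cut A t s :: F)) x (.inl (cutNode A t s F)) ↔
      x = .inl (cutLeft A t s F) ∨ x = .inl (cutRight A t s F) := by
  have hs : ¬ (label (.cut A t s :: F) (cutNode A t s F)).IsSwitched := id
  rw [edge_of_not_isSwitched hs]
  constructor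
  · rintro ⟨(_ | y | y) | y, h, rfl⟩
    · cases h
    · obtain ⟨z, h, he⟩ := Option.map_eq_some_iff.1 h
      cases he
      have := Option.map_eq_none_iff.1 (Option.some_injective _ h)
      rw [(t.parent_eq_none_iff y).1 this]
      exact .inl rfl
    · obtain ⟨z, h, he⟩ := Option.map_eq_some_iff.1 h
      cases he
      have := Option.map_eq_none_iff.1 (Option.some_injective _ h)
      rw [(s.parent_eq_none_iff y).1 this]
      exact .inr rfl
    · obtain ⟨z, h, he⟩ := Option.map_eq_some_iff.1 h
      cases he
  · rintro (rfl | rfl)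
    · refine ⟨_, ?_, rfl⟩
      change Option.map _ (some (Option.map _ (t.parent t.root))) = _
      rw [(t.parent_eq_none_iff _).2 rfl]
      rfl
    · refine ⟨_, ?_, rfl⟩
      change Option.map _ (some (Option.map _ (s.parent s.root))) = _
      rw [(s.parent_eq_none_iff _).2 rfl]
      rfl

theorem disjuncts_cut (F G : Forest L V I) (A : Prenex L V 0) (t : Tree L V I A)
    (s : Tree L V I A.dual) (i : I) : disjuncts (.cut A t s :: (F ++ G)) i =
      disjuncts (.tree _ t :: F) i ∪ disjuncts (.tree _ s :: G) i := by
  ext P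
  simp only [mem_disjuncts, labels_cons, labels_append, Root.labels_tree, Root.labels_cut,
    Set.mem_union, Set.mem_insert_iff, reduceCtorEq, false_or, ← exists_or, ← or_and_right]
  refine exists_congr fun S => and_congr_left fun _ => ?_
  tauto

theorem indices_cut (F G : Forest L V I) (A : Prenex L V 0) (t : Tree L V I A)
    (s : Tree L V I A.dual) : indices (.cut A t s :: (F ++ G)) =
      indices (.tree _ t :: F) ∪ indices (.tree _ s :: G) := by
  ext i
  simp only [mem_indices, Set.mem_union, disjuncts_cut, exists_or]

/-- The premises of a cut rule are embedded in the conclusion. -/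
theorem exists_localIso_cut (F G : Forest L V I) (A : Prenex L V 0) (t : Tree L V I A)
    (s : Tree L V I A.dual) :
    ∃ (f₁ : Node (.tree _ t :: F) → Node (.cut A t s :: (F ++ G)))
      (f₂ : Node (.tree _ s :: G) → Node (.cut A t s :: (F ++ G))),
      LocalIso (label _) (parent _) (label _) (parent _) f₁ Set.univ ∧
      LocalIso (label _) (parent _) (label _) (parent _) f₂ Set.univ ∧
      cutLeft A t s (F ++ G) ∈ f₁ '' Set.univ ∧ cutRight A t s (F ++ G) ∈ f₂ '' Set.univ ∧
      (∀ y z, f₁ y ≠ f₂ z) ∧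
      ∀ y, y = cutNode A t s (F ++ G) ↔ y ∉ f₁ '' Set.univ ∧ y ∉ f₂ '' Set.univ := by
  have hl := LocalIso.inl (.cut A t s) (F ++ G)
  have hr := LocalIso.inr (.cut A t s) (F ++ G)
  have hf₁ := (hl.comp (LocalIso.cutLeft A t s) fun _ _ => trivial).cons_univ
    (hr.comp (localIso_appendLeft F G) fun _ _ => trivial) fun y z h => by cases h
  have hf₂ := (hl.comp (LocalIso.cutRight A t s) fun _ _ => trivial).cons_univ
    (hr.comp (localIso_appendRight F G) fun _ _ => trivial) fun y z h => by cases h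
  refine ⟨_, _, hf₁, hf₂, ⟨.inl t.root, trivial, rfl⟩, ⟨.inl s.root, trivial, rfl⟩, ?_, fun y =>
    ⟨?_, fun h => ?_⟩⟩
  · rintro (y | y) (z | z) h
    · cases h
    · cases h
    · cases h
    · exact appendLeft_ne_appendRight F G y z (Sum.inr_injective h)
  · rintro rfl
    constructor
    · rintro ⟨y | y, -, h⟩ <;> cases h
    · rintro ⟨y | y, -, h⟩ <;> cases h
  · rcases y with (_ | y | y) | y
    · rfl
    · exact absurd ⟨.inl y, trivial, rfl⟩ h.1
    · exact absurd ⟨.inl y, trivial, rfl⟩ h.2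
    · rcases append_cases F G y with ⟨z, rfl⟩ | ⟨z, rfl⟩
      · exact absurd ⟨.inr z, trivial, rfl⟩ h.1
      · exact absurd ⟨.inr z, trivial, rfl⟩ h.2

/-- The cut rule joins two nets if there are no jumps and no indices that relate them. -/
theorem isNet_cut (F G : Forest L V I) (A : Prenex L V 0) (t : Tree L V I A)
    (s : Tree L V I A.dual) (hF : IsNet (.tree _ t :: F)) (hG : IsNet (.tree _ s :: G))
    (h₁ : Disjoint (bound (.tree _ t :: F)) (A.free ∪ jumps (.tree _ s :: G)))
    (h₂ : Disjoint (bound (.tree _ s :: G)) (A.free ∪ jumps (.tree _ t :: F)))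
    (hI : Disjoint (indices (.tree _ t :: F)) (indices (.tree _ s :: G))) :
    IsNet (.cut A t s :: (F ++ G)) := by
  obtain ⟨f₁, f₂, hf₁, hf₂, hu, hw, hne, hcut⟩ := exists_localIso_cut F G A t s
  have hcover : ∀ y, y = cutNode A t s (F ++ G) ∨ y ∈ f₁ '' Set.univ ∨ y ∈ f₂ '' Set.univ := by
    intro y
    by_contra h
    push Not at h
    exact h.1 ((hcut y).2 h.2)
  have hc := (hcut (cutNode A t s (F ++ G))).1 rfl
  -- jumps into a premise come from that premise
  have hjump : ∀ a, a ∉ A.free ∪ jumps (.tree _ s :: G) → ∀ y,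
      a ∈ (label (.cut A t s :: (F ++ G)) y).jumps → y ∈ f₁ '' Set.univ := by
    intro a ha y hy
    rcases hcover y with rfl | h | ⟨z, -, rfl⟩
    · exact absurd (.inl hy) ha
    · exact h
    · rw [hf₂.label z trivial] at hy
      exact absurd (.inr ⟨_, ⟨z, rfl⟩, hy⟩) ha
  have hjump' : ∀ a, a ∉ A.free ∪ jumps (.tree _ t :: F) → ∀ y,
      a ∈ (label (.cut A t s :: (F ++ G)) y).jumps → y ∈ f₂ '' Set.univ := by
    intro a ha y hy
    rcases hcover y with rfl | ⟨z, -, rfl⟩ | h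
    · exact absurd (.inl hy) ha
    · rw [hf₁.label z trivial] at hy
      exact absurd (.inr ⟨_, ⟨z, rfl⟩, hy⟩) ha
    · exact h
  have hB₁ := (hf₁.isSubnet_iff (fun _ _ _ _ _ _ => trivial)
    (fun z _ a hz y hy => hjump a (Set.disjoint_left.1 h₁ ⟨z, hz⟩) y hy)
    (J := indices (.tree _ t :: F)) fun y _ P S hl i hi => ⟨y, P, S, hl, hi⟩).2 hF
  have hB₂ := (hf₂.isSubnet_iff (fun _ _ _ _ _ _ => trivial)
    (fun z _ a hz y hy => hjump' a (Set.disjoint_left.1 h₂ ⟨z, hz⟩) y hy)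
    (J := indices (.tree _ s :: G)) fun y _ P S hl i hi => ⟨y, P, S, hl, hi⟩).2 hG
  have := IsSubnet.join _ _ _ _ _ ?_ (fun h => hc.1 (inl_mem_image_union.1 h))
    (fun h => hc.2 (inl_mem_image_union.1 h)) (inl_mem_image_union.2 hu)
    (inl_mem_image_union.2 hw) (edge_cut_iff (F ++ G) A t s) id hB₁ hB₂
  · refine cast (congrArg (IsSubnet _ _) ?_) this
    ext (y | i)
    · refine iff_of_true ?_ (.inl ⟨y, trivial, rfl⟩)
      rcases hcover y with rfl | h | h
      · exact .inl rfl
      · exact .inr (.inl (inl_mem_image_union.2 h))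
      · exact .inr (.inr (inl_mem_image_union.2 h))
    · rw [support, inr_mem_image_union, indices_cut, Set.mem_insert_iff, Set.mem_union,
        inr_mem_image_union, inr_mem_image_union]
      simp
  · rw [Set.disjoint_left]
    rintro (y | i) hy hy'
    · rw [inl_mem_image_union] at hy hy'
      obtain ⟨z, -, rfl⟩ := hy
      obtain ⟨z', -, h⟩ := hy'
      exact hne _ _ h.symm
    · rw [inr_mem_image_union] at hy hy'
      exact Set.disjoint_left.1 hI hy hy'

theorem tautForest_node (i : I) (Ps : List (QFF L (V ⊕ Fin 0))) (y : Node (tautForest i Ps)) :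
    parent _ y = none ∧ ∃ P ∈ Ps, label _ y = .leaf P {i} := by
  induction Ps with
  | nil => exact y.elim
  | cons P Ps ih =>
    rcases y with y | y
    · exact ⟨rfl, P, List.mem_cons_self, rfl⟩
    · obtain ⟨h, Q, hQ, hl⟩ := ih y
      refine ⟨?_, Q, List.mem_cons_of_mem _ hQ, hl⟩
      exact congrArg (Option.map Sum.inr) h

theorem labels_tautForest (i : I) (Ps : List (QFF L (V ⊕ Fin 0))) :
    labels (tautForest i Ps) = {l | ∃ P ∈ Ps, l = .leaf P {i}} := by
  induction Ps with
  | nil => rw [tautForest, List.map_nil, labels_nil]; ext; simp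
  | cons P Ps ih =>
    change labels (_ :: tautForest i Ps) = _
    rw [labels_cons, ih, Root.labels_tree, Tree.labels_leaf]
    ext l
    simp

theorem indices_tautForest (i : I) {Ps : List (QFF L (V ⊕ Fin 0))} (hne : Ps ≠ []) :
    indices (tautForest i Ps) = {i} := by
  ext j
  simp only [mem_indices, mem_disjuncts, labels_tautForest]
  constructor
  · rintro ⟨P, S, ⟨Q, hQ, h⟩, hj⟩
    cases h
    exact Finset.mem_singleton.1 hj
  · rintro rfl
    obtain ⟨P, hP⟩ := List.exists_mem_of_ne_nil _ hne
    exact ⟨P, _, ⟨P, hP, rfl⟩, Finset.mem_singleton_self _⟩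

theorem disjuncts_tautForest (i : I) (Ps : List (QFF L (V ⊕ Fin 0))) :
    disjuncts (tautForest i Ps) i = {P | P ∈ Ps} := by
  ext P
  simp only [mem_disjuncts, labels_tautForest]
  constructor
  · rintro ⟨S, ⟨Q, hQ, h⟩, hj⟩
    cases h
    exact hQ
  · intro hP
    exact ⟨_, ⟨P, hP, rfl⟩, Finset.mem_singleton_self _⟩

/-- The leaves of a tautology are switched roots, so that its index is all that matters. -/
theorem isNet_tautForest (i : I) {Ps : List (QFF L (V ⊕ Fin 0))} (hne : Ps ≠ []) :
    IsNet (tautForest i Ps) := by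
  rw [isNet_iff_isNetOn ∅]
  · unfold IsNetOn part
    rw [Set.image_empty, Set.empty_union, indices_tautForest i hne, Set.image_singleton]
    exact .base _ (isBase_inr i)
  · intro y _
    obtain ⟨h, P, -, hl⟩ := tautForest_node i Ps y
    rw [hl]
    exact ⟨h, trivial⟩

end Forest

/-! ### Free variables -/

theorem QFF.free_dual {n : ℕ} (P : QFF L (V ⊕ Fin n)) : P.dual.free = P.free := by
  induction P with
  | lit pos p ts => rfl
  | and P Q ihP ihQ => exact congrArg₂ _ ihP ihQ
  | or P Q ihP ihQ => exact congrArg₂ _ ihP ihQ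

theorem Prenex.free_dual {n : ℕ} (A : Prenex L V n) : A.dual.free = A.free := by
  induction A with
  | qf P => exact P.free_dual
  | all A ih => exact ih
  | ex A ih => exact ih

open Classical in
theorem varFinset_eq_of_relabel_inl {β : Type*} (M : L.Term V) :
    (M.relabel Sum.inl : L.Term (V ⊕ β)).varFinsetLeft = M.varFinset := by
  induction M with
  | var a => rfl
  | func f ts ih =>
    simp only [FirstOrder.Language.Term.relabel, FirstOrder.Language.Term.varFinsetLeft,
      FirstOrder.Language.Term.varFinset, ih]

open Classical in
theorem mem_varFinsetLeft_subst {n : ℕ} (M : L.Term V) (t : L.Term (V ⊕ Fin (n + 1))) {a : V}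
    (ha : a ∈ (t.subst (Prenex.instVar M n)).varFinsetLeft) :
    a ∈ t.varFinsetLeft ∨ a ∈ termFree M := by
  induction t with
  | var x =>
    rcases x with b | k
    · exact .inl ha
    · refine .inr ?_
      induction k using Fin.cases with
      | zero =>
        change a ∈ (M.relabel Sum.inl : L.Term (V ⊕ Fin n)).varFinsetLeft at ha
        rw [varFinset_eq_of_relabel_inl] at ha
        exact ha
      | succ k => exact absurd ha (Finset.notMem_empty a)
  | func f ts ih =>
    simp only [FirstOrder.Language.Term.subst, FirstOrder.Language.Term.varFinsetLeft,
      Finset.mem_biUnion, Finset.mem_univ, true_and] at ha ⊢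
    obtain ⟨i, hi⟩ := ha
    exact (ih i hi).imp_left fun h => ⟨i, h⟩

theorem QFF.free_subst {n : ℕ} (M : L.Term V) (P : QFF L (V ⊕ Fin (n + 1))) :
    (P.subst (Prenex.instVar M n)).free ⊆ P.free ∪ termFree M := by
  induction P with
  | lit pos p ts =>
    intro a ha
    obtain ⟨i, hi⟩ := Set.mem_iUnion.1 ha
    exact (mem_varFinsetLeft_subst M (ts i) hi).imp_left fun h => Set.mem_iUnion.2 ⟨i, h⟩
  | and P Q ihP ihQ =>
    rintro a (ha | ha)
    · exact (ihP ha).imp_left .inl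
    · exact (ihQ ha).imp_left .inr
  | or P Q ihP ihQ =>
    rintro a (ha | ha)
    · exact (ihP ha).imp_left .inl
    · exact (ihQ ha).imp_left .inr

theorem Prenex.free_inst (M : L.Term V) :
    {n : ℕ} → (A : Prenex L V (n + 1)) → (A.inst M).free ⊆ A.free ∪ termFree M
  | _, qf P => by simpa only [inst, free] using P.free_subst M
  | _, all A => by simpa only [inst, free] using free_inst M A
  | _, ex A => by simpa only [inst, free] using free_inst M A

theorem termFree_var (a : V) : termFree (.var a : L.Term V) = {a} := by
  classical
  simp [termFree, FirstOrder.Language.Term.varFinset]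

namespace Forest

theorem mem_typeFree_cons {r : Root L V I} {F : Forest L V I} {a : V} :
    a ∈ typeFree (r :: F) ↔ (¬ r.IsCut ∧ a ∈ r.free) ∨ a ∈ typeFree F := by
  constructor
  · rintro ⟨q, hq, h⟩
    rcases List.mem_cons.1 hq with rfl | hq
    · exact .inl h
    · exact .inr ⟨q, hq, h⟩
  · rintro (h | ⟨q, hq, h⟩)
    · exact ⟨r, List.mem_cons_self, h⟩
    · exact ⟨q, List.mem_cons_of_mem _ hq, h⟩

theorem mem_typeFree_tree {A : Prenex L V 0} {t : Tree L V I A} {F : Forest L V I} {a : V} :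
    a ∈ typeFree (.tree A t :: F) ↔ a ∈ A.free ∨ a ∈ typeFree F := by
  rw [mem_typeFree_cons]
  exact or_congr_left ⟨fun h => h.2, fun h => ⟨id, h⟩⟩

theorem mem_typeFree_cut {A : Prenex L V 0} {t : Tree L V I A} {s : Tree L V I A.dual}
    {F : Forest L V I} {a : V} : a ∈ typeFree (.cut A t s :: F) ↔ a ∈ typeFree F := by
  rw [mem_typeFree_cons]
  exact or_iff_right fun h => h.1 trivial

theorem mem_typeFree_append {F G : Forest L V I} {a : V} :
    a ∈ typeFree (F ++ G) ↔ a ∈ typeFree F ∨ a ∈ typeFree G := by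
  constructor
  · rintro ⟨r, hr, h⟩
    exact (List.mem_append.1 hr).imp (fun hr => ⟨r, hr, h⟩) fun hr => ⟨r, hr, h⟩
  · rintro (⟨r, hr, h⟩ | ⟨r, hr, h⟩)
    · exact ⟨r, List.mem_append_left _ hr, h⟩
    · exact ⟨r, List.mem_append_right _ hr, h⟩

theorem typeFree_perm {F G : Forest L V I} (h : F.Perm G) : typeFree F = typeFree G := by
  ext a
  exact ⟨fun ⟨r, hr, h'⟩ => ⟨r, h.mem_iff.1 hr, h'⟩, fun ⟨r, hr, h'⟩ => ⟨r, h.mem_iff.2 hr, h'⟩⟩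

/-- The variables that occur free in the type of a root, in a cut formula or in a witnessing term. -/
def occ (F : Forest L V I) : Set V := jumps F ∪ typeFree F

theorem mem_occ {F : Forest L V I} {a : V} : a ∈ occ F ↔ a ∈ jumps F ∨ a ∈ typeFree F := Iff.rfl

theorem disjuncts_eq_of_labels {F G : Forest L V I} (h : labels F = labels G) :
    disjuncts F = disjuncts G := by
  refine funext fun i => Set.ext fun P => ?_
  rw [mem_disjuncts, mem_disjuncts, h]

theorem jumps_eq_of_labels {F G : Forest L V I} (h : labels F = labels G) :
    jumps F = jumps G := by
  unfold jumps
  rw [h]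

theorem jumps_append (F G : Forest L V I) : jumps (F ++ G) = jumps F ∪ jumps G := by
  ext a
  simp only [jumps, labels_append, Set.mem_union, or_and_right, exists_or]
  rfl

end Forest

/-- The eigenvariables that would be targets of jumps from the tree. -/
def Tree.jumps {A : Prenex L V 0} (t : Tree L V I A) : Set V := {a | ∃ l ∈ t.labels, a ∈ l.jumps}

theorem Tree.jumps_leaf (P : QFF L (V ⊕ Fin 0)) (S : Finset I) (hS : S.Nonempty) :
    (leaf P S hS).jumps = ∅ := by
  simp [jumps, labels_leaf, Label.jumps]

theorem Tree.jumps_alpha (A : Prenex L V 1) (a : V) (t : Tree L V I (A.inst (.var a))) :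
    (alpha A a t).jumps = t.jumps := by
  simp [jumps, labels_alpha, Label.jumps]

theorem Tree.jumps_single (A : Prenex L V 1) (M : L.Term V) (t : Tree L V I (A.inst M)) :
    (sum A 0 (fun _ => M) (fun _ => t)).jumps = termFree M ∪ t.jumps := by
  ext a
  simp [jumps, labels_sum, Label.jumps, Set.iUnion_const]

theorem Forest.jumps_tree {A : Prenex L V 0} (t : Tree L V I A) (F : Forest L V I) :
    jumps (.tree A t :: F) = t.jumps ∪ jumps F := by
  ext a
  simp only [jumps, Tree.jumps, labels_cons, Root.labels_tree, Set.mem_union, or_and_right,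
    exists_or]
  rfl

theorem Forest.jumps_cut (A : Prenex L V 0) (t : Tree L V I A) (s : Tree L V I A.dual)
    (F : Forest L V I) : jumps (.cut A t s :: F) = A.free ∪ t.jumps ∪ s.jumps ∪ jumps F := by
  ext a
  simp [jumps, Tree.jumps, labels_cons, Root.labels_cut, or_and_right, exists_or, Label.jumps,
    or_assoc]

/-! ### Strict proofs yield nets -/

namespace Proof

open Forest

variable {T : L.Theory}

theorem mem_eigenvars {F : Forest L V I} (π : Proof T F) (a : V) :
    a ∈ π.eigenvars ↔ a ∈ bound F := by
  induction π with
  | taut i Ps hne h => simp [eigenvars, mem_bound, labels_tautForest]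
  | allR F A b t π ih =>
    simp [eigenvars, mem_bound, labels_cons, Root.labels_tree, Tree.labels_alpha, ih, or_assoc]
  | exR F A M t π ih =>
    simp [eigenvars, mem_bound, labels_cons, Root.labels_tree, Tree.labels_sum, ih]
  | contrEx F A m n k e M t π ih =>
    rw [eigenvars, ih, mem_bound, mem_bound, labels_contrEx F A m n k e M t]
  | contrP F P S₁ S₂ h₁ h₂ π ih =>
    simp [eigenvars, mem_bound, labels_cons, Root.labels_tree, Tree.labels_leaf, ih]
  | cut F G A t s π₁ π₂ ih₁ ih₂ =>
    simp only [eigenvars, mem_bound, labels_cons, Root.labels_tree, Root.labels_cut, labels_append,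
      ih₁, ih₂, List.mem_append, Set.mem_union, Set.mem_insert_iff, reduceCtorEq, false_or]
    tauto
  | perm F G h π ih => rw [eigenvars, ih, mem_bound, mem_bound, labels_perm h]

theorem mem_indices {F : Forest L V I} (π : Proof T F) (i : I) :
    i ∈ π.indices ↔ i ∈ Forest.indices F := by
  induction π with
  | taut j Ps hne h => simp [indices, indices_tautForest j hne]
  | allR F A b t π ih => rw [indices, ih, indices_eq_of_disjuncts (disjuncts_alpha F A b t)]
  | exR F A M t π ih => rw [indices, ih, indices_eq_of_disjuncts (disjuncts_single F A M t)]
  | contrEx F A m n k e M t π ih =>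
    rw [indices, ih]
    simp only [Forest.mem_indices, mem_disjuncts, labels_contrEx F A m n k e M t]
  | contrP F P S₁ S₂ h₁ h₂ π ih =>
    classical
    rw [indices, ih, indices_eq_of_disjuncts (disjuncts_contrP F P S₁ S₂ _ h₁ h₂)]
  | cut F G A t s π₁ π₂ ih₁ ih₂ =>
    rw [indices, List.mem_append, ih₁, ih₂, indices_cut]
    rfl
  | perm F G h π ih =>
    rw [indices, ih]
    simp only [Forest.mem_indices, mem_disjuncts, labels_perm h]

/-- The variable `a` does not occur outside the subproofs above the `∀`-rules for `a`. -/
def Avoids {F : Forest L V I} (π : Proof T F) (a : V) : Prop :=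
  (∀ G ∈ π.sequentsOutside a, a ∉ typeFree G) ∧ ∀ M ∈ π.witnessesOutside a, a ∉ termFree M

theorem isStrict_iff {F : Forest L V I} {π : Proof T F} : π.IsStrict ↔
    π.indices.Nodup ∧ π.eigenvars.Nodup ∧ ∀ a ∈ π.eigenvars, π.Avoids a := Iff.rfl

theorem avoids_taut {i : I} {Ps : List (QFF L (V ⊕ Fin 0))} {hne : Ps ≠ []}
    {h : Valid T {P | P ∈ Ps}} {a : V} :
    (taut i Ps hne h).Avoids a ↔ a ∉ typeFree (tautForest i Ps) := by
  simp [Avoids, sequentsOutside, witnessesOutside]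

theorem avoids_allR {F : Forest L V I} {A : Prenex L V 1} {b : V}
    {t : Tree L V I (A.inst (.var b))} {π : Proof T (.tree _ t :: F)} {a : V} :
    (allR F A b t π).Avoids a ↔
      a ∉ typeFree (.tree _ (.alpha A b t) :: F) ∧ (b ≠ a → π.Avoids a) := by
  by_cases h : b = a <;> simp [Avoids, sequentsOutside, witnessesOutside, h, and_assoc]

theorem avoids_exR {F : Forest L V I} {A : Prenex L V 1} {M : L.Term V}
    {t : Tree L V I (A.inst M)} {π : Proof T (.tree _ t :: F)} {a : V} :
    (exR F A M t π).Avoids a ↔ a ∉ typeFree (.tree _ (.sum A 0 (fun _ => M) (fun _ => t)) :: F) ∧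
      a ∉ termFree M ∧ π.Avoids a := by
  simp only [Avoids, sequentsOutside, witnessesOutside, Set.singleton_union,
    Set.forall_mem_insert]
  tauto

theorem avoids_contrEx {F : Forest L V I} {A : Prenex L V 1} {m n k : ℕ}
    {e : Fin (m + 1) ⊕ Fin (n + 1) ≃ Fin (k + 1)}
    {M : Fin (k + 1) → L.Term V} {t : ∀ j, Tree L V I (A.inst (M j))} {π} {a : V} :
    (contrEx (T := T) F A m n k e M t π).Avoids a ↔
      a ∉ typeFree (.tree _ (.sum A k M t) :: F) ∧ π.Avoids a := by
  simp only [Avoids, sequentsOutside, witnessesOutside, Set.singleton_union,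
    Set.forall_mem_insert]
  tauto

open Classical in
theorem avoids_contrP {F : Forest L V I} {P : QFF L (V ⊕ Fin 0)} {S₁ S₂ : Finset I}
    {h₁ : S₁.Nonempty} {h₂ : S₂.Nonempty} {π} {a : V} :
    (contrP (T := T) F P S₁ S₂ h₁ h₂ π).Avoids a ↔
      a ∉ typeFree (.tree _ (.leaf P (S₁ ∪ S₂) (h₁.mono Finset.subset_union_left)) :: F) ∧
        π.Avoids a := by
  simp only [Avoids, sequentsOutside, witnessesOutside, Set.singleton_union,
    Set.forall_mem_insert]
  tauto

theorem avoids_cut {F G : Forest L V I} {A : Prenex L V 0} {t : Tree L V I A}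
    {s : Tree L V I A.dual} {π₁ : Proof T (.tree _ t :: F)} {π₂ : Proof T (.tree _ s :: G)} {a : V} :
    (cut F G A t s π₁ π₂).Avoids a ↔
      a ∉ typeFree (.cut A t s :: (F ++ G)) ∧ π₁.Avoids a ∧ π₂.Avoids a := by
  simp only [Avoids, sequentsOutside, witnessesOutside, Set.singleton_union,
    Set.forall_mem_insert, Set.mem_union, or_imp, forall_and]
  tauto

theorem avoids_perm {F G : Forest L V I} {h : F.Perm G} {π : Proof T F} {a : V} :
    (perm F G h π).Avoids a ↔ a ∉ typeFree G ∧ π.Avoids a := by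
  simp only [Avoids, sequentsOutside, witnessesOutside, Set.singleton_union,
    Set.forall_mem_insert]
  tauto

theorem Avoids.not_mem_typeFree {F : Forest L V I} {π : Proof T F} {a : V} (h : π.Avoids a) :
    a ∉ typeFree F := by
  refine h.1 F ?_
  cases π <;> exact .inl rfl

/-- A variable that is not an eigenvariable occurs in a proof if and only if it occurs in the
conclusion. -/
theorem avoids_iff {F : Forest L V I} (π : Proof T F) {a : V} (ha : a ∉ π.eigenvars) :
    π.Avoids a ↔ a ∉ occ F := by
  induction π with
  | taut i Ps hne h =>
    have : a ∉ jumps (tautForest i Ps) := by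
      rintro ⟨l, hl, h⟩
      rw [labels_tautForest] at hl
      obtain ⟨P, -, rfl⟩ := hl
      exact h
    rw [avoids_taut, mem_occ]
    tauto
  | allR F A b t π ih =>
    have hb : a ≠ b ∧ a ∉ π.eigenvars := by simpa [eigenvars] using ha
    have := Prenex.free_inst (.var b : L.Term V) A
    rw [termFree_var] at this
    have h1 : a ∈ (A.inst (.var b)).free → a ∈ A.free := fun h => (this h).resolve_right hb.1
    have h2 : (Prenex.all A).free = A.free := rfl
    rw [avoids_allR, ih hb.2, mem_occ, mem_occ, mem_typeFree_tree, mem_typeFree_tree, jumps_tree,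
      jumps_tree, Tree.jumps_alpha, h2]
    have h3 := hb.1.symm
    grind
  | exR F A M t π ih =>
    have := Prenex.free_inst M A
    have h1 : a ∈ (A.inst M).free → a ∈ A.free ∨ a ∈ termFree M := fun h => this h
    have h2 : (Prenex.ex A).free = A.free := rfl
    rw [avoids_exR, ih ha, mem_occ, mem_occ, mem_typeFree_tree, mem_typeFree_tree, jumps_tree,
      jumps_tree, Tree.jumps_single, h2, Set.mem_union, Set.mem_union, Set.mem_union]
    grind
  | contrEx F A m n k e M t π ih =>
    rw [avoids_contrEx, ih ha, mem_occ, mem_occ, mem_typeFree_tree, mem_typeFree_tree,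
      mem_typeFree_tree, jumps_eq_of_labels (labels_contrEx F A m n k e M t)]
    grind
  | contrP F P S₁ S₂ h₁ h₂ π ih =>
    rw [avoids_contrP, ih ha, mem_occ, mem_occ, mem_typeFree_tree, mem_typeFree_tree,
      mem_typeFree_tree, jumps_tree, jumps_tree, jumps_tree, Tree.jumps_leaf, Tree.jumps_leaf,
      Tree.jumps_leaf, Set.empty_union, Set.empty_union]
    grind
  | cut F G A t s π₁ π₂ ih₁ ih₂ =>
    have ha' : a ∉ π₁.eigenvars ∧ a ∉ π₂.eigenvars := by simpa [eigenvars] using ha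
    rw [avoids_cut, ih₁ ha'.1, ih₂ ha'.2, mem_occ, mem_occ, mem_occ, mem_typeFree_tree,
      mem_typeFree_tree, mem_typeFree_cut, mem_typeFree_append, jumps_tree, jumps_tree, jumps_cut,
      jumps_append, Prenex.free_dual]
    simp only [Set.mem_union]
    grind
  | perm F G h π ih =>
    rw [avoids_perm, ih ha, mem_occ, mem_occ, jumps_eq_of_labels (labels_perm h), typeFree_perm h]
    grind

/-- The endsequent of a strict proof is propositionally correct and ACC-correct. -/
theorem correct_of_isStrict {F : Forest L V I} (π : Proof T F) (hπ : π.IsStrict) :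
    IsHerbrandStructure T F ∧ IsNet F := by
  induction π with
  | taut i Ps hne h =>
    refine ⟨fun j hj => ?_, isNet_tautForest i hne⟩
    rw [indices_tautForest i hne] at hj
    obtain rfl : j = i := hj
    rwa [disjuncts_tautForest]
  | allR F A b t π ih =>
    obtain ⟨h1, h2, h3⟩ := isStrict_iff.1 hπ
    rw [eigenvars, List.nodup_cons] at h2
    obtain ⟨hT, hN⟩ := ih ⟨h1, h2.2, fun a ha =>
      (avoids_allR.1 (h3 a (List.mem_cons_of_mem _ ha))).2 fun h => h2.1 (h ▸ ha)⟩
    exact ⟨isHerbrandStructure_of_disjuncts (disjuncts_alpha F A b t).symm hT,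
      (isNet_alpha_iff F A b t).2 hN⟩
  | exR F A M t π ih =>
    obtain ⟨h1, h2, h3⟩ := isStrict_iff.1 hπ
    obtain ⟨hT, hN⟩ := ih ⟨h1, h2, fun a ha => (avoids_exR.1 (h3 a ha)).2.2⟩
    refine ⟨isHerbrandStructure_of_disjuncts (disjuncts_single F A M t).symm hT,
      (isNet_single_iff F A M t ?_).2 hN⟩
    exact Set.disjoint_left.2 fun a ha => (avoids_exR.1 (h3 a ((π.mem_eigenvars a).2 ha))).2.1
  | contrEx F A m n k e M t π ih =>
    obtain ⟨h1, h2, h3⟩ := isStrict_iff.1 hπ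
    obtain ⟨hT, hN⟩ := ih ⟨h1, h2, fun a ha => (avoids_contrEx.1 (h3 a ha)).2⟩
    have hdis := disjuncts_eq_of_labels (labels_contrEx F A m n k e M t)
    obtain ⟨f, D, h, hD, hD'⟩ := exists_localIso_contrEx F A m n k e M t
    exact ⟨isHerbrandStructure_of_disjuncts hdis.symm hT, (isNet_contr_iff h hD hD' hdis).2 hN⟩
  | contrP F P S₁ S₂ h₁ h₂ π ih =>
    classical
    obtain ⟨h1, h2, h3⟩ := isStrict_iff.1 hπ
    obtain ⟨hT, hN⟩ := ih ⟨h1, h2, fun a ha => (avoids_contrP.1 (h3 a ha)).2⟩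
    have hdis := disjuncts_contrP F P S₁ S₂ (h₁.mono Finset.subset_union_left) h₁ h₂
    obtain ⟨f, D, h, hD, hD'⟩ := exists_localIso_contrP F P (S₁ ∪ S₂) S₁ S₂
      (h₁.mono Finset.subset_union_left) h₁ h₂
    have hT' := isHerbrandStructure_of_disjuncts hdis.symm hT
    have hN' := (isNet_contr_iff h hD hD' hdis).2 hN
    -- the instances of `DecidableEq I` in the two unions may differ
    convert And.intro hT' hN'
  | cut F G A t s π₁ π₂ ih₁ ih₂ =>
    obtain ⟨h1, h2, h3⟩ := isStrict_iff.1 hπ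
    obtain ⟨hi₁, hi₂, hi⟩ := List.nodup_append.1 h1
    obtain ⟨he₁, he₂, he⟩ := List.nodup_append.1 h2
    have hav : ∀ a, a ∈ π₁.eigenvars ∨ a ∈ π₂.eigenvars → π₁.Avoids a ∧ π₂.Avoids a :=
      fun a ha => (avoids_cut.1 (h3 a (List.mem_append.2 ha))).2
    obtain ⟨hT₁, hN₁⟩ := ih₁ ⟨hi₁, he₁, fun a ha => (hav a (.inl ha)).1⟩
    obtain ⟨hT₂, hN₂⟩ := ih₂ ⟨hi₂, he₂, fun a ha => (hav a (.inr ha)).2⟩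
    have hI : Disjoint (Forest.indices (.tree _ t :: F)) (Forest.indices (.tree _ s :: G)) :=
      Set.disjoint_left.2 fun i hi' hi'' =>
        hi i ((π₁.mem_indices i).2 hi') i ((π₂.mem_indices i).2 hi'') rfl
    refine ⟨fun i hi' => ?_, isNet_cut F G A t s hN₁ hN₂ ?_ ?_ hI⟩
    · have hempty : ∀ {H : Forest L V I}, i ∉ Forest.indices H → disjuncts H i = ∅ := fun h =>
        Set.eq_empty_of_forall_notMem fun P hP => h (Forest.mem_indices.2 ⟨P, hP⟩)
      rw [disjuncts_cut]
      rw [indices_cut] at hi'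
      rcases hi' with hi' | hi'
      · rw [hempty (Set.disjoint_left.1 hI hi'), Set.union_empty]
        exact hT₁ i hi'
      · rw [hempty (Set.disjoint_right.1 hI hi'), Set.empty_union]
        exact hT₂ i hi'
    · refine Set.disjoint_left.2 fun a ha => ?_
      have ha := (π₁.mem_eigenvars a).2 ha
      obtain ⟨hav₁, hav₂⟩ := hav a (.inl ha)
      rintro (h | h)
      · exact hav₁.not_mem_typeFree (mem_typeFree_tree.2 (.inl h))
      · exact (avoids_iff π₂ fun h => he a ha a h rfl).1 hav₂ (.inl h)
    · refine Set.disjoint_left.2 fun a ha => ?_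
      have ha := (π₂.mem_eigenvars a).2 ha
      obtain ⟨hav₁, hav₂⟩ := hav a (.inr ha)
      rintro (h | h)
      · exact hav₂.not_mem_typeFree (mem_typeFree_tree.2 (.inl (by rwa [Prenex.free_dual])))
      · exact (avoids_iff π₁ fun h => he a h a ha rfl).1 hav₁ (.inl h)
  | perm F G h π ih =>
    obtain ⟨h1, h2, h3⟩ := isStrict_iff.1 hπ
    obtain ⟨hT, hN⟩ := ih ⟨h1, h2, fun a ha => (avoids_perm.1 (h3 a ha)).2⟩
    exact ⟨isHerbrandStructure_of_disjuncts (disjuncts_eq_of_labels (labels_perm h)) hT,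
      (isNet_perm h).1 hN⟩

end Proof

/-! ### Splitting a net at a cut -/

/-- Induction from the roots to the leaves. -/
theorem IsLabelled.induction_root {N : Type*} {lab : N → Label L V I} {par : N → Option N}
    (h : IsLabelled lab par) {q : N → Prop} (hroot : ∀ y, par y = none → q y)
    (hchild : ∀ y z, par y = some z → q z → q y) (y : N) : q y := by
  obtain ⟨d, hd⟩ := h.depth
  induction hn : d y using Nat.strong_induction_on generalizing y with
  | _ n ih =>
    cases hy : par y with
    | none => exact hroot y hy
    | some z => exact hchild y z hy (ih (d z) (hn ▸ hd y z hy) z rfl)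

theorem Root.exists_root (r : Root L V I) : ∃ ρ, ∀ y, r.parent y = none ↔ y = ρ := by
  cases r with
  | tree A t => exact ⟨t.root, t.parent_eq_none_iff⟩
  | witness A M t =>
    refine ⟨(none : Option t.Node), ?_⟩
    rintro (_ | y)
    · exact ⟨fun _ => rfl, fun _ => rfl⟩
    · exact ⟨fun h => (by cases h), fun h => (by cases h)⟩
  | cut A t s =>
    refine ⟨(none : Option (t.Node ⊕ s.Node)), ?_⟩
    rintro (_ | y | y)
    · exact ⟨fun _ => rfl, fun _ => rfl⟩
    · exact ⟨fun h => (by cases h), fun h => (by cases h)⟩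
    · exact ⟨fun h => (by cases h), fun h => (by cases h)⟩

/-- Isomorphisms transport sub-nets. -/
theorem LocalIso.isSubnet_image {N N' : Type*} {lab : N → Label L V I} {par : N → Option N}
    {lab' : N' → Label L V I} {par' : N' → Option N'} {f : N → N'}
    (h : LocalIso lab par lab' par' f Set.univ) (hf : f.Surjective) {B : Set (N ⊕ I)}
    (hB : IsSubnet (Edge lab par) (NodeSwitched lab) B) :
    IsSubnet (Edge lab' par') (NodeSwitched lab') (Sum.map f id '' B) := by
  have hfi : Function.Injective f := Set.injOn_univ.1 h.inj
  refine hB.image (D := Set.univ) _ (Sum.map_injective.2 ⟨hfi, Function.injective_id⟩).injOn ?_ ?_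
    (Set.subset_univ B)
  · rintro (y | i) -
    · change (lab' (f y)).IsSwitched ↔ (lab y).IsSwitched
      rw [h.label y trivial]
    · exact Iff.rfl
  · intro v _ u'
    have huniv : ∀ v : N ⊕ I, v ∈ Sum.inl '' (Set.univ : Set N) ∪ Sum.inr '' (Set.univ : Set I) := by
      rintro (y | i)
      · exact .inl ⟨y, trivial, rfl⟩
      · exact .inr ⟨i, trivial, rfl⟩
    rw [h.edge (J := Set.univ)
      (fun _ _ _ _ y' _ => by obtain ⟨y, rfl⟩ := hf y'; exact ⟨y, trivial, rfl⟩)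
      (fun _ _ _ _ _ _ _ => trivial) v (huniv v)]
    exact ⟨fun ⟨u, _, h⟩ => ⟨u, trivial, h⟩, fun ⟨u, _, h⟩ => ⟨u, huniv u, h⟩⟩

namespace Forest

/-- A set `p` of nodes that is a union of whole trees, and its complement, are the sets of nodes of
two forests into which the given one splits. -/
theorem exists_split (F : Forest L V I) (p : Node F → Prop)
    (hp : ∀ y z, parent F y = some z → (p y ↔ p z)) :
    ∃ F₁ F₂ : Forest L V I, F.Perm (F₁ ++ F₂) ∧
      ∃ (g₁ : Node F₁ → Node F) (g₂ : Node F₂ → Node F),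
        LocalIso (label F₁) (parent F₁) (label F) (parent F) g₁ Set.univ ∧
        LocalIso (label F₂) (parent F₂) (label F) (parent F) g₂ Set.univ ∧
        (∀ y, y ∈ g₁ '' Set.univ ↔ p y) ∧ ∀ y, y ∈ g₂ '' Set.univ ↔ ¬ p y := by
  induction F with
  | nil =>
    exact ⟨[], [], .nil, fun y => y.elim, fun y => y.elim, .nil _ _, .nil _ _, fun y => y.elim,
      fun y => y.elim⟩
  | cons r F ih =>
    obtain ⟨F₁, F₂, hF, g₁, g₂, hg₁, hg₂, hp₁, hp₂⟩ := ih (fun y => p (.inr y))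
      fun y z h => hp _ _ (congrArg (Option.map Sum.inr) h)
    obtain ⟨ρ, hρ⟩ := r.exists_root
    have hconst : ∀ y, p (.inl y) ↔ p (.inl ρ) := fun y =>
      r.isLabelled.induction_root (q := fun y => p (.inl y) ↔ p (.inl ρ))
        (fun y h => by rw [(hρ y).1 h])
        (fun y z h hz => (hp (.inl y) (.inl z) (congrArg (Option.map Sum.inl) h)).trans hz) y
    have hl := LocalIso.inl r F
    have hr := LocalIso.inr r F
    have hrg₁ := hr.comp hg₁ fun _ _ => trivial
    have hrg₂ := hr.comp hg₂ fun _ _ => trivial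
    by_cases hpρ : p (.inl ρ)
    · refine ⟨r :: F₁, F₂, hF.cons r, _, _, hl.cons_univ hrg₁ fun y z h => (by cases h), hrg₂,
        ?_, ?_⟩
      · rintro (y | y)
        · exact iff_of_true ⟨.inl y, trivial, rfl⟩ ((hconst y).2 hpρ)
        · rw [← hp₁ y]
          constructor
          · rintro ⟨z | z, -, h⟩
            · cases h
            · exact ⟨z, trivial, Sum.inr_injective h⟩
          · rintro ⟨z, -, rfl⟩
            exact ⟨.inr z, trivial, rfl⟩
      · rintro (y | y)
        · refine iff_of_false ?_ (not_not_intro ((hconst y).2 hpρ))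
          rintro ⟨z, -, h⟩
          cases h
        · rw [← hp₂ y]
          constructor
          · rintro ⟨z, -, h⟩
            exact ⟨z, trivial, Sum.inr_injective h⟩
          · rintro ⟨z, -, rfl⟩
            exact ⟨z, trivial, rfl⟩
    · refine ⟨F₁, r :: F₂, (hF.cons r).trans List.perm_middle.symm, _, _, hrg₁,
        hl.cons_univ hrg₂ fun y z h => (by cases h), ?_, ?_⟩
      · rintro (y | y)
        · refine iff_of_false ?_ fun h => hpρ ((hconst y).1 h)
          rintro ⟨z, -, h⟩
          cases h
        · rw [← hp₁ y]
          constructor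
          · rintro ⟨z, -, h⟩
            exact ⟨z, trivial, Sum.inr_injective h⟩
          · rintro ⟨z, -, rfl⟩
            exact ⟨z, trivial, rfl⟩
      · rintro (y | y)
        · exact iff_of_true ⟨.inl y, trivial, rfl⟩ fun h => hpρ ((hconst y).1 h)
        · rw [← hp₂ y]
          constructor
          · rintro ⟨z | z, -, h⟩
            · cases h
            · exact ⟨z, trivial, Sum.inr_injective h⟩
          · rintro ⟨z, -, rfl⟩
            exact ⟨.inr z, trivial, rfl⟩

/-- A cut node is a root, and can be moved to the front. -/
theorem exists_localIso_of_cut (F : Forest L V I) (y : Node F) {A : Prenex L V 0}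
    (hy : label F y = .cut A) :
    ∃ (t : Tree L V I A) (s : Tree L V I A.dual) (F' : Forest L V I)
      (f : Node F → Node (.cut A t s :: F')), F.Perm (.cut A t s :: F') ∧
      LocalIso (label F) (parent F) (label (.cut A t s :: F')) (parent (.cut A t s :: F')) f
        Set.univ ∧ f.Surjective ∧ f y = cutNode A t s F' := by
  induction F with
  | nil => exact y.elim
  | cons r F ih =>
    rcases y with y | y
    · cases r with
      | tree B t => exact absurd hy (t.label_ne_cut y A)
      | witness B M t =>
        rcases y with _ | y
        · cases hy
        · exact absurd hy (t.label_ne_cut y A)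
      | cut B t s =>
        rcases y with _ | y | y
        · cases hy
          exact ⟨t, s, F, id, .refl _, ⟨fun _ _ _ _ h => h, fun _ _ => rfl,
            fun _ _ _ h => ⟨trivial, h⟩, fun _ _ y h => ⟨y, trivial, h, rfl⟩⟩,
            Function.surjective_id, rfl⟩
        · exact absurd hy (t.label_ne_cut y A)
        · exact absurd hy (s.label_ne_cut y A)
    · obtain ⟨t, s, F', f, hF, hf, hsurj, hfy⟩ := ih y hy
      have h1 := LocalIso.inl (.cut A t s) (r :: F')
      have h2 := LocalIso.inr (.cut A t s) (r :: F')
      have h3 := h1.cons_univ (h2.comp (LocalIso.inr r F') fun _ _ => trivial) fun y z h => by cases h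
      have h4 := h3.comp hf fun _ _ => trivial
      have h5 := (h2.comp (LocalIso.inl r F') fun _ _ => trivial).cons_univ h4 ?_
      · refine ⟨t, s, r :: F', _, (hF.cons r).trans (.swap _ _ _), h5, ?_, ?_⟩
        · rintro (z | z | z)
          · obtain ⟨z', hz'⟩ := hsurj (.inl z)
            refine ⟨.inr z', ?_⟩
            change Sum.elim _ _ (f z') = _
            rw [hz']
            rfl
          · exact ⟨.inl z, rfl⟩
          · obtain ⟨z', hz'⟩ := hsurj (.inr z)
            refine ⟨.inr z', ?_⟩
            change Sum.elim _ _ (f z') = _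
            rw [hz']
            rfl
        · change Sum.elim _ _ (f y) = _
          rw [hfy]
          rfl
      · intro z z' h
        change _ = Sum.elim _ _ (f z') at h
        generalize f z' = x at h
        rcases x with x | x <;> cases h

/-- If the nodes of a sub-net `B` of `G` are those of a forest `H`, and each of its indices occurs
at one of its nodes, then `H` is a net with the indices of `B`. -/
theorem isNet_of_isSubnet {H G : Forest L V I} {f : Node H → Node G}
    (hf : LocalIso (label H) (parent H) (label G) (parent G) f Set.univ) {B : Set (Node G ⊕ I)}
    (hB : IsSubnet (Edge (label G) (parent G)) (NodeSwitched (label G)) B)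
    (himg : ∀ y, y ∈ f '' Set.univ ↔ .inl y ∈ B)
    (hidx : ∀ i, .inr i ∈ B → ∃ z P S, .inl z ∈ B ∧ label G z = .leaf P S ∧ i ∈ S) :
    IsNet H ∧ ∀ i, i ∈ indices H ↔ .inr i ∈ B := by
  have hJ : ∀ i, i ∈ indices H ↔ .inr i ∈ B := by
    intro i
    constructor
    · rintro ⟨y, P, S, hl, hi⟩
      refine hB.source_mem ((himg (f y)).1 ⟨y, trivial, rfl⟩) (.index (P := P) ?_ hi)
      rw [hf.label y trivial, hl]
    · intro hi
      obtain ⟨z, P, S, hz, hl, hi⟩ := hidx i hi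
      obtain ⟨y, -, rfl⟩ := (himg z).2 hz
      exact ⟨y, P, S, by rw [← hf.label y trivial, hl], hi⟩
  refine ⟨(hf.isSubnet_iff (fun _ _ _ _ _ _ => trivial) (fun z _ a hz y hy => ?_)
    (J := indices H) (fun y _ P S hl i hi => ⟨y, P, S, hl, hi⟩)).1 ?_, hJ⟩
  · refine (himg y).2 (hB.source_mem ((himg (f z)).1 ⟨z, trivial, rfl⟩) (.jump hy ?_))
    rw [hf.label z trivial, hz]
  · refine cast (congrArg (IsSubnet _ _) ?_) hB
    ext (y | i)
    · rw [inl_mem_image_union, himg]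
    · rw [inr_mem_image_union, hJ]

/-- If a net ends with a cut that joins two sub-nets, the other roots are distributed over the two
sub-nets, and there are no jumps between these, since sub-nets contain the sources of their
vertices. -/
theorem exists_split_cut (A : Prenex L V 0) (t : Tree L V I A) (s : Tree L V I A.dual)
    (F : Forest L V I) {B C : Set (Node (.cut A t s :: F) ⊕ I)}
    (hB : IsSubnet (Edge (label _) (parent _)) (NodeSwitched (label _)) B)
    (hC : IsSubnet (Edge (label _) (parent _)) (NodeSwitched (label _)) C)
    (hBC : Disjoint B C) (hnB : .inl (cutNode A t s F) ∉ B) (hnC : .inl (cutNode A t s F) ∉ C)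
    (hsupp : support (.cut A t s :: F) = insert (.inl (cutNode A t s F)) (B ∪ C))
    (hlB : .inl (cutLeft A t s F) ∈ B) (hrC : .inl (cutRight A t s F) ∈ C) :
    ∃ F₁ F₂ : Forest L V I, F.Perm (F₁ ++ F₂) ∧
      IsNet (.tree _ t :: F₁) ∧ IsNet (.tree _ s :: F₂) ∧
      Disjoint (indices (.tree _ t :: F₁)) (indices (.tree _ s :: F₂)) ∧
      Disjoint (bound (.tree _ t :: F₁)) (A.free ∪ jumps (.tree _ s :: F₂)) ∧
      Disjoint (bound (.tree _ s :: F₂)) (A.free ∪ jumps (.tree _ t :: F₁)) ∧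
      ∃ (f₁ : Node (.tree _ t :: F₁) → Node (.cut A t s :: F))
        (f₂ : Node (.tree _ s :: F₂) → Node (.cut A t s :: F)),
        LocalIso (label _) (parent _) (label _) (parent _) f₁ Set.univ ∧
        LocalIso (label _) (parent _) (label _) (parent _) f₂ Set.univ ∧ ∀ y z, f₁ y ≠ f₂ z := by
  have hcov : ∀ y, y ≠ cutNode A t s F → .inl y ∈ B ∨ .inl y ∈ C := by
    intro y hy
    have : .inl y ∈ support (.cut A t s :: F) := .inl ⟨y, trivial, rfl⟩
    rw [hsupp] at this
    exact this.resolve_left fun h => hy (Sum.inl_injective h)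
  have hdisj : ∀ {v}, v ∈ B → v ∉ C := fun h => Set.disjoint_left.1 hBC h
  -- the trees above the premises of the cut
  have ht : ∀ y : t.Node, .inl (.inl (some (.inl y))) ∈ B := by
    refine fun y => t.isLabelled.induction_root
      (q := fun y => .inl (.inl (some (.inl y))) ∈ B) (fun y h => ?_) (fun y z h hz => ?_) y
    · rw [(t.parent_eq_none_iff y).1 h]
      exact hlB
    · exact hB.source_mem hz (.child
        ((LocalIso.inl (.cut A t s) F).child _ trivial _
          ((LocalIso.cutLeft A t s).child _ trivial y h).2).2)
  have hs : ∀ y : s.Node, .inl (.inl (some (.inr y))) ∈ C := by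
    refine fun y => s.isLabelled.induction_root
      (q := fun y => .inl (.inl (some (.inr y))) ∈ C) (fun y h => ?_) (fun y z h hz => ?_) y
    · rw [(s.parent_eq_none_iff y).1 h]
      exact hrC
    · exact hC.source_mem hz (.child
        ((LocalIso.inl (.cut A t s) F).child _ trivial _
          ((LocalIso.cutRight A t s).child _ trivial y h).2).2)
  have hne : ∀ y : Node F, (.inr y : Node (.cut A t s :: F)) ≠ cutNode A t s F :=
    fun y h => by cases h
  obtain ⟨F₁, F₂, hF, g₁, g₂, hg₁, hg₂, hp₁, hp₂⟩ := exists_split F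
    (fun y => .inl (.inr y) ∈ B) (by
      intro y z h
      have hE : Edge (I := I) (label (.cut A t s :: F)) (parent (.cut A t s :: F)) (.inl (.inr y))
        (.inl (.inr z)) := .child ((LocalIso.inr (.cut A t s) F).child z trivial y h).2
      refine ⟨fun hy => ?_, fun hz => hB.source_mem hz hE⟩
      exact (hcov _ (hne z)).resolve_right fun hz => hdisj hy (hC.source_mem hz hE))
  have hl := LocalIso.inl (.cut A t s) F
  have hr := LocalIso.inr (.cut A t s) F
  have hf₁ := (hl.comp (LocalIso.cutLeft A t s) fun _ _ => trivial).cons_univ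
    (hr.comp hg₁ fun _ _ => trivial) fun y z h => by cases h
  have hf₂ := (hl.comp (LocalIso.cutRight A t s) fun _ _ => trivial).cons_univ
    (hr.comp hg₂ fun _ _ => trivial) fun y z h => by cases h
  obtain ⟨f₁, hf₁, himg₁⟩ : ∃ f₁ : Node (.tree _ t :: F₁) → Node (.cut A t s :: F),
      LocalIso (label _) (parent _) (label _) (parent _) f₁ Set.univ ∧
      ∀ y, y ∈ f₁ '' Set.univ ↔ .inl y ∈ B := by
    refine ⟨_, hf₁, fun y => ⟨?_, fun hy => ?_⟩⟩
    · rintro ⟨z | z, -, rfl⟩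
      · exact ht z
      · exact (hp₁ (g₁ z)).1 ⟨z, trivial, rfl⟩
    · rcases y with (_ | y | y) | y
      · exact absurd hy hnB
      · exact ⟨.inl y, trivial, rfl⟩
      · exact absurd (hs y) (hdisj hy)
      · obtain ⟨z, -, rfl⟩ := (hp₁ y).2 hy
        exact ⟨.inr z, trivial, rfl⟩
  obtain ⟨f₂, hf₂, himg₂⟩ : ∃ f₂ : Node (.tree _ s :: F₂) → Node (.cut A t s :: F),
      LocalIso (label _) (parent _) (label _) (parent _) f₂ Set.univ ∧
      ∀ y, y ∈ f₂ '' Set.univ ↔ .inl y ∈ C := by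
    refine ⟨_, hf₂, fun y => ⟨?_, fun hy => ?_⟩⟩
    · rintro ⟨z | z, -, rfl⟩
      · exact hs z
      · exact (hcov _ (hne (g₂ z))).resolve_left ((hp₂ (g₂ z)).1 ⟨z, trivial, rfl⟩)
    · rcases y with (_ | y | y) | y
      · exact absurd hy hnC
      · exact absurd hy (hdisj (ht y))
      · exact ⟨.inl y, trivial, rfl⟩
      · obtain ⟨z, -, rfl⟩ := (hp₂ y).2 fun h => hdisj h hy
        exact ⟨.inr z, trivial, rfl⟩
  have hleaf : ∀ i, .inr i ∈ B ∪ C → ∃ z P S, (.inl z ∈ B ∨ .inl z ∈ C) ∧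
      label (.cut A t s :: F) z = .leaf P S ∧ i ∈ S := by
    intro i hi
    have : .inr i ∈ support (.cut A t s :: F) := by
      rw [hsupp]
      exact .inr hi
    obtain ⟨z, P, S, hl, hi⟩ := inr_mem_image_union.1 this
    refine ⟨z, P, S, hcov z ?_, hl, hi⟩
    rintro rfl
    cases hl
  obtain ⟨hN₁, hI₁⟩ := isNet_of_isSubnet hf₁ hB himg₁ fun i hi => by
    obtain ⟨z, P, S, hz, hl, hiS⟩ := hleaf i (.inl hi)
    exact ⟨z, P, S, hz.resolve_right fun h => hdisj hi (hC.source_mem h (.index hl hiS)), hl, hiS⟩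
  obtain ⟨hN₂, hI₂⟩ := isNet_of_isSubnet hf₂ hC himg₂ fun i hi => by
    obtain ⟨z, P, S, hz, hl, hiS⟩ := hleaf i (.inr hi)
    exact ⟨z, P, S, hz.resolve_left fun h => hdisj (hB.source_mem h (.index hl hiS)) hi, hl, hiS⟩
  have hm₁ : ∀ y, .inl (f₁ y) ∈ B := fun y => (himg₁ _).1 ⟨y, trivial, rfl⟩
  have hm₂ : ∀ y, .inl (f₂ y) ∈ C := fun y => (himg₂ _).1 ⟨y, trivial, rfl⟩
  refine ⟨F₁, F₂, hF, hN₁, hN₂, ?_, ?_, ?_, f₁, f₂, hf₁, hf₂, ?_⟩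
  · exact Set.disjoint_left.2 fun i h h' => hdisj ((hI₁ i).1 h) ((hI₂ i).1 h')
  · refine Set.disjoint_left.2 ?_
    rintro a ⟨z, hz⟩ (ha | ⟨_, ⟨y, rfl⟩, hy⟩)
    · rw [← hf₁.label z trivial] at hz
      exact hnB (hB.source_mem (hm₁ z) (.jump (y := cutNode A t s F) ha hz))
    · rw [← hf₁.label z trivial] at hz
      rw [← hf₂.label y trivial] at hy
      exact hdisj (hB.source_mem (hm₁ z) (.jump hy hz)) (hm₂ y)
  · refine Set.disjoint_left.2 ?_
    rintro a ⟨z, hz⟩ (ha | ⟨_, ⟨y, rfl⟩, hy⟩)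
    · rw [← hf₂.label z trivial] at hz
      exact hnC (hC.source_mem (hm₂ z) (.jump (y := cutNode A t s F) ha hz))
    · rw [← hf₂.label z trivial] at hz
      rw [← hf₁.label y trivial] at hy
      exact hdisj (hm₁ y) (hC.source_mem (hm₂ z) (.jump hy hz))
  · exact fun y z h => hdisj (h ▸ hm₁ y) (hm₂ z)

end Forest

/-! ### Sizes -/

/-- The size of an expansion tree, chosen so that each rule of the calculus, contraction included,
has larger conclusion than premises. -/
def Tree.weight : {A : Prenex L V 0} → Tree L V I A → ℕ
  | _, leaf _ S _ => 2 * S.card - 1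
  | _, alpha _ _ t => 1 + t.weight
  | _, sum _ n _ t => 2 * n + 1 + ∑ k, (t k).weight

/-- The size of a root. -/
def Root.weight : Root L V I → ℕ
  | tree _ t => t.weight
  | witness _ _ t => 1 + t.weight
  | cut _ t s => 1 + t.weight + s.weight

namespace Forest

/-- The size of a forest. -/
def weight (F : Forest L V I) : ℕ := (F.map Root.weight).sum

theorem weight_cons (r : Root L V I) (F : Forest L V I) : weight (r :: F) = r.weight + weight F :=
  rfl

theorem weight_append (F G : Forest L V I) : weight (F ++ G) = weight F + weight G := by
  simp [weight]

theorem weight_perm {F G : Forest L V I} (h : F.Perm G) : weight F = weight G :=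
  (h.map _).sum_eq

/-- The weight `2 * n + 1` of a sum node makes the weight of a sum exceed that of its two parts. -/
theorem weight_contrEx_lt (F : Forest L V I) (A : Prenex L V 1) (m n k : ℕ)
    (e : Fin (m + 1) ⊕ Fin (n + 1) ≃ Fin (k + 1))
    (M : Fin (k + 1) → L.Term V) (t : ∀ j, Tree L V I (A.inst (M j))) :
    weight (.tree _ (.sum A m (fun j => M (e (.inl j))) (fun j => t (e (.inl j)))) ::
        .tree _ (.sum A n (fun j => M (e (.inr j))) (fun j => t (e (.inr j)))) :: F) <
      weight (.tree _ (.sum A k M t) :: F) := by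
  have hk := Fintype.card_congr e
  have hs := e.sum_comp fun j => (t j).weight
  rw [Fintype.card_sum, Fintype.card_fin, Fintype.card_fin, Fintype.card_fin] at hk
  rw [Fintype.sum_sum_type] at hs
  simp only [weight_cons, Root.weight, Tree.weight]
  omega

/-! ### Annotated sequents and backward application of rules -/

/-- Strictness is inherited along maps that miss no `α`-node. -/
theorem isStrict_of_localIso {F G : Forest L V I} {f : Node F → Node G} {D : Set (Node F)}
    (h : LocalIso (label F) (parent F) (label G) (parent G) f D)
    (hD : ∀ y a, label F y = .alpha a → y ∈ D) (hG : IsStrict G)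
    (hT : ∀ a ∈ bound F, a ∈ typeFree F → a ∈ typeFree G) : IsStrict F := by
  refine ⟨fun a y z hy hz => h.inj (hD y a hy) (hD z a hz) (hG.1 a _ _ ?_ ?_),
    Set.disjoint_left.2 fun a ha ha' => Set.disjoint_left.1 hG.2 ?_ (hT a ha ha')⟩
  · rw [h.label y (hD y a hy), hy]
  · rw [h.label z (hD z a hz), hz]
  · obtain ⟨y, hy⟩ := ha
    exact ⟨f y, by rw [h.label y (hD y a hy), hy]⟩

theorem isStrict_perm {F G : Forest L V I} (h : F.Perm G) (hF : IsStrict F) : IsStrict G := by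
  obtain ⟨e, he⟩ := exists_localIso_of_perm h.symm
  exact isStrict_of_localIso he (fun _ _ _ => trivial) hF fun a _ => typeFree_perm h ▸ id

/-- The eigenvariable of an `α`-node at a root is not bound elsewhere. -/
theorem not_mem_bound_of_alpha {F : Forest L V I} {A : Prenex L V 1} {a : V}
    {t : Tree L V I (A.inst (.var a))} (h : IsStrict (.tree _ (.alpha A a t) :: F)) :
    a ∉ bound (.tree _ t :: F) := by
  rintro ⟨y | y, hy⟩
  · have := h.1 a (.inl (none : Option t.Node)) (.inl (some y : Option t.Node)) rfl hy
    cases this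
  · have := h.1 a (.inl (none : Option t.Node)) (.inr y) rfl hy
    cases this

/-- Herbrand nets, with ACC-correctness expressed in terms of sub-nets. -/
structure IsCorrect (T : L.Theory) (F : Forest L V I) : Prop where
  strict : IsStrict F
  not_isWitness : ∀ r ∈ F, ¬ r.IsWitness
  herbrand : IsHerbrandStructure T F
  net : IsNet F

/-- Being the endsequent of a strict proof. -/
def Provable (T : L.Theory) (F : Forest L V I) : Prop := ∃ π : Proof T F, π.IsStrict

variable {T : L.Theory}

open Proof

theorem IsCorrect.perm {F G : Forest L V I} (h : F.Perm G) (hF : IsCorrect T F) :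
    IsCorrect T G where
  strict := isStrict_perm h hF.strict
  not_isWitness r hr := hF.not_isWitness r (h.mem_iff.2 hr)
  herbrand := isHerbrandStructure_of_disjuncts (disjuncts_eq_of_labels (labels_perm h)) hF.herbrand
  net := (isNet_perm h).1 hF.net

theorem Provable.perm {F G : Forest L V I} (h : F.Perm G) : Provable T F → Provable T G := by
  rintro ⟨π, hπ⟩
  obtain ⟨h1, h2, h3⟩ := isStrict_iff.1 hπ
  refine ⟨.perm F G h π, isStrict_iff.2 ⟨h1, h2, fun a ha => avoids_perm.2 ⟨?_, h3 a ha⟩⟩⟩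
  rw [← typeFree_perm h]
  exact (h3 a ha).not_mem_typeFree

theorem IsCorrect.alpha {F : Forest L V I} {A : Prenex L V 1} {a : V}
    {t : Tree L V I (A.inst (.var a))} (h : IsCorrect T (.tree _ (.alpha A a t) :: F)) :
    IsCorrect T (.tree _ t :: F) := by
  obtain ⟨f, hf, -⟩ := exists_localIso_alpha F A a t
  refine ⟨isStrict_of_localIso hf (fun _ _ _ => trivial) h.strict fun b hb hb' => ?_,
    List.forall_mem_cons.2 ⟨id, (List.forall_mem_cons.1 h.not_isWitness).2⟩,
    isHerbrandStructure_of_disjuncts (disjuncts_alpha F A a t) h.herbrand,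
    (isNet_alpha_iff F A a t).1 h.net⟩
  refine mem_typeFree_tree.2 ((mem_typeFree_tree.1 hb').imp_left fun h' => ?_)
  refine (Prenex.free_inst _ A h').resolve_right fun h' => ?_
  rw [termFree_var] at h'
  obtain rfl : b = a := h'
  exact not_mem_bound_of_alpha h.strict hb

theorem Provable.alpha {F : Forest L V I} {A : Prenex L V 1} {a : V}
    {t : Tree L V I (A.inst (.var a))} (h : IsStrict (.tree _ (.alpha A a t) :: F)) :
    Provable T (.tree _ t :: F) → Provable T (.tree _ (.alpha A a t) :: F) := by
  rintro ⟨π, hπ⟩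
  obtain ⟨h1, h2, h3⟩ := isStrict_iff.1 hπ
  have ha := not_mem_bound_of_alpha h
  refine ⟨.allR F A a t π, isStrict_iff.2 ⟨h1, List.nodup_cons.2
    ⟨fun h => ha ((π.mem_eigenvars a).1 h), h2⟩, fun b hb => avoids_allR.2 ⟨?_, fun hab => ?_⟩⟩⟩
  · exact Set.disjoint_left.1 h.2 ((mem_eigenvars (.allR F A a t π) b).1 hb)
  · exact h3 b ((List.mem_cons.1 hb).resolve_left (Ne.symm hab))

theorem IsCorrect.single {F : Forest L V I} {A : Prenex L V 1} {M : L.Term V}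
    {t : Tree L V I (A.inst M)} (h : IsCorrect T (.tree _ (.sum A 0 (fun _ => M) (fun _ => t)) :: F))
    (hM : Disjoint (bound (.tree _ t :: F)) (termFree M)) : IsCorrect T (.tree _ t :: F) := by
  obtain ⟨f, hf, -⟩ := exists_localIso_single F A M t
  refine ⟨isStrict_of_localIso hf (fun _ _ _ => trivial) h.strict fun b hb hb' => ?_,
    List.forall_mem_cons.2 ⟨id, (List.forall_mem_cons.1 h.not_isWitness).2⟩,
    isHerbrandStructure_of_disjuncts (disjuncts_single F A M t) h.herbrand,
    (isNet_single_iff F A M t hM).1 h.net⟩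
  refine mem_typeFree_tree.2 ((mem_typeFree_tree.1 hb').imp_left fun h' => ?_)
  exact (Prenex.free_inst _ A h').resolve_right (Set.disjoint_left.1 hM hb)

theorem Provable.single {F : Forest L V I} {A : Prenex L V 1} {M : L.Term V}
    {t : Tree L V I (A.inst M)} (h : IsStrict (.tree _ (.sum A 0 (fun _ => M) (fun _ => t)) :: F))
    (hM : Disjoint (bound (.tree _ t :: F)) (termFree M)) : Provable T (.tree _ t :: F) →
      Provable T (.tree _ (.sum A 0 (fun _ => M) (fun _ => t)) :: F) := by
  rintro ⟨π, hπ⟩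
  obtain ⟨h1, h2, h3⟩ := isStrict_iff.1 hπ
  refine ⟨.exR F A M t π, isStrict_iff.2 ⟨h1, h2, fun b hb => avoids_exR.2 ⟨?_, ?_, h3 b hb⟩⟩⟩
  · exact Set.disjoint_left.1 h.2 ((mem_eigenvars (.exR F A M t π) b).1 hb)
  · exact Set.disjoint_left.1 hM ((π.mem_eigenvars b).1 hb)

theorem IsCorrect.contrEx {F : Forest L V I} {A : Prenex L V 1} {m n k : ℕ}
    (e : Fin (m + 1) ⊕ Fin (n + 1) ≃ Fin (k + 1))
    {M : Fin (k + 1) → L.Term V} {t : ∀ j, Tree L V I (A.inst (M j))}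
    (h : IsCorrect T (.tree _ (.sum A k M t) :: F)) :
    IsCorrect T (.tree _ (.sum A m (fun j => M (e (.inl j))) (fun j => t (e (.inl j)))) ::
      .tree _ (.sum A n (fun j => M (e (.inr j))) (fun j => t (e (.inr j)))) :: F) := by
  have hdis := disjuncts_eq_of_labels (labels_contrEx F A m n k e M t)
  obtain ⟨f, D, hf, hD, hD'⟩ := exists_localIso_contrEx F A m n k e M t
  refine ⟨isStrict_of_localIso hf (fun y a hy => ?_) h.strict fun b hb hb' => ?_,
    List.forall_mem_cons.2 ⟨id, List.forall_mem_cons.2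
      ⟨id, (List.forall_mem_cons.1 h.not_isWitness).2⟩⟩,
    isHerbrandStructure_of_disjuncts hdis h.herbrand, (isNet_contr_iff hf hD hD' hdis).1 h.net⟩
  · by_contra hyD
    exact (hD y hyD).label_ne a hy
  · rw [mem_typeFree_tree, mem_typeFree_tree] at hb'
    rw [mem_typeFree_tree]
    tauto

theorem Provable.contrEx {F : Forest L V I} {A : Prenex L V 1} {m n k : ℕ}
    (e : Fin (m + 1) ⊕ Fin (n + 1) ≃ Fin (k + 1))
    {M : Fin (k + 1) → L.Term V} {t : ∀ j, Tree L V I (A.inst (M j))} :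
    Provable T (.tree _ (.sum A m (fun j => M (e (.inl j))) (fun j => t (e (.inl j)))) ::
      .tree _ (.sum A n (fun j => M (e (.inr j))) (fun j => t (e (.inr j)))) :: F) →
    Provable T (.tree _ (.sum A k M t) :: F) := by
  rintro ⟨π, hπ⟩
  obtain ⟨h1, h2, h3⟩ := isStrict_iff.1 hπ
  refine ⟨.contrEx F A m n k e M t π,
    isStrict_iff.2 ⟨h1, h2, fun b hb => avoids_contrEx.2 ⟨fun h => ?_, h3 b hb⟩⟩⟩
  refine (h3 b hb).not_mem_typeFree ?_
  rw [mem_typeFree_tree] at h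
  rw [mem_typeFree_tree, mem_typeFree_tree]
  exact h.imp_right .inr

open Classical in
theorem IsCorrect.contrP {F : Forest L V I} {P : QFF L (V ⊕ Fin 0)} {S₁ S₂ : Finset I}
    {h₁ : S₁.Nonempty} {h₂ : S₂.Nonempty}
    (h : IsCorrect T (.tree _ (.leaf P (S₁ ∪ S₂) (h₁.mono Finset.subset_union_left)) :: F)) :
    IsCorrect T (.tree _ (.leaf P S₁ h₁) :: .tree _ (.leaf P S₂ h₂) :: F) := by
  have hdis := disjuncts_contrP F P S₁ S₂ (h₁.mono Finset.subset_union_left) h₁ h₂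
  obtain ⟨f, D, hf, hD, hD'⟩ := exists_localIso_contrP F P (S₁ ∪ S₂) S₁ S₂
    (h₁.mono Finset.subset_union_left) h₁ h₂
  refine ⟨isStrict_of_localIso hf (fun y a hy => ?_) h.strict fun b hb hb' => ?_,
    List.forall_mem_cons.2 ⟨id, List.forall_mem_cons.2
      ⟨id, (List.forall_mem_cons.1 h.not_isWitness).2⟩⟩,
    isHerbrandStructure_of_disjuncts hdis h.herbrand, (isNet_contr_iff hf hD hD' hdis).1 h.net⟩
  · by_contra hyD
    exact (hD y hyD).label_ne a hy
  · rw [mem_typeFree_tree, mem_typeFree_tree] at hb'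
    rw [mem_typeFree_tree]
    tauto

open Classical in
theorem Provable.contrP {F : Forest L V I} {P : QFF L (V ⊕ Fin 0)} {S₁ S₂ : Finset I}
    {h₁ : S₁.Nonempty} {h₂ : S₂.Nonempty} :
    Provable T (.tree _ (.leaf P S₁ h₁) :: .tree _ (.leaf P S₂ h₂) :: F) →
    Provable T (.tree _ (.leaf P (S₁ ∪ S₂) (h₁.mono Finset.subset_union_left)) :: F) := by
  rintro ⟨π, hπ⟩
  obtain ⟨h1, h2, h3⟩ := isStrict_iff.1 hπ
  refine ⟨.contrP F P S₁ S₂ h₁ h₂ π,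
    isStrict_iff.2 ⟨h1, h2, fun b hb => avoids_contrP.2 ⟨fun h => ?_, h3 b hb⟩⟩⟩
  refine (h3 b hb).not_mem_typeFree ?_
  rw [mem_typeFree_tree] at h
  rw [mem_typeFree_tree, mem_typeFree_tree]
  exact h.imp_right .inr

/-- The eigenvariables of each premise of the cut do not occur in the other premise, so that they are
avoided by its proof. -/
theorem Provable.cut {F₁ F₂ F : Forest L V I} {A : Prenex L V 0} {t : Tree L V I A}
    {s : Tree L V I A.dual} (hF : F.Perm (F₁ ++ F₂)) (h : IsStrict (.cut A t s :: F))
    (hI : Disjoint (indices (.tree _ t :: F₁)) (indices (.tree _ s :: F₂)))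
    (hb₁ : Disjoint (bound (.tree _ t :: F₁)) (A.free ∪ jumps (.tree _ s :: F₂)))
    (hb₂ : Disjoint (bound (.tree _ s :: F₂)) (A.free ∪ jumps (.tree _ t :: F₁)))
    (hb : Disjoint (bound (.tree _ t :: F₁)) (bound (.tree _ s :: F₂))) :
    Provable T (.tree _ t :: F₁) → Provable T (.tree _ s :: F₂) → Provable T (.cut A t s :: F) := by
  rintro ⟨π₁, hπ₁⟩ ⟨π₂, hπ₂⟩
  obtain ⟨h1, h2, h3⟩ := isStrict_iff.1 hπ₁
  obtain ⟨h1', h2', h3'⟩ := isStrict_iff.1 hπ₂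
  replace h := isStrict_perm (hF.cons _) h
  refine Provable.perm (hF.symm.cons _) ⟨.cut F₁ F₂ A t s π₁ π₂, isStrict_iff.2 ⟨?_, ?_, ?_⟩⟩
  · refine List.nodup_append.2 ⟨h1, h1', fun i hi j hj hij => ?_⟩
    exact Set.disjoint_left.1 hI ((π₁.mem_indices i).1 hi) ((π₂.mem_indices i).1 (hij ▸ hj))
  · refine List.nodup_append.2 ⟨h2, h2', fun i hi j hj hij => ?_⟩
    exact Set.disjoint_left.1 hb ((π₁.mem_eigenvars i).1 hi) ((π₂.mem_eigenvars i).1 (hij ▸ hj))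
  · intro a ha
    have hat := Set.disjoint_left.1 h.2 ((mem_eigenvars (.cut F₁ F₂ A t s π₁ π₂) a).1 ha)
    have hat' : a ∉ typeFree F₁ ∧ a ∉ typeFree F₂ := by
      rw [mem_typeFree_cut, mem_typeFree_append] at hat
      exact not_or.1 hat
    refine avoids_cut.2 ⟨hat, ?_⟩
    rcases List.mem_append.1 ha with ha | ha
    · have ha' := (π₁.mem_eigenvars a).1 ha
      have hA := Set.disjoint_left.1 hb₁ ha'
      refine ⟨h3 a ha, (avoids_iff π₂ fun h => ?_).2 ?_⟩
      · exact Set.disjoint_left.1 hb ha' ((π₂.mem_eigenvars a).1 h)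
      · rw [mem_occ, mem_typeFree_tree, Prenex.free_dual]
        rintro (h | h | h)
        · exact hA (.inr h)
        · exact hA (.inl h)
        · exact hat'.2 h
    · have ha' := (π₂.mem_eigenvars a).1 ha
      have hA := Set.disjoint_left.1 hb₂ ha'
      refine ⟨(avoids_iff π₁ fun h => ?_).2 ?_, h3' a ha⟩
      · exact Set.disjoint_left.1 hb ((π₁.mem_eigenvars a).1 h) ha'
      · rw [mem_occ, mem_typeFree_tree]
        rintro (h | h | h)
        · exact hA (.inr h)
        · exact hA (.inl h)
        · exact hat'.1 h

/-- A Herbrand net whose vertices split at a cut into two sub-nets is the conclusion of a cut. -/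
theorem IsCorrect.cut {F : Forest L V I} {A : Prenex L V 0} {t : Tree L V I A}
    {s : Tree L V I A.dual} (h : IsCorrect T (.cut A t s :: F))
    {B C : Set (Node (.cut A t s :: F) ⊕ I)}
    (hB : IsSubnet (Edge (label _) (parent _)) (NodeSwitched (label _)) B)
    (hC : IsSubnet (Edge (label _) (parent _)) (NodeSwitched (label _)) C)
    (hBC : Disjoint B C) (hnB : .inl (cutNode A t s F) ∉ B) (hnC : .inl (cutNode A t s F) ∉ C)
    (hsupp : support (.cut A t s :: F) = insert (.inl (cutNode A t s F)) (B ∪ C))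
    (hlB : .inl (cutLeft A t s F) ∈ B) (hrC : .inl (cutRight A t s F) ∈ C) :
    ∃ F₁ F₂ : Forest L V I, F.Perm (F₁ ++ F₂) ∧ IsCorrect T (.tree _ t :: F₁) ∧
      IsCorrect T (.tree _ s :: F₂) ∧ (Provable T (.tree _ t :: F₁) →
        Provable T (.tree _ s :: F₂) → Provable T (.cut A t s :: F)) := by
  obtain ⟨F₁, F₂, hF, hN₁, hN₂, hI, hb₁, hb₂, f₁, f₂, hf₁, hf₂, hne⟩ :=
    exists_split_cut A t s F hB hC hBC hnB hnC hsupp hlB hrC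
  have hb : Disjoint (bound (.tree _ t :: F₁)) (bound (.tree _ s :: F₂)) := by
    refine Set.disjoint_left.2 ?_
    rintro a ⟨y, hy⟩ ⟨z, hz⟩
    refine hne y z (h.strict.1 a _ _ ?_ ?_)
    · rw [hf₁.label y trivial, hy]
    · rw [hf₂.label z trivial, hz]
  have hT := (h.perm (hF.cons _)).herbrand
  have hempty : ∀ {H : Forest L V I} {i : I}, i ∉ indices H → disjuncts H i = ∅ := fun h =>
    Set.eq_empty_of_forall_notMem fun P hP => h (mem_indices.2 ⟨P, hP⟩)
  have hW := (List.forall_mem_cons.1 h.not_isWitness).2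
  refine ⟨F₁, F₂, hF, ⟨?_, ?_, ?_, hN₁⟩, ⟨?_, ?_, ?_, hN₂⟩, Provable.cut hF h.strict hI hb₁ hb₂ hb⟩
  · refine isStrict_of_localIso hf₁ (fun _ _ _ => trivial) h.strict fun a ha ha' => ?_
    rw [mem_typeFree_cut, typeFree_perm hF, mem_typeFree_append]
    exact .inl ((mem_typeFree_tree.1 ha').resolve_left
      fun h => Set.disjoint_left.1 hb₁ ha (.inl h))
  · exact List.forall_mem_cons.2 ⟨id, fun r hr => hW r (hF.mem_iff.2 (List.mem_append_left _ hr))⟩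
  · intro i hi
    have := hT i (by rw [indices_cut]; exact .inl hi)
    rwa [disjuncts_cut, hempty (Set.disjoint_left.1 hI hi), Set.union_empty] at this
  · refine isStrict_of_localIso hf₂ (fun _ _ _ => trivial) h.strict fun a ha ha' => ?_
    rw [mem_typeFree_cut, typeFree_perm hF, mem_typeFree_append]
    exact .inr ((mem_typeFree_tree.1 ha').resolve_left
      fun h => Set.disjoint_left.1 hb₂ ha (.inl (by rwa [Prenex.free_dual] at h)))
  · exact List.forall_mem_cons.2 ⟨id, fun r hr => hW r (hF.mem_iff.2 (List.mem_append_right _ hr))⟩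
  · intro i hi
    have := hT i (by rw [indices_cut]; exact .inr hi)
    rwa [disjuncts_cut, hempty (Set.disjoint_right.1 hI hi), Set.empty_union] at this

theorem Provable.taut {F : Forest L V I} (i : I) (Ps : List (QFF L (V ⊕ Fin 0)))
    (hF : F = tautForest i Ps) (hne : Ps ≠ []) (h : IsCorrect T F) : Provable T F := by
  subst hF
  have hv : Valid T {P | P ∈ Ps} := by
    have := h.herbrand i (by rw [indices_tautForest i hne]; rfl)
    rwa [disjuncts_tautForest] at this
  refine ⟨.taut i Ps hne hv, isStrict_iff.2 ⟨List.nodup_singleton i, List.nodup_nil, ?_⟩⟩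
  exact fun a ha => absurd ha List.not_mem_nil

end Forest

/-! ### Sequentialization -/

/-- The roots that are conclusions of no invertible rule: neither an `α`-node nor a contraction. -/
inductive Root.IsFinal : Root L V I → Prop
  | leaf (P : QFF L (V ⊕ Fin 0)) (i : I) :
      IsFinal (.tree _ (.leaf P {i} (Finset.singleton_nonempty i)))
  | single (A : Prenex L V 1) (M : L.Term V) (t : Tree L V I (A.inst M)) :
      IsFinal (.tree _ (.sum A 0 (fun _ => M) (fun _ => t)))
  | cut (A : Prenex L V 0) (t : Tree L V I A) (s : Tree L V I A.dual) : IsFinal (.cut A t s)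

namespace Forest

variable {T : L.Theory}

/-- If all roots are final, each root node is a leaf with a single index, a cut, or a sum with a
single summand. -/
theorem root_cases {F : Forest L V I} (hF : ∀ r ∈ F, r.IsFinal) (y : Node F)
    (hy : parent F y = none) : (∃ P i, label F y = .leaf P {i}) ∨ (∃ A, label F y = .cut A) ∨
      (label F y = .plus ∧ ∃ c, ∀ z, parent F z = some y ↔ z = c) := by
  induction F with
  | nil => exact y.elim
  | cons r F ih =>
    obtain ⟨hr, hF⟩ := List.forall_mem_cons.1 hF
    rcases y with y | y
    · cases hr with
      | leaf P i => exact .inl ⟨P, i, rfl⟩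
      | single A M t =>
        have hroot : y = (none : Option (Σ _ : Fin 1, Option t.Node)) :=
          ((Tree.sum A 0 (fun _ => M) (fun _ => t)).parent_eq_none_iff y).1
            (Option.map_eq_none_iff.1 hy)
        subst hroot
        refine .inr (.inr ⟨rfl,
          .inl (some ⟨0, none⟩ : Option (Σ _ : Fin 1, Option t.Node)), ?_⟩)
        rintro ((_ | ⟨k, _ | z⟩) | z)
        · exact ⟨fun h => (by cases h), fun h => (by cases h)⟩
        · obtain rfl : k = 0 := Subsingleton.elim (α := Fin 1) _ _
          exact ⟨fun _ => rfl, fun _ => rfl⟩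
        · exact ⟨fun h => (by cases h), fun h => (by cases h)⟩
        · refine ⟨fun h => ?_, fun h => (by cases h)⟩
          obtain ⟨x, -, hx⟩ := Option.map_eq_some_iff.1 (show (parent F z).map Sum.inr = _ from h)
          cases hx
      | cut A t s =>
        obtain ⟨ρ, hρ⟩ := (Root.cut A t s).exists_root
        have h0 : (none : Option (t.Node ⊕ s.Node)) = ρ := (hρ _).1 rfl
        have h1 : y = ρ := (hρ y).1 (Option.map_eq_none_iff.1 hy)
        rw [← h0] at h1
        subst h1
        exact .inr (.inl ⟨A, rfl⟩)
    · rcases ih hF y (Option.map_eq_none_iff.1 hy) with h | h | ⟨h, c, hc⟩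
      · exact .inl h
      · exact .inr (.inl h)
      · refine .inr (.inr ⟨h, .inr c, ?_⟩)
        rintro (z | z)
        · refine ⟨fun h => ?_, fun h => (by cases h)⟩
          obtain ⟨x, -, hx⟩ := Option.map_eq_some_iff.1 (show (r.parent z).map Sum.inl = _ from h)
          cases hx
        · constructor
          · intro h
            obtain ⟨x, hx, hx'⟩ := Option.map_eq_some_iff.1
              (show (parent F z).map Sum.inr = _ from h)
            rw [(hc z).1 (hx.trans (congrArg some (Sum.inr_injective hx')))]
          · intro h
            exact congrArg (Option.map Sum.inr) ((hc z).2 (Sum.inr_injective h))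

/-- The parent of an `ε`-node, if it is a root, is a sum with a single summand. -/
theorem exists_perm_single {F : Forest L V I} (hF : ∀ r ∈ F, r.IsFinal) {z p : Node F}
    {M : L.Term V} (hz : label F z = .eps M) (hp : parent F z = some p) (hp' : parent F p = none) :
    ∃ (A : Prenex L V 1) (t : Tree L V I (A.inst M)) (F' : Forest L V I),
      F.Perm (.tree _ (.sum A 0 (fun _ => M) (fun _ => t)) :: F') := by
  induction F with
  | nil => exact z.elim
  | cons r F ih =>
    obtain ⟨hr, hF⟩ := List.forall_mem_cons.1 hF
    rcases z with z | z
    · obtain ⟨q, hq, rfl⟩ := Option.map_eq_some_iff.1 (show (r.parent z).map Sum.inl = _ from hp)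
      have hq' : r.parent q = none := Option.map_eq_none_iff.1 hp'
      clear hp hp'
      cases hr with
      | leaf P i => cases hz
      | single A N t =>
        rcases z with _ | ⟨k, _ | z⟩
        · cases hz
        · cases hz
          exact ⟨A, t, F, .refl _⟩
        · rw [← Option.some.inj hq] at hq'
          rcases h : t.parent z with _ | x <;> rw [h] at hq' <;> cases hq'
      | cut A t s =>
        rcases z with _ | z | z
        · cases hz
        · cases hq
          have : t.parent z = none := by
            cases h : t.parent z with
            | none => rfl
            | some x =>
              rw [h] at hq'
              cases hq'
          rw [(t.parent_eq_none_iff z).1 this] at hz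
          exact absurd hz (t.label_root_ne_eps M)
        · cases hq
          have : s.parent z = none := by
            cases h : s.parent z with
            | none => rfl
            | some x =>
              rw [h] at hq'
              cases hq'
          rw [(s.parent_eq_none_iff z).1 this] at hz
          exact absurd hz (s.label_root_ne_eps M)
    · obtain ⟨q, hq, rfl⟩ := Option.map_eq_some_iff.1 (show (parent F z).map Sum.inr = _ from hp)
      obtain ⟨A, t, F', h⟩ := ih hF hz hq (Option.map_eq_none_iff.1 hp')
      exact ⟨A, t, r :: F', (h.cons r).trans (.swap _ _ _)⟩

/-- A forest of leaves with the single index `i` is the conclusion of a tautology rule. -/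
theorem exists_eq_tautForest {F : Forest L V I} (hF : ∀ r ∈ F, r.IsFinal) (i : I)
    (h : ∀ y, ∃ P, label F y = .leaf P {i}) : ∃ Ps, F = tautForest i Ps := by
  induction F with
  | nil => exact ⟨[], rfl⟩
  | cons r F ih =>
    obtain ⟨hr, hF⟩ := List.forall_mem_cons.1 hF
    obtain ⟨Ps, rfl⟩ := ih hF fun y => h (.inr y)
    cases hr with
    | leaf P j =>
      obtain ⟨Q, hQ⟩ := h (.inl ())
      have hj : j = i := by
        injection hQ with _ hS
        exact Finset.singleton_injective hS
      subst hj
      exact ⟨P :: Ps, rfl⟩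
    | single A M t =>
      obtain ⟨Q, hQ⟩ := h (.inl (none : Option (Σ _ : Fin 1, Option t.Node)))
      cases hQ
    | cut A t s =>
      obtain ⟨Q, hQ⟩ := h (.inl (none : Option (t.Node ⊕ s.Node)))
      cases hQ

/-- The vertices of a net that is joined at a cut split into two sub-nets, each containing one of
the trees of the cut. -/
theorem exists_cut_of_isJoin {F : Forest L V I} (hF : IsCorrect T F) {z : Node F}
    {A : Prenex L V 0} (hz : label F z = .cut A) {B C : Set (Node F ⊕ I)}
    (hB : IsSubnet (Edge (label F) (parent F)) (NodeSwitched (label F)) B)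
    (hC : IsSubnet (Edge (label F) (parent F)) (NodeSwitched (label F)) C)
    (hBC : Disjoint B C) (hnB : .inl z ∉ B) (hnC : .inl z ∉ C)
    (hsupp : support F = insert (.inl z) (B ∪ C)) {u w : Node F ⊕ I} (hu : u ∈ B) (hw : w ∈ C)
    (huw : ∀ x, Edge (label F) (parent F) x (.inl z) ↔ x = u ∨ x = w) :
    ∃ (t : Tree L V I A) (s : Tree L V I A.dual) (F₁ F₂ : Forest L V I),
      F.Perm (.cut A t s :: (F₁ ++ F₂)) ∧ IsCorrect T (.tree _ t :: F₁) ∧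
      IsCorrect T (.tree _ s :: F₂) ∧ (Provable T (.tree _ t :: F₁) →
        Provable T (.tree _ s :: F₂) → Provable T F) := by
  obtain ⟨t, s, F', f, hperm, hf, hsurj, hfz⟩ := exists_localIso_of_cut F z hz
  have hinj : Function.Injective f := Set.injOn_univ.1 hf.inj
  have hginj : Function.Injective (Sum.map f id : Node F ⊕ I → _) :=
    Sum.map_injective.2 ⟨hinj, Function.injective_id⟩
  have hB' := hf.isSubnet_image hsurj hB
  have hC' := hf.isSubnet_image hsurj hC
  have hBC' : Disjoint (Sum.map f id '' B) (Sum.map f id '' C) :=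
    (Set.disjoint_image_iff hginj).2 hBC
  have hnB' : .inl (cutNode A t s F') ∉ Sum.map f id '' B := by
    rintro ⟨v, hv, h⟩
    rw [← hfz] at h
    exact hnB (hginj (a₂ := .inl z) h ▸ hv)
  have hnC' : .inl (cutNode A t s F') ∉ Sum.map f id '' C := by
    rintro ⟨v, hv, h⟩
    rw [← hfz] at h
    exact hnC (hginj (a₂ := .inl z) h ▸ hv)
  have hidx : indices (.cut A t s :: F') = indices F :=
    (indices_eq_of_disjuncts (disjuncts_eq_of_labels (labels_perm hperm))).symm
  have hsupp' : support (.cut A t s :: F') =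
      insert (.inl (cutNode A t s F')) (Sum.map f id '' B ∪ Sum.map f id '' C) := by
    have h1 : support (.cut A t s :: F') = Sum.map f id '' support F := by
      ext (y | i)
      · obtain ⟨x, rfl⟩ := hsurj y
        exact iff_of_true (inl_mem_image_union.2 trivial)
          ⟨.inl x, inl_mem_image_union.2 trivial, rfl⟩
      · refine inr_mem_image_union.trans ?_
        rw [hidx]
        constructor
        · exact fun h => ⟨.inr i, inr_mem_image_union.2 h, rfl⟩
        · rintro ⟨x | j, h, hx⟩
          · cases hx
          · cases hx
            exact inr_mem_image_union.1 h
    rw [h1, hsupp, Set.image_insert_eq, Set.image_union, ← hfz]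
    rfl
  have hsrc : ∀ x, Edge (label F) (parent F) x (.inl z) →
      Sum.map f id x = .inl (cutLeft A t s F') ∨ Sum.map f id x = .inl (cutRight A t s F') := by
    intro x hx
    obtain ⟨y, hy, rfl⟩ := (edge_of_not_isSwitched (by rw [hz]; exact id) x).1 hx
    have := (hf.child z trivial y hy).2
    rw [hfz] at this
    exact (edge_cut_iff F' A t s _).1 (.child this)
  have hdis : ∀ {v}, v ∈ Sum.map f id '' B → v ∉ Sum.map f id '' C :=
    fun h => Set.disjoint_left.1 hBC' h
  have hu' := Set.mem_image_of_mem (Sum.map f id) hu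
  have hw' := Set.mem_image_of_mem (Sum.map f id) hw
  have key : ∃ B C : Set (Node (.cut A t s :: F') ⊕ I),
      IsSubnet (Edge (label _) (parent _)) (NodeSwitched (label _)) B ∧
      IsSubnet (Edge (label _) (parent _)) (NodeSwitched (label _)) C ∧ Disjoint B C ∧
      .inl (cutNode A t s F') ∉ B ∧ .inl (cutNode A t s F') ∉ C ∧
      support (.cut A t s :: F') = insert (.inl (cutNode A t s F')) (B ∪ C) ∧
      .inl (cutLeft A t s F') ∈ B ∧ .inl (cutRight A t s F') ∈ C := by
    -- the sources of the cut are in distinct sub-nets, which may have to be exchanged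
    rcases hsrc u ((huw u).2 (.inl rfl)) with h1 | h1 <;>
      rcases hsrc w ((huw w).2 (.inr rfl)) with h2 | h2 <;> rw [h1] at hu' <;> rw [h2] at hw'
    · exact absurd hw' (hdis hu')
    · exact ⟨_, _, hB', hC', hBC', hnB', hnC', hsupp', hu', hw'⟩
    · exact ⟨_, _, hC', hB', hBC'.symm, hnC', hnB', by rw [hsupp', Set.union_comm], hw', hu'⟩
    · exact absurd hw' (hdis hu')
  obtain ⟨B', C', h1, h2, h3, h4, h5, h6, h7, h8⟩ := key
  obtain ⟨F₁, F₂, hF', hc₁, hc₂, hc⟩ := (hF.perm hperm).cut h1 h2 h3 h4 h5 h6 h7 h8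
  exact ⟨t, s, F₁, F₂, hperm.trans (hF'.cons _), hc₁, hc₂,
    fun p₁ p₂ => (hc p₁ p₂).perm hperm.symm⟩

/-- If no invertible rule applies, the last step of the construction of the net yields the last
rule of a proof. -/
theorem provable_of_isFinal {F : Forest L V I} (hF : IsCorrect T F) (hfin : ∀ r ∈ F, r.IsFinal)
    (ih : ∀ G : Forest L V I, weight G < weight F → IsCorrect T G → Provable T G) :
    Provable T F := by
  have hL := F.isLabelled
  have hchild : ∀ {y p : Node F} {P i}, parent F y = some p → label F p ≠ .leaf P {i} := by
    intro y p P i hy hl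
    have := hL.fits p
    rw [hl] at this
    exact Set.eq_empty_iff_forall_notMem.1 this.2 y hy
  have hαroot : ∀ {y : Node F} {a}, parent F y = none → label F y ≠ .alpha a := by
    intro y a hy hl
    rcases root_cases hfin y hy with ⟨P, i, h⟩ | ⟨A, h⟩ | ⟨h, -⟩ <;> rw [h] at hl <;> cases hl
  have hjumps : ∀ {y : Node F} {a}, (label F y).IsSwitched → a ∉ (label F y).jumps := by
    intro y a h
    cases hl : label F y <;> rw [hl] at h <;> first | exact h.elim | exact id
  -- the switched roots, which the last step of the construction disregards
  set R : Set (Node F ⊕ I) := Sum.inl '' {y | parent F y = none ∧ (label F y).IsSwitched}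
  have hR : ∀ r ∈ R, ∃ u, ∀ w, Edge (label F) (parent F) w r ↔ w = u := by
    rintro _ ⟨y, ⟨hy, hsw⟩, rfl⟩
    rcases root_cases hfin y hy with ⟨P, i, h⟩ | ⟨A, h⟩ | ⟨h, c, hc⟩
    · refine ⟨.inr i, fun w => ⟨fun hw => ?_, ?_⟩⟩
      · cases hw with
        | child hw => exact absurd h (hchild hw)
        | jump _ hw => rw [h] at hw; cases hw
        | index hw hi =>
          rw [h] at hw
          cases hw
          rw [Finset.mem_singleton.1 hi]
      · rintro rfl
        exact .index h (Finset.mem_singleton_self i)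
    · rw [h] at hsw
      exact hsw.elim
    · refine ⟨.inl c, fun w => ⟨fun hw => ?_, ?_⟩⟩
      · cases hw with
        | child hw => rw [(hc _).1 hw]
        | jump _ hw => rw [h] at hw; cases hw
        | index hw hi => rw [h] at hw; cases hw
      · rintro rfl
        exact .child ((hc c).2 rfl)
  have hout' : ∀ r ∈ R, ∀ v, ¬ Edge (label F) (parent F) r v := by
    rintro _ ⟨y, ⟨hy, hsw⟩, rfl⟩ v he
    cases he with
    | child h => rw [hy] at h; cases h
    | jump h _ => exact hjumps hsw h
  have hmemR : ∀ {y}, .inl y ∈ R → parent F y = none ∧ (label F y).IsSwitched := by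
    rintro y ⟨x, hx, h⟩
    exact Sum.inl_injective h ▸ hx
  have hinl : ∀ y, .inl y ∈ support F := fun y => inl_mem_image_union.2 trivial
  have := hL.finite
  rcases hF.net.last_cases R (Set.toFinite _ |>.image _) (by rintro _ ⟨y, -, rfl⟩; exact hinl y)
    hR (fun r hr v _ => hout' r hr v) with ⟨v, hv, hX⟩ | ⟨v, hvX, hvR, hv, hdown⟩ |
      ⟨v, hvX, hvR, hv, hdown, hsplit⟩
  · -- a single vertex apart from the roots: a tautology
    have hv' : ∀ y, v ≠ .inl y := by
      rintro y rfl
      cases hl : label F y with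
      | eps M =>
        obtain ⟨x, -, hx⟩ := exists_edge_iff_of_eps hL hl
        exact hv.2 _ ((hx (.inl x)).2 rfl)
      | cut A =>
        obtain ⟨x, w, -, hx⟩ := exists_edge_iff_of_cut hL hl
        exact hv.2 _ ((hx (.inl x)).2 (.inl rfl))
      | _ => exact hv.1 (show (label F y).IsSwitched by rw [hl]; trivial)
    obtain ⟨i, rfl⟩ : ∃ i, v = .inr i := by
      rcases v with y | i
      · exact absurd rfl (hv' y)
      · exact ⟨i, rfl⟩
    have hall : ∀ y, parent F y = none ∧ (label F y).IsSwitched := by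
      intro y
      by_contra h
      have : .inl y ∈ support F \ R := ⟨hinl y, fun ⟨x, hx, he⟩ => h (Sum.inl_injective he ▸ hx)⟩
      rw [hX] at this
      cases this
    have hi : i ∈ indices F := by
      have : .inr i ∈ support F \ R := by rw [hX]; rfl
      exact inr_mem_image_union.1 this.1
    have hlab : ∀ y, ∃ P, label F y = .leaf P {i} := by
      intro y
      obtain ⟨hy, hsw⟩ := hall y
      rcases root_cases hfin y hy with ⟨P, j, h⟩ | ⟨A, h⟩ | ⟨h, c, hc⟩
      · have : .inr j ∈ support F \ R := by
          refine ⟨inr_mem_image_union.2 ⟨y, P, _, h, Finset.mem_singleton_self j⟩, ?_⟩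
          rintro ⟨x, -, hx⟩
          cases hx
        rw [hX] at this
        cases this
        exact ⟨P, h⟩
      · rw [h] at hsw
        exact hsw.elim
      · have := (hc c).2 rfl
        rw [(hall c).1] at this
        cases this
    obtain ⟨Ps, hPs⟩ := exists_eq_tautForest hfin i hlab
    refine Provable.taut i Ps hPs ?_ hF
    rintro rfl
    subst hPs
    obtain ⟨y, -⟩ := hi
    exact y.elim
  · -- a link below which there are only roots: an instance of the `∃`-rule
    obtain ⟨z, rfl⟩ : ∃ z, v = .inl z := by
      rcases v with z | i
      · exact ⟨z, rfl⟩
      · obtain ⟨u, hu⟩ := hv.1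
        exact absurd hu ((isBase_inr i).2 u)
    cases hp : parent F z with
    | none =>
      rcases root_cases hfin z hp with ⟨P, i, h⟩ | ⟨A, h⟩ | ⟨h, -⟩
      · exact absurd ⟨z, ⟨hp, by rw [h]; trivial⟩, rfl⟩ hvR
      · exact absurd hv (isJoin_of_cut hL h).not_isLink
      · exact absurd ⟨z, ⟨hp, by rw [h]; trivial⟩, rfl⟩ hvR
    | some p =>
      obtain ⟨hp', hsw⟩ := hmemR (hdown _ (hinl p) (.child hp))
      obtain ⟨M, hM⟩ : ∃ M, label F z = .eps M := by
        rcases root_cases hfin p hp' with ⟨P, i, h⟩ | ⟨A, h⟩ | ⟨h, -⟩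
        · exact absurd h (hchild hp)
        · rw [h] at hsw
          exact hsw.elim
        · have := hL.fits p
          rw [h] at this
          exact this.2 z hp
      have hdis : Disjoint (bound F) (termFree M) := by
        refine Set.disjoint_left.2 ?_
        rintro a ⟨w, hw⟩ ha
        exact hαroot (hmemR (hdown (.inl w) (hinl w)
          (.jump (a := a) (by rw [hM]; exact ha) hw))).1 hw
      obtain ⟨A, t, F', hperm⟩ := exists_perm_single hfin hM hp hp'
      have hF' := hF.perm hperm
      have hdis' : Disjoint (bound (.tree _ t :: F')) (termFree M) := by
        refine hdis.mono_left fun a ha => ?_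
        rw [mem_bound, labels_perm hperm, labels_cons, Root.labels_tree, Tree.labels_sum]
        rw [mem_bound, labels_cons, Root.labels_tree] at ha
        refine ha.imp_left fun h => .inr (Set.mem_iUnion.2 ⟨0, .inr h⟩)
      refine Provable.perm hperm.symm (Provable.single hF'.strict hdis'
        (ih _ ?_ (hF'.single hdis')))
      rw [weight_perm hperm]
      simp [weight_cons, Root.weight, Tree.weight]
  · -- a join below which there are only roots: an instance of the cut rule
    obtain ⟨z, rfl⟩ : ∃ z, v = .inl z := by
      rcases v with z | i
      · exact ⟨z, rfl⟩
      · exact absurd (isBase_inr i) hv.not_isBase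
    obtain ⟨A, hA⟩ : ∃ A, label F z = .cut A := by
      cases hl : label F z with
      | eps M => exact absurd (isLink_of_eps hL hl) hv.not_isLink
      | cut A => exact ⟨A, rfl⟩
      | _ => exact absurd (show (label F z).IsSwitched by rw [hl]; trivial) hv.1
    obtain ⟨B, C, hB, hC, hBC, hnB, hnC, hX, u, hu, w, hw, huw⟩ := hsplit (by
      rintro _ ⟨y, ⟨hy, hsw⟩, rfl⟩ he
      cases he with
      | child h =>
        rcases root_cases hfin y hy with ⟨P, i, hl⟩ | ⟨B, hl⟩ | ⟨hl, -⟩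
        · exact hchild h hl
        · rw [hl] at hsw
          exact hsw
        · have := hL.fits y
          rw [hl] at this
          obtain ⟨M, hM⟩ := this.2 z h
          rw [hA] at hM
          cases hM
      | jump _ h => exact hαroot hy h)
    obtain ⟨t, s, F₁, F₂, hperm, hc₁, hc₂, hc⟩ :=
      exists_cut_of_isJoin hF hA hB hC hBC hnB hnC hX hu hw huw
    have hw := weight_perm hperm
    simp only [weight_cons, weight_append, Root.weight] at hw
    refine hc (ih _ ?_ hc₁) (ih _ ?_ hc₂) <;> simp only [weight_cons, Root.weight] <;> omega

/-- A root that is not final is the conclusion of an invertible rule, unless it is a witness. -/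
theorem provable_of_not_isFinal {r : Root L V I} {F : Forest L V I} (hr : ¬ r.IsFinal)
    (hF : IsCorrect T (r :: F))
    (ih : ∀ G : Forest L V I, weight G < weight (r :: F) → IsCorrect T G → Provable T G) :
    Provable T (r :: F) := by
  classical
  cases r with
  | witness A M t => exact absurd trivial (hF.not_isWitness _ List.mem_cons_self)
  | cut A t s => exact absurd (.cut A t s) hr
  | tree A t =>
    cases t with
    | alpha A a t =>
      refine Provable.alpha hF.strict (ih _ ?_ hF.alpha)
      simp [weight_cons, Root.weight, Tree.weight]
    | leaf P S hS =>
      obtain ⟨i, hi⟩ := hS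
      have hS' : (S.erase i).Nonempty := by
        by_contra h
        rw [Finset.not_nonempty_iff_eq_empty, Finset.erase_eq_empty_iff] at h
        rcases h with rfl | rfl
        · exact absurd hi (Finset.notMem_empty i)
        · exact hr (.leaf P i)
      have hcard := Finset.card_erase_of_mem hi
      have hpos := hS'.card_pos
      obtain ⟨S', hS'', hiS'⟩ : ∃ S', S'.Nonempty ∧ S = {i} ∪ S' ∧ S'.card = S.card - 1 :=
        ⟨S.erase i, hS', (by rw [← Finset.insert_eq, Finset.insert_erase hi]), hcard⟩
      obtain ⟨rfl, hc⟩ := hiS'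
      refine Provable.contrP (ih _ ?_ (hF.contrP (h₁ := Finset.singleton_nonempty i) (h₂ := hS'')))
      simp only [weight_cons, Root.weight, Tree.weight, Finset.card_singleton]
      omega
    | sum A n M t =>
      cases n with
      | zero =>
        obtain ⟨N, rfl⟩ : ∃ N, M = fun _ => N :=
          ⟨M 0, funext fun k => congrArg M (Subsingleton.elim (α := Fin 1) k 0)⟩
        obtain ⟨s, rfl⟩ : ∃ s, t = fun _ => s :=
          ⟨t 0, funext fun k => congrArg t (Subsingleton.elim (α := Fin 1) k 0)⟩
        exact absurd (.single A N s) hr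
      | succ n =>
        let e : Fin (0 + 1) ⊕ Fin (n + 1) ≃ Fin (n + 1 + 1) :=
          finSumFinEquiv.trans (finCongr (by omega))
        exact Provable.contrEx e (ih _ (weight_contrEx_lt F A 0 n (n + 1) e M t) (hF.contrEx e))

/-- Induction on the weight, the invertible rules being applied first. -/
theorem IsCorrect.provable {F : Forest L V I} (hF : IsCorrect T F) : Provable T F := by
  induction hn : weight F using Nat.strong_induction_on generalizing F with
  | _ n ih =>
    replace ih : ∀ G : Forest L V I, weight G < weight F → IsCorrect T G → Provable T G :=
      fun G hG h => ih _ (hn ▸ hG) h rfl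
    by_cases hfin : ∀ r ∈ F, r.IsFinal
    · exact provable_of_isFinal hF hfin ih
    · push Not at hfin
      obtain ⟨r, hr, hrF⟩ := hfin
      obtain ⟨F₁, F₂, rfl⟩ := List.append_of_mem hr
      have hperm : (F₁ ++ r :: F₂).Perm (r :: (F₁ ++ F₂)) := List.perm_middle
      rw [weight_perm hperm] at ih
      exact (provable_of_not_isFinal hrF (hF.perm hperm) ih).perm hperm.symm

end Forest

end Herbrand

theorem mainTheorem2 {L : FirstOrder.Language} {V : Type*} {I : Type*}
    (T : L.Theory) (F : Herbrand.Forest L V I)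
    (hF : Herbrand.Forest.IsAnnotatedSequent F) :
    Herbrand.Forest.IsHerbrandNet T F ↔
      ∃ π : Herbrand.Proof T F, π.IsStrict := by
  constructor
  · rintro ⟨-, hT, hN⟩
    exact Herbrand.Forest.IsCorrect.provable
      ⟨hF.1, hF.2, hT, (Herbrand.Forest.isACC_iff_isNet F).1 hN⟩
  · rintro ⟨π, hπ⟩
    obtain ⟨hT, hN⟩ := π.correct_of_isStrict hπ
    exact ⟨hF, hT, (Herbrand.Forest.isACC_iff_isNet F).2 hN⟩
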